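/- Let $x_I>0$ and $h\in\mathbb R$. Let $V$ be a real potential on $[0,\infty)$ with $V,V'\in L^1(0,\infty)$ (we take $V$ to be its absolutely continuous representative), with $\operatorname{supp}V\subset[0,x_I]$, and such that $(x_I-\epsilon,x_I)\cap\operatorname{supp}V$ has positive Lebesgue measure for every $\epsilon>0$. Consider $-u''+Vu=k^2u$ on $[0,\infty)$ with the boundary condition $u'(0)+hu(0)=0$. Let $f(x,k)$ be the Jost solution, i.e. the solution with $f(x,k)=e^{ikx}$ for $x>x_I$; let $f_h(k)=hf(0,k)+f'(0,k)$ be the Jost function; and let $\varphi(x,k)$ be the regular solution, i.e. the solution with $\varphi(0,k)=1$, $\varphi'(0,k)=-h$. Let $M(\lambda)=f(0,k)/f_h(k)$, $\lambda=k^2$, $\operatorname{Im}k>0$, be the Weyl function. For $\lambda>0$ put $M^\pm(\lambda)=\lim_{z\to0,\ \operatorname{Re}z>0}M(\lambda\pm iz)$, and for real $k\neq0$ put $$j(k)=M^{\pm}(k^2)-\frac1{ik},\qquad \pm k>0 .$$ Let $k_1,\dots,k_N$ be the zeros of $f_h$ in $\{\operatorname{Im}k>0\}$ (there are finitely many) and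 let $\alpha_j=\operatorname{Res}_{\lambda=k_j^2}M(\lambda)$. Define $$g(x,y)=\frac i\pi\int_{-\infty}^{\infty}k\cos(kx)\,j(k)\cos(ky)\,dk+\sum_{j=1}^N\cos(k_jx)\,\alpha_j\cos(k_jy)\qquad(x,y\in\mathbb R),$$ $$K(x,y)=\frac i\pi\int_{-\infty}^{\infty}k\,\varphi(x,k)\,j(k)\cos(ky)\,dk+\sum_{j=1}^N\varphi(x,k_j)\,\alpha_j\cos(k_jy)\qquad(x\ge0,\ y\in\mathbb R),$$ where $\int_{-\infty}^\infty=\lim_{R\to\infty}\int_{-R}^{R}$. Then these integrals converge; for all $x\ge0$ and $y\le x$ the function $s\mapsto K(x,s)g(s,y)$ is integrable on $[-x,x]$ and $K$ satisfies the Gelfand--Levitan equation $$K(x,y)-g(x,y)+\frac12\int_{-x}^{x}K(x,s)\,g(s,y)\,ds=0;$$ and the potential is recovered by $$V(x)=-2\,\frac{d}{dx}K(x,x)\qquad\text{for all }x\ge0$$ (the derivative exists, and is one-sided at $x=0$). -/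

import Mathlib

open MeasureTheory Filter Topology Set

noncomputable section

namespace LoveProblem

/-- The class `𝕍¹_{x_I}` of real potentials on `[0, ∞)` with `V, V' ∈ L¹(0, ∞)`, with support in
`[0, x_I]` and with `supp V ∩ (x_I - ε, x_I)` of positive measure for all `ε > 0`. A function
with a weak derivative in `L¹` is represented by its absolutely continuous version. The values of
`V` on the negative half-line play no role. -/
structure IsPotential (xI : ℝ) (V : ℝ → ℝ) : Prop where
  integrable : IntegrableOn V (Ioi 0)
  deriv_integrable : ∃ V' : ℝ → ℝ, IntegrableOn V' (Ioi 0) ∧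
    ∀ x, 0 ≤ x → V x = V 0 + ∫ t in (0 : ℝ)..x, V' t
  eq_zero : ∀ x, xI < x → V x = 0
  support_pos : ∀ ε : ℝ, 0 < ε → 0 < volume (Ioo (xI - ε) xI ∩ tsupport V)

/-- `u` solves `-u'' + V u = k² u` on `[0, ∞)`, and `u'` is its derivative
(one-sided derivatives at `0`). -/
def IsSolution (V : ℝ → ℝ) (k : ℂ) (u u' : ℝ → ℂ) : Prop :=
  ∀ x, 0 ≤ x → HasDerivWithinAt u (u' x) (Ici 0) x ∧
    HasDerivWithinAt u' (((V x : ℂ) - k ^ 2) * u x) (Ici 0) x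

/-- `u` solves the equation and `u(x) = e^{ikx}` for `x > x_I`. -/
def IsJostSolution (V : ℝ → ℝ) (xI : ℝ) (k : ℂ) (u : ℝ → ℂ) : Prop :=
  (∃ u' : ℝ → ℂ, IsSolution V k u u') ∧
    ∀ x, 0 ≤ x → xI < x → u x = Complex.exp (Complex.I * k * x)

/-- The Jost solution `f(x, k)`, unique on `x ≥ 0`. -/
def jost (V : ℝ → ℝ) (xI : ℝ) (x : ℝ) (k : ℂ) : ℂ :=
  Classical.epsilon (IsJostSolution V xI k) x

/-- The Jost function `f_h(k) = h f(0, k) + f'(0, k)`. -/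
def jostFun (V : ℝ → ℝ) (xI h : ℝ) (k : ℂ) : ℂ :=
  jost V xI 0 k * h + derivWithin (fun x => jost V xI x k) (Ici 0) 0

/-- `u` solves the equation with `u(0) = 1`, `u'(0) = -h`. -/
def IsRegularSolution (V : ℝ → ℝ) (h : ℝ) (k : ℂ) (u : ℝ → ℂ) : Prop :=
  ∃ u' : ℝ → ℂ, IsSolution V k u u' ∧ u 0 = 1 ∧ u' 0 = -h

/-- The regular solution `φ(x, k)`, unique on `x ≥ 0`. -/
def regular (V : ℝ → ℝ) (h : ℝ) (x : ℝ) (k : ℂ) : ℂ :=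
  Classical.epsilon (IsRegularSolution V h k) x

/-- The square root `k` of `λ` with `Im k > 0`, for `λ` outside the cut `[0, ∞)`. -/
def upperSqrt (lam : ℂ) : ℂ := Complex.I * (-lam) ^ (1 / 2 : ℂ)

/-- The Weyl function `M(λ) = f(0, k) / f_h(k)`, `λ = k²`, `Im k > 0`. -/
def weyl (V : ℝ → ℝ) (xI h : ℝ) (lam : ℂ) : ℂ :=
  jost V xI 0 (upperSqrt lam) / jostFun V xI h (upperSqrt lam)

/-- The boundary value `M⁺(λ)`, the limit of `M(λ + iz)` as `z → 0` with `Re z > 0`. -/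
def upperValue (M : ℂ → ℂ) (lam : ℂ) : ℂ :=
  limUnder (𝓝[{z : ℂ | 0 < z.re}] 0) fun z => M (lam + Complex.I * z)

/-- The boundary value `M⁻(λ)`, the limit of `M(λ - iz)` as `z → 0` with `Re z > 0`. -/
def lowerValue (M : ℂ → ℂ) (lam : ℂ) : ℂ :=
  limUnder (𝓝[{z : ℂ | 0 < z.re}] 0) fun z => M (lam - Complex.I * z)

/-- `j(k) = M(λ) - 1/(ik)` for real `k ≠ 0`, with `M = M⁺` for `k > 0` and `M = M⁻` for `k < 0`
and `λ = k²`. -/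
def jFun (M : ℂ → ℂ) (k : ℝ) : ℂ :=
  (if 0 < k then upperValue M ((k : ℂ) ^ 2) else lowerValue M ((k : ℂ) ^ 2))
    - 1 / (Complex.I * k)

/-- The residue of `F` at an isolated singularity `z₀`: the integral over small circles. -/
def residue (F : ℂ → ℂ) (z₀ : ℂ) : ℂ :=
  limUnder (𝓝[>] (0 : ℝ)) fun r =>
    (2 * (Real.pi : ℂ) * Complex.I)⁻¹ * ∮ z in C(z₀, r), F z

/-- The eigenvalues `k_j`: the zeros of the Jost function in the open upper half-plane. -/
def eigenvalues (V : ℝ → ℝ) (xI h : ℝ) : Set ℂ :=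
  {k : ℂ | 0 < k.im ∧ jostFun V xI h k = 0}

/-- The normalizing constant `α_j = Res_{λ = k_j²} M(λ)`. -/
def normConst (V : ℝ → ℝ) (xI h : ℝ) (k : ℂ) : ℂ :=
  residue (weyl V xI h) (k ^ 2)

/-- The integral over the real line in the principal value sense at infinity. -/
def pvIntegral (F : ℝ → ℂ) : ℂ :=
  limUnder atTop fun R : ℝ => ∫ k in (-R)..R, F k

/-- The principal value integral of `F` exists. -/
def PVConverges (F : ℝ → ℂ) : Prop :=
  (∀ R : ℝ, IntervalIntegrable F volume (-R) R) ∧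
    ∃ L : ℂ, Tendsto (fun R : ℝ => ∫ k in (-R)..R, F k) atTop (𝓝 L)

/-- The integrand of `g(x, y)`: `k cos(kx) j(k) cos(ky)`. -/
def gIntegrand (V : ℝ → ℝ) (xI h x y k : ℝ) : ℂ :=
  k * Complex.cos (k * x) * jFun (weyl V xI h) k * Complex.cos (k * y)

/-- `g(x, y) = (i/π) ∫ k cos(kx) j(k) cos(ky) dk + ∑ⱼ cos(k_j x) α_j cos(k_j y)`. -/
def gKernel (V : ℝ → ℝ) (xI h x y : ℝ) : ℂ :=
  Complex.I / Real.pi * pvIntegral (gIntegrand V xI h x y) +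
    ∑ᶠ k ∈ eigenvalues V xI h,
      Complex.cos (k * x) * normConst V xI h k * Complex.cos (k * y)

/-- The integrand of `K(x, y)`: `k φ(x, k) j(k) cos(ky)`. -/
def KIntegrand (V : ℝ → ℝ) (xI h x y k : ℝ) : ℂ :=
  k * regular V h x k * jFun (weyl V xI h) k * Complex.cos (k * y)

/-- `K(x, y) = (i/π) ∫ k φ(x, k) j(k) cos(ky) dk + ∑ⱼ φ(x, k_j) α_j cos(k_j y)`. -/
def KKernel (V : ℝ → ℝ) (xI h x y : ℝ) : ℂ :=
  Complex.I / Real.pi * pvIntegral (KIntegrand V xI h x y) +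
    ∑ᶠ k ∈ eigenvalues V xI h,
      regular V h x k * normConst V xI h k * Complex.cos (k * y)

end LoveProblem

end

open LoveProblem

/-! The proof rests on a transformation operator. For each x ≥ 0 there is a continuous even kernel
κ(x, ·) (`transKernel`) with φ(x,k) = cos kx − ∫₀ˣ κ(x,t) cos kt dt for all complex k, and κ(x,x) =
h − ½∫₀ˣ V. It comes from a Paley–Wiener argument: the Volterra equation gives φ = cos kx − κ(x,x)
sin(kx)/k + O(e^{x Im k}/|k|²) in the upper half-plane (`regular_asymptotics`), so the cosine
transform of the remainder vanishes at and beyond x (`cosTransform_regRem_eq_zero`), and Fourier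
inversion followed by analytic continuation represents the remainder (`regRem_eq_integral`).

The spectral kernel K coincides with κ for |y| < x (`KKernel_eq_transKernel`). Let θ be the solution
with data (0,1) at 0. Then f(x,k) = f(0,k) φ(x,k) + f_h(k) θ(x,k), so k φ j cos(ky) splits into
three pieces. The first, k f(x,k) cos(ky)/f_h − e^{ikx} cos(ky)/i, is integrated by closing the
contour upwards, and its residues cancel the sum over eigenvalues. The second, (cos kx − φ)
cos(ky)/i, yields κ through Dirichlet's integral and the cosine transform. The third is odd and
integrates to zero. Green's identity (`abs_re_mul_exp_le`) shows that f_h vanishes in the closed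
upper half-plane only on the imaginary axis, and that all these zeros, including a possible one at
0, are simple and finite in number.

Inserting the representation of φ into the definition of K and exchanging integrals gives K(x,y) =
g(x,y) − ∫₀ˣ κ(x,s) g(s,y) ds for every real y (`KKernel_eq_gKernel_sub`). Since K = κ inside and
both K and g are even in s, this is the Gelfand–Levitan equation.

On the diagonal, K and κ are continuous in y, so K(x,x) = h − ½∫₀ˣ V for x > 0; the corner K(0,0) =
h is a separate contour integral (`KKernel_zero_zero`). Differentiation recovers V. Convergence of
the principal values follows from k j(k) = h/k + O(1/k²): subtracting the odd function hk/(1+k²)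
leaves an absolutely integrable density. -/

noncomputable section

namespace LoveProblem

/-! ### Solutions on the half-line, holomorphic in k, by a weighted Volterra equation -/

open BoundedContinuousFunction in
/-- The operator `v ↦ ∫₀^{x⁺} e^{-ω (x⁺ - t)} v(t) dt` on bounded continuous functions. -/
def weightedPrimitive (ω : ℝ) (hω : 0 < ω) : (ℝ →ᵇ ℂ) →L[ℂ] (ℝ →ᵇ ℂ) :=
  LinearMap.mkContinuous
    { toFun := fun v => BoundedContinuousFunction.ofNormedAddCommGroup
        -- Everything is frozen to the left of 0, so that the operator acts on bounded continuous
        -- functions on the whole line.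
        (fun x => (Real.exp (-ω * max x 0) : ℂ) * ∫ t in (0 : ℝ)..max x 0,
          (Real.exp (ω * t) : ℂ) * v t)
        (by
          have h1 : Continuous fun y : ℝ => ∫ t in (0 : ℝ)..y, (Real.exp (ω * t) : ℂ) * v t :=
            intervalIntegral.continuous_primitive
              (fun a b => Continuous.intervalIntegrable (by fun_prop) a b) 0
          exact (by fun_prop : Continuous fun x : ℝ => (Real.exp (-ω * max x 0) : ℂ)).mul
            (h1.comp (by fun_prop : Continuous fun x : ℝ => max x 0)))
        (‖v‖ / ω)
        (by
          intro x
          set y := max x 0 with hy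
          have hy0 : 0 ≤ y := le_max_right _ _
          have h2 : ‖∫ t in (0 : ℝ)..y, (Real.exp (ω * t) : ℂ) * v t‖ ≤
              ∫ t in (0 : ℝ)..y, ‖v‖ * Real.exp (ω * t) := by
            apply intervalIntegral.norm_integral_le_of_norm_le hy0
            · refine Eventually.of_forall fun t _ => ?_
              rw [norm_mul, mul_comm]
              simp only [Complex.norm_real, Real.norm_eq_abs, Real.abs_exp]
              gcongr
              exact v.norm_coe_le_norm t
            · exact Continuous.intervalIntegrable (by fun_prop) _ _
          have h3 : ∫ t in (0 : ℝ)..y, ‖v‖ * Real.exp (ω * t) =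
              ‖v‖ * ((Real.exp (ω * y) - 1) / ω) := by
            rw [intervalIntegral.integral_const_mul]
            congr 1
            rw [intervalIntegral.integral_comp_mul_left (fun t => Real.exp t) hω.ne']
            simp [integral_exp]
            field_simp
          rw [norm_mul]
          simp only [Complex.norm_real, Real.norm_eq_abs, Real.abs_exp]
          calc Real.exp (-ω * y) * ‖∫ t in (0 : ℝ)..y, (Real.exp (ω * t) : ℂ) * v t‖
              ≤ Real.exp (-ω * y) * (‖v‖ * ((Real.exp (ω * y) - 1) / ω)) := by
                rw [← h3]; gcongr
            _ = ‖v‖ / ω * (1 - Real.exp (-ω * y)) := by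
                have : Real.exp (-ω * y) * Real.exp (ω * y) = 1 := by
                  rw [← Real.exp_add]; simp
                calc Real.exp (-ω * y) * (‖v‖ * ((Real.exp (ω * y) - 1) / ω))
                    = ‖v‖ / ω * (Real.exp (-ω * y) * Real.exp (ω * y) - Real.exp (-ω * y)) := by
                      ring
                  _ = _ := by rw [this]
            _ ≤ ‖v‖ / ω * 1 := by
                gcongr
                linarith [Real.exp_pos (-ω * y)]
            _ = ‖v‖ / ω := mul_one _)
      map_add' := by
        intro v w
        ext x
        simp only [BoundedContinuousFunction.coe_ofNormedAddCommGroup,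
          BoundedContinuousFunction.coe_add, Pi.add_apply]
        rw [← mul_add, ← intervalIntegral.integral_add]
        · simp only [mul_add]
        · exact Continuous.intervalIntegrable (by fun_prop) _ _
        · exact Continuous.intervalIntegrable (by fun_prop) _ _
      map_smul' := by
        intro c v
        ext x
        simp only [BoundedContinuousFunction.coe_ofNormedAddCommGroup,
          BoundedContinuousFunction.coe_smul, RingHom.id_apply, smul_eq_mul]
        have : ∀ t, (Real.exp (ω * t) : ℂ) * (c * v t) = c * ((Real.exp (ω * t) : ℂ) * v t) :=
          fun t => by ring
        simp only [this, intervalIntegral.integral_const_mul]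
        ring }
    (1 / ω)
    (by
      intro v
      rw [one_div_mul_eq_div]
      simp only [LinearMap.coe_mk, AddHom.coe_mk]
      exact BoundedContinuousFunction.norm_ofNormedAddCommGroup_le _
        (div_nonneg (norm_nonneg v) hω.le) _)

open BoundedContinuousFunction in
lemma weightedPrimitive_apply (ω : ℝ) (hω : 0 < ω) (v : ℝ →ᵇ ℂ) (x : ℝ) :
    weightedPrimitive ω hω v x = (Real.exp (-ω * max x 0) : ℂ) * ∫ t in (0 : ℝ)..max x 0,
          (Real.exp (ω * t) : ℂ) * v t := rfl

lemma norm_weightedPrimitive_le (ω : ℝ) (hω : 0 < ω) : ‖weightedPrimitive ω hω‖ ≤ 1 / ω :=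
  LinearMap.mkContinuous_norm_le _ (by positivity) _

open BoundedContinuousFunction in
/-- The Volterra operator of the first order system `u' = w`, `w' = (q - k²) u`, conjugated by
the weight `e^{ω x}`. -/
def systemOp (ω : ℝ) (hω : 0 < ω) (q : ℝ →ᵇ ℂ) (k : ℂ) :
    ((ℝ →ᵇ ℂ) × (ℝ →ᵇ ℂ)) →L[ℂ] ((ℝ →ᵇ ℂ) × (ℝ →ᵇ ℂ)) :=
  ((weightedPrimitive ω hω).comp (ContinuousLinearMap.snd ℂ _ _)).prod
    (((weightedPrimitive ω hω).comp (ContinuousLinearMap.mul ℂ (ℝ →ᵇ ℂ) q)).comp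
      (ContinuousLinearMap.fst ℂ _ _)) -
  k ^ 2 • (0 : ((ℝ →ᵇ ℂ) × (ℝ →ᵇ ℂ)) →L[ℂ] (ℝ →ᵇ ℂ)).prod
    ((weightedPrimitive ω hω).comp (ContinuousLinearMap.fst ℂ _ _))

-- Each weighted primitive gains a factor 1/ω. For large ω the operator is therefore a contraction
-- on the whole half-line at once, uniformly for k in a disc.
open BoundedContinuousFunction in
lemma norm_systemOp_le (ω : ℝ) (hω : 0 < ω) (q : ℝ →ᵇ ℂ) (k : ℂ) :
    ‖systemOp ω hω q k‖ ≤ (1 + ‖q‖ + ‖k‖ ^ 2) / ω := by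
  refine ContinuousLinearMap.opNorm_le_bound _ (by positivity) fun v => ?_
  obtain ⟨v1, v2⟩ := v
  have hJ : ∀ w : ℝ →ᵇ ℂ, ‖weightedPrimitive ω hω w‖ ≤ ‖w‖ / ω := fun w =>
    ((weightedPrimitive ω hω).le_opNorm w).trans (by
      have := norm_weightedPrimitive_le ω hω
      calc _ ≤ 1 / ω * ‖w‖ := by gcongr
        _ = _ := by ring)
  have h1 : ‖v1‖ ≤ ‖(v1, v2)‖ := norm_fst_le (v1, v2)
  have h2 : ‖v2‖ ≤ ‖(v1, v2)‖ := norm_snd_le (v1, v2)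
  have e : systemOp ω hω q k (v1, v2) =
      (weightedPrimitive ω hω v2, weightedPrimitive ω hω (q * v1) -
        k ^ 2 • weightedPrimitive ω hω v1) := by
    simp [systemOp]
  rw [e]
  set N := ‖(v1, v2)‖
  have hN : 0 ≤ N := norm_nonneg _
  have a1 : ‖weightedPrimitive ω hω v2‖ ≤ N / ω := (hJ v2).trans (by gcongr)
  have a2 : ‖weightedPrimitive ω hω (q * v1)‖ ≤ ‖q‖ * N / ω := (hJ _).trans (by
    gcongr
    exact (norm_mul_le _ _).trans (by gcongr))
  have a3 : ‖k ^ 2 • weightedPrimitive ω hω v1‖ ≤ ‖k‖ ^ 2 * N / ω := by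
    rw [norm_smul, norm_pow, mul_div_assoc]
    gcongr
    exact (hJ v1).trans (by gcongr)
  have : (1 + ‖q‖ + ‖k‖ ^ 2) / ω * N = N / ω + ‖q‖ * N / ω + ‖k‖ ^ 2 * N / ω := by ring
  rw [this]
  have p1 : 0 ≤ ‖q‖ * N / ω := by positivity
  have p2 : 0 ≤ ‖k‖ ^ 2 * N / ω := by positivity
  have p3 : 0 ≤ N / ω := by positivity
  refine max_le (by dsimp only; linarith) ?_
  dsimp only
  linarith [norm_sub_le (weightedPrimitive ω hω (q * v1)) (k ^ 2 • weightedPrimitive ω hω v1)]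

/-- Inversion is differentiable at the units of a Banach algebra, so the solution of (1 − T k) w = v
inherits the holomorphy of T. -/
lemma differentiableAt_inverse_one_sub_apply {E : Type*} [NormedAddCommGroup E] [NormedSpace ℂ E]
    [CompleteSpace E] {T : ℂ → E →L[ℂ] E} {k : ℂ} (hT : DifferentiableAt ℂ T k)
    (hk : ‖T k‖ < 1) (v : E) : DifferentiableAt ℂ (fun k => Ring.inverse (1 - T k) v) k := by
  have h0 : DifferentiableAt ℂ (fun k => 1 - T k) k := hT.const_sub 1
  have h1 := differentiableAt_inverse (𝕜 := ℂ) (isUnit_one_sub_of_norm_lt_one hk)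
  have h2 : DifferentiableAt ℂ (fun k => Ring.inverse (1 - T k)) k :=
    DifferentiableAt.fun_comp' k h1 h0
  exact h2.clm_apply (differentiableAt_const _)

open BoundedContinuousFunction in
/-- Existence of solutions of `u'' = (q - k²) u` on the half-line with given initial values,
depending holomorphically on `k` in a disc. -/
lemma exists_holomorphic_solution (q : ℝ →ᵇ ℂ) (R : ℝ) (a b : ℂ) :
    ∃ u u' : ℂ → ℝ → ℂ,
      (∀ k ∈ Metric.ball (0 : ℂ) R, u k 0 = a ∧ u' k 0 = b ∧ ∀ x, 0 ≤ x →
        HasDerivAt (u k) (u' k x) x ∧ HasDerivAt (u' k) ((q x - k ^ 2) * u k x) x) ∧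
      ∀ x, 0 ≤ x → DifferentiableOn ℂ (fun k => u k x) (Metric.ball 0 R) ∧
        DifferentiableOn ℂ (fun k => u' k x) (Metric.ball 0 R) := by
  -- Strictly larger than 1 + ‖q‖ + |k|² for |k| < R, which makes the operator norm less than 1.
  set ω : ℝ := 2 + ‖q‖ + R ^ 2 with hωdef
  have hω : 0 < ω := by positivity
  let v0 : ℂ → (ℝ →ᵇ ℂ) := fun c => BoundedContinuousFunction.ofNormedAddCommGroup
    (fun x => (Real.exp (-ω * max x 0) : ℂ) * c) (by fun_prop) ‖c‖ (by
      intro x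
      rw [norm_mul]
      simp only [Complex.norm_real, Real.norm_eq_abs, Real.abs_exp]
      have : Real.exp (-ω * max x 0) ≤ 1 := Real.exp_le_one_iff.mpr (by
        have := mul_nonneg hω.le (le_max_right x 0)
        linarith)
      exact mul_le_of_le_one_left (norm_nonneg _) this)
  let T := systemOp ω hω q
  let v : ℂ → (ℝ →ᵇ ℂ) × (ℝ →ᵇ ℂ) := fun k => Ring.inverse (1 - T k) (v0 a, v0 b)
  have hT : ∀ k ∈ Metric.ball (0 : ℂ) R, ‖T k‖ < 1 := by
    intro k hk
    rw [mem_ball_zero_iff] at hk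
    refine (norm_systemOp_le ω hω q k).trans_lt ?_
    rw [div_lt_one hω]
    have : ‖k‖ ^ 2 ≤ R ^ 2 := by gcongr
    linarith
  have hunit : ∀ k ∈ Metric.ball (0 : ℂ) R, IsUnit (1 - T k) := fun k hk =>
    isUnit_one_sub_of_norm_lt_one (x := T k) (hT k hk)
  have hfix : ∀ k ∈ Metric.ball (0 : ℂ) R, v k = (v0 a, v0 b) + T k (v k) := by
    intro k hk
    have h := congrArg (fun S => S (v0 a, v0 b)) (Ring.mul_inverse_cancel _ (hunit k hk))
    have h' : (1 - T k) (v k) = (v0 a, v0 b) := h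
    rw [← h']
    simp
  have hTd : ∀ k, DifferentiableAt ℂ T k := fun k => by
    have h2 : DifferentiableAt ℂ (fun k : ℂ => k ^ 2) k := differentiableAt_pow 2
    exact DifferentiableAt.sub (differentiableAt_const _)
      (h2.smul_const ((0 : ((ℝ →ᵇ ℂ) × (ℝ →ᵇ ℂ)) →L[ℂ] (ℝ →ᵇ ℂ)).prod
        ((weightedPrimitive ω hω).comp (ContinuousLinearMap.fst ℂ _ _))))
  have hvd : DifferentiableOn ℂ v (Metric.ball 0 R) := by
    intro k hk
    exact (differentiableAt_inverse_one_sub_apply (hTd k) (hT k hk)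
      (v0 a, v0 b)).differentiableWithinAt
  -- Multiplying the fixed point equation by e^{ωx} removes the weight: e^{ωx} v is the pair (u, u')
  -- of the unweighted system.
  have hv1 : ∀ k ∈ Metric.ball (0 : ℂ) R, ∀ x, 0 ≤ x →
      (Real.exp (ω * x) : ℂ) * (v k).1 x =
        a + ∫ t in (0 : ℝ)..x, (Real.exp (ω * t) : ℂ) * (v k).2 t := by
    intro k hk x hx
    have h := congrArg (fun w => w.1 x) (hfix k hk)
    have e : (T k (v k)).1 = weightedPrimitive ω hω (v k).2 := by simp [T, systemOp]
    simp only [Prod.fst_add, BoundedContinuousFunction.coe_add, Pi.add_apply, e,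
      weightedPrimitive_apply, max_eq_left hx] at h
    have h0 : v0 a x = (Real.exp (-ω * x) : ℂ) * a := by simp [v0, max_eq_left hx]
    rw [h, h0, ← mul_add, ← mul_assoc, ← Complex.ofReal_mul, ← Real.exp_add]
    simp
  have hv2 : ∀ k ∈ Metric.ball (0 : ℂ) R, ∀ x, 0 ≤ x →
      (Real.exp (ω * x) : ℂ) * (v k).2 x =
        b + ∫ t in (0 : ℝ)..x, (q t - k ^ 2) * ((Real.exp (ω * t) : ℂ) * (v k).1 t) := by
    intro k hk x hx
    have h := congrArg (fun w => w.2 x) (hfix k hk)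
    have e : (T k (v k)).2 = weightedPrimitive ω hω (q * (v k).1 - k ^ 2 • (v k).1) := by
      simp [T, systemOp]
    simp only [Prod.snd_add, BoundedContinuousFunction.coe_add, Pi.add_apply, e,
      weightedPrimitive_apply, max_eq_left hx] at h
    have h0 : v0 b x = (Real.exp (-ω * x) : ℂ) * b := by simp [v0, max_eq_left hx]
    rw [h, h0, ← mul_add, ← mul_assoc, ← Complex.ofReal_mul, ← Real.exp_add]
    simp only [neg_mul, add_neg_cancel, Real.exp_zero, Complex.ofReal_one, one_mul]
    congr 1
    refine intervalIntegral.integral_congr fun t _ => ?_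
    simp
    ring
  -- The solution is taken to be the primitive, not e^{ωx} v: the two agree for x ≥ 0, but the
  -- primitive has a two-sided derivative even at 0.
  refine ⟨fun k x => a + ∫ t in (0 : ℝ)..x, (Real.exp (ω * t) : ℂ) * (v k).2 t,
    fun k x => b + ∫ t in (0 : ℝ)..x, (q t - k ^ 2) * ((Real.exp (ω * t) : ℂ) * (v k).1 t),
    fun k hk => ⟨by simp, by simp, fun x hx => ⟨?_, ?_⟩⟩, fun x hx => ⟨?_, ?_⟩⟩
  · beta_reduce
    rw [← hv2 k hk x hx]
    exact (intervalIntegral.integral_hasDerivAt_right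
      (Continuous.intervalIntegrable (by fun_prop) _ _)
      (Continuous.stronglyMeasurableAtFilter (by fun_prop) _ _)
      (by fun_prop)).const_add a
  · beta_reduce
    rw [← hv1 k hk x hx]
    exact (intervalIntegral.integral_hasDerivAt_right
      (Continuous.intervalIntegrable (by fun_prop) _ _)
      (Continuous.stronglyMeasurableAtFilter (by fun_prop) _ _)
      (by fun_prop)).const_add b
  · refine DifferentiableOn.congr (f := fun k => (Real.exp (ω * x) : ℂ) * (v k).1 x) ?_
      (fun k hk => (hv1 k hk x hx).symm)
    have : DifferentiableOn ℂ (fun k => (BoundedContinuousFunction.evalCLM ℂ x) (v k).1)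
      (Metric.ball 0 R) := by fun_prop
    exact this.const_mul _
  · refine DifferentiableOn.congr (f := fun k => (Real.exp (ω * x) : ℂ) * (v k).2 x) ?_
      (fun k hk => (hv2 k hk x hx).symm)
    have : DifferentiableOn ℂ (fun k => (BoundedContinuousFunction.evalCLM ℂ x) (v k).2)
      (Metric.ball 0 R) := by fun_prop
    exact this.const_mul _

/-! ### The fundamental theorem of calculus with one-sided derivatives at 0 -/

section Calculus

lemma continuousOn_Ici_of_hasDerivWithinAt {E : Type*} [NormedAddCommGroup E] [NormedSpace ℝ E]
    {F F' : ℝ → E} (h : ∀ x, 0 ≤ x → HasDerivWithinAt F (F' x) (Ici 0) x) :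
    ContinuousOn F (Ici 0) := fun x hx => (h x hx).continuousWithinAt

lemma integral_eq_sub_of_hasDerivWithinAt_Ici {F F' : ℝ → ℂ}
    (h : ∀ x, 0 ≤ x → HasDerivWithinAt F (F' x) (Ici 0) x) (hF' : ContinuousOn F' (Ici 0))
    {a b : ℝ} (ha : 0 ≤ a) (hab : a ≤ b) : ∫ t in a..b, F' t = F b - F a := by
  have hsub : Icc a b ⊆ Ici 0 := fun x hx => ha.trans hx.1
  refine intervalIntegral.integral_eq_sub_of_hasDeriv_right_of_le hab
    ((continuousOn_Ici_of_hasDerivWithinAt h).mono hsub)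
    (fun x hx => (h x (ha.trans hx.1.le)).mono fun y hy => (ha.trans hx.1.le).trans hy.le) ?_
  exact (hF'.mono (by rwa [uIcc_of_le hab])).intervalIntegrable

end Calculus

/-! ### Continuity of the potential, uniqueness, and solutions with prescribed data at 0 -/

section Potential

variable {xI : ℝ} {V : ℝ → ℝ}

lemma IsPotential.continuousOn (hV : IsPotential xI V) : ContinuousOn V (Ici 0) := by
  obtain ⟨V', hV', h⟩ := hV.deriv_integrable
  have h1 : Continuous fun x : ℝ => ∫ t in (0 : ℝ)..x, (Ioi (0 : ℝ)).indicator V' t :=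
    intervalIntegral.continuous_primitive (fun a b =>
      ((integrable_indicator_iff measurableSet_Ioi).mpr hV').intervalIntegrable) 0
  refine ((h1.const_add (V 0)).continuousOn).congr fun x hx => ?_
  rw [h x hx]
  congr 1
  rw [intervalIntegral.integral_of_le hx, intervalIntegral.integral_of_le hx]
  refine setIntegral_congr_fun measurableSet_Ioc fun t ht => ?_
  simp [indicator_of_mem (show t ∈ Ioi (0 : ℝ) from ht.1)]

lemma IsPotential.continuous_max (hV : IsPotential xI V) : Continuous fun x => V (max x 0) :=
  hV.continuousOn.comp_continuous (by fun_prop) fun x => le_max_right x 0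

lemma IsPotential.exists_bound (hV : IsPotential xI V) : ∃ B, 0 ≤ B ∧ ∀ x, 0 ≤ x → |V x| ≤ B := by
  have hc : ContinuousOn V (Icc 0 xI) := hV.continuousOn.mono fun x hx => hx.1
  obtain ⟨B, hB⟩ := isCompact_Icc.exists_bound_of_continuousOn hc
  refine ⟨max B 0, le_max_right _ _, fun x hx => ?_⟩
  rcases le_or_gt x xI with h | h
  · exact (hB x ⟨hx, h⟩).trans (le_max_left _ _)
  · simp [hV.eq_zero x h]

lemma IsPotential.eq_zero_of_le (hV : IsPotential xI V) (hxI : 0 < xI) {x : ℝ} (hx : xI ≤ x) :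
    V x = 0 := by
  rcases hx.eq_or_lt with rfl | h
  · have h1 : Tendsto V (𝓝[>] xI) (𝓝 (V xI)) :=
      ((hV.continuousOn xI hxI.le).mono fun y hy => hxI.le.trans (le_of_lt hy)).tendsto
    have h2 : Tendsto V (𝓝[>] xI) (𝓝 0) :=
      tendsto_const_nhds.congr' (eventually_nhdsWithin_of_forall fun y hy =>
        (hV.eq_zero y hy).symm)
    exact tendsto_nhds_unique h1 h2
  · exact hV.eq_zero x h

/-- Two solutions of the equation on `[a, ∞)` with the same data at `a` agree. -/
lemma solution_unique {B : ℝ} (hB : ∀ x, 0 ≤ x → |V x| ≤ B) {k : ℂ} {u u' w w' : ℝ → ℂ} {a : ℝ}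
    (ha : 0 ≤ a)
    (hu : ∀ x, a ≤ x → HasDerivWithinAt u (u' x) (Ici a) x ∧
      HasDerivWithinAt u' (((V x : ℂ) - k ^ 2) * u x) (Ici a) x)
    (hw : ∀ x, a ≤ x → HasDerivWithinAt w (w' x) (Ici a) x ∧
      HasDerivWithinAt w' (((V x : ℂ) - k ^ 2) * w x) (Ici a) x)
    (h : u a = w a) (h' : u' a = w' a) {x : ℝ} (hx : a ≤ x) : u x = w x ∧ u' x = w' x := by
  have hB0 : 0 ≤ B := (abs_nonneg _).trans (hB a ha)
  have hd : ∀ y, a ≤ y → HasDerivWithinAt (fun t => (u t - w t, u' t - w' t))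
      (u' y - w' y, ((V y : ℂ) - k ^ 2) * (u y - w y)) (Ici a) y := fun y hy => by
    have := ((hu y hy).1.sub (hw y hy).1).prodMk ((hu y hy).2.sub (hw y hy).2)
    rw [mul_sub]
    exact this
  have key := eq_zero_of_abs_deriv_le_mul_abs_self_of_eq_zero_right
    (f := fun t => (u t - w t, u' t - w' t))
    (f' := fun y => (u' y - w' y, ((V y : ℂ) - k ^ 2) * (u y - w y)))
    -- A Grönwall constant for the pair (u − w, u' − w') in the sup norm: it dominates both 1 and |V
    -- − k²|.
    (K := 1 + B + ‖k‖ ^ 2) (a := a) (b := x)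
    (fun y hy => ((hd y hy.1).continuousWithinAt).mono fun z hz => hz.1)
    (fun y hy => (hd y hy.1).mono fun z hz => hy.1.trans hz)
    (by simp [h, h'])
    (fun y hy => by
      set N := ‖(u y - w y, u' y - w' y)‖ with hN
      have h1 : ‖u y - w y‖ ≤ N := norm_fst_le (u y - w y, u' y - w' y)
      have h2 : ‖u' y - w' y‖ ≤ N := norm_snd_le (u y - w y, u' y - w' y)
      have h0 : 0 ≤ N := norm_nonneg _
      have h3 : ‖(V y : ℂ) - k ^ 2‖ ≤ B + ‖k‖ ^ 2 := by
        refine (norm_sub_le _ _).trans ?_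
        rw [norm_pow, Complex.norm_real]
        gcongr
        exact hB y (ha.trans hy.1)
      refine max_le ?_ ?_
      · dsimp only
        nlinarith [sq_nonneg ‖k‖, mul_nonneg hB0 h0, mul_nonneg (sq_nonneg ‖k‖) h0]
      · dsimp only
        rw [norm_mul]
        calc _ ≤ (B + ‖k‖ ^ 2) * N := by gcongr
          _ ≤ _ := by nlinarith)
    x ⟨hx, le_rfl⟩
  simp only [Prod.mk_eq_zero, sub_eq_zero] at key
  exact key

lemma IsSolution.mono_Ici {k : ℂ} {u u' : ℝ → ℂ} (hu : IsSolution V k u u') {a : ℝ} (ha : 0 ≤ a) :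
    ∀ x, a ≤ x → HasDerivWithinAt u (u' x) (Ici a) x ∧
      HasDerivWithinAt u' (((V x : ℂ) - k ^ 2) * u x) (Ici a) x := fun x hx =>
  ⟨(hu x (ha.trans hx)).1.mono (Ici_subset_Ici.mpr ha),
    (hu x (ha.trans hx)).2.mono (Ici_subset_Ici.mpr ha)⟩

lemma IsSolution.unique (hV : IsPotential xI V) {k : ℂ} {u u' w w' : ℝ → ℂ}
    (hu : IsSolution V k u u') (hw : IsSolution V k w w') (h : u 0 = w 0) (h' : u' 0 = w' 0)
    {x : ℝ} (hx : 0 ≤ x) : u x = w x ∧ u' x = w' x := by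
  obtain ⟨B, -, hB⟩ := hV.exists_bound
  exact solution_unique hB le_rfl hu hw h h' hx

lemma IsSolution.continuousOn {k : ℂ} {u u' : ℝ → ℂ} (hu : IsSolution V k u u') :
    ContinuousOn u (Ici 0) := fun x hx => (hu x hx).1.continuousWithinAt

lemma IsSolution.lin_comb {k : ℂ} {u u' w w' : ℝ → ℂ} (hu : IsSolution V k u u')
    (hw : IsSolution V k w w') (a b : ℂ) :
    IsSolution V k (fun x => a * u x + b * w x) (fun x => a * u' x + b * w' x) := fun x hx =>
  ⟨((hu x hx).1.const_mul a).add ((hw x hx).1.const_mul b), by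
    have := ((hu x hx).2.const_mul a).add ((hw x hx).2.const_mul b)
    exact this.congr_deriv (by ring)⟩

/-- The Wronskian of two solutions is constant. -/
lemma IsSolution.wronskian {k : ℂ} {u u' w w' : ℝ → ℂ} (hu : IsSolution V k u u')
    (hw : IsSolution V k w w') {x : ℝ} (hx : 0 ≤ x) :
    u x * w' x - u' x * w x = u 0 * w' 0 - u' 0 * w 0 := by
  have := integral_eq_sub_of_hasDerivWithinAt_Ici (F := fun x => u x * w' x - u' x * w x)
    (F' := fun _ => 0) (fun y hy => by
      have := ((hu y hy).1.mul (hw y hy).2).sub ((hu y hy).2.mul (hw y hy).1)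
      exact this.congr_deriv (by ring)) continuousOn_const le_rfl hx
  simp only [intervalIntegral.integral_zero] at this
  exact (sub_eq_zero.mp this.symm)

lemma exists_isSolution_holomorphic (hV : IsPotential xI V) (R : ℝ) (a b : ℂ) :
    ∃ u u' : ℂ → ℝ → ℂ,
      (∀ k ∈ Metric.ball (0 : ℂ) R, u k 0 = a ∧ u' k 0 = b ∧ IsSolution V k (u k) (u' k)) ∧
      ∀ x, 0 ≤ x → DifferentiableOn ℂ (fun k => u k x) (Metric.ball 0 R) ∧
        DifferentiableOn ℂ (fun k => u' k x) (Metric.ball 0 R) := by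
  obtain ⟨B, hB0, hB⟩ := hV.exists_bound
  -- Extending V by the constant V 0 to the left makes it a bounded continuous coefficient on the
  -- line.
  let q : BoundedContinuousFunction ℝ ℂ := BoundedContinuousFunction.ofNormedAddCommGroup
    (fun x => ((V (max x 0) : ℝ) : ℂ)) (Complex.continuous_ofReal.comp hV.continuous_max) B
    (fun x => by
      rw [Complex.norm_real]
      exact hB _ (le_max_right _ _))
  obtain ⟨u, u', h, hd⟩ := exists_holomorphic_solution q R a b
  refine ⟨u, u', fun k hk => ⟨(h k hk).1, (h k hk).2.1, fun x hx => ?_⟩, hd⟩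
  have hq : q x = V x := by simp [q, max_eq_left hx]
  have := (h k hk).2.2 x hx
  rw [hq] at this
  exact ⟨this.1.hasDerivWithinAt, this.2.hasDerivWithinAt⟩

/-- The solution (with its derivative) of the equation with data `(a, b)` at `0`. -/
def sol (V : ℝ → ℝ) (a b k : ℂ) : ℝ → ℂ × ℂ :=
  Classical.epsilon fun s => IsSolution V k (fun x => (s x).1) (fun x => (s x).2) ∧ s 0 = (a, b)

lemma sol_spec (hV : IsPotential xI V) (a b k : ℂ) :
    IsSolution V k (fun x => (sol V a b k x).1) (fun x => (sol V a b k x).2) ∧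
      sol V a b k 0 = (a, b) := by
  refine Classical.epsilon_spec (p := fun s : ℝ → ℂ × ℂ =>
    IsSolution V k (fun x => (s x).1) (fun x => (s x).2) ∧ s 0 = (a, b)) ?_
  obtain ⟨u, u', h, -⟩ := exists_isSolution_holomorphic hV (‖k‖ + 1) a b
  obtain ⟨h1, h2, h3⟩ := h k (by simp)
  exact ⟨fun x => (u k x, u' k x), h3, by simp [h1, h2]⟩

lemma isSolution_sol (hV : IsPotential xI V) (a b k : ℂ) :
    IsSolution V k (fun x => (sol V a b k x).1) (fun x => (sol V a b k x).2) :=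
  (sol_spec hV a b k).1

lemma sol_zero (hV : IsPotential xI V) (a b k : ℂ) : sol V a b k 0 = (a, b) :=
  (sol_spec hV a b k).2

lemma IsSolution.eq_sol (hV : IsPotential xI V) {k : ℂ} {u u' : ℝ → ℂ}
    (hu : IsSolution V k u u') {x : ℝ} (hx : 0 ≤ x) :
    u x = (sol V (u 0) (u' 0) k x).1 ∧ u' x = (sol V (u 0) (u' 0) k x).2 :=
  hu.unique hV (isSolution_sol hV _ _ k) (by simp [sol_zero hV]) (by simp [sol_zero hV]) hx

/-- The equation sees k only through k², so both sides choose from the same predicate. This parity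
is what makes several later integrands odd. -/
lemma sol_neg (V : ℝ → ℝ) (a b k : ℂ) : sol V a b (-k) = sol V a b k := by
  unfold sol IsSolution
  simp

/-- On every disc a holomorphic family of solutions exists, and uniqueness identifies it with `sol`;
hence the dependence on k is entire. -/
lemma differentiable_sol (hV : IsPotential xI V) (a b : ℂ) {x : ℝ} (hx : 0 ≤ x) :
    Differentiable ℂ (fun k => (sol V a b k x).1) ∧
      Differentiable ℂ (fun k => (sol V a b k x).2) := by
  have key : ∀ R, DifferentiableOn ℂ (fun k => (sol V a b k x).1) (Metric.ball 0 R) ∧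
      DifferentiableOn ℂ (fun k => (sol V a b k x).2) (Metric.ball 0 R) := fun R => by
    obtain ⟨u, u', h, hd⟩ := exists_isSolution_holomorphic hV R a b
    have he : ∀ k ∈ Metric.ball (0 : ℂ) R, u k x = (sol V a b k x).1 ∧
        u' k x = (sol V a b k x).2 := fun k hk => by
      obtain ⟨h1, h2, h3⟩ := h k hk
      have := h3.eq_sol hV hx
      rwa [h1, h2] at this
    exact ⟨(hd x hx).1.congr fun k hk => (he k hk).1.symm,
      (hd x hx).2.congr fun k hk => (he k hk).2.symm⟩
  have hm : ∀ k : ℂ, Metric.ball (0 : ℂ) (‖k‖ + 1) ∈ 𝓝 k := fun k =>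
    Metric.isOpen_ball.mem_nhds (by simp)
  exact ⟨fun k => (key (‖k‖ + 1)).1.differentiableAt (hm k),
    fun k => (key (‖k‖ + 1)).2.differentiableAt (hm k)⟩

lemma regular_eq (hV : IsPotential xI V) (h : ℝ) (k : ℂ) {x : ℝ} (hx : 0 ≤ x) :
    regular V h x k = (sol V 1 (-h) k x).1 := by
  have : IsRegularSolution V h k (fun x => regular V h x k) :=
    Classical.epsilon_spec (p := IsRegularSolution V h k)
      ⟨_, _, isSolution_sol hV 1 (-h) k, by simp [sol_zero hV], by simp [sol_zero hV]⟩
  obtain ⟨u', hu, h0, h1⟩ := this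
  have := (hu.eq_sol hV hx).1
  simpa only [h0, h1] using this

end Potential

/-! ### The Jost solution and the Jost function as entire functions of k -/

section Jost

variable {xI : ℝ} {V : ℝ → ℝ}

lemma hasDerivAt_cexp_I_mul (k : ℂ) (x : ℝ) :
    HasDerivAt (fun x : ℝ => Complex.exp (Complex.I * k * x))
      (Complex.I * k * Complex.exp (Complex.I * k * x)) x := by
  have h1 : HasDerivAt (fun z : ℂ => Complex.exp (Complex.I * k * z))
      (Complex.exp (Complex.I * k * x) * (Complex.I * k)) (x : ℂ) := by
    have := ((hasDerivAt_id (x : ℂ)).const_mul (Complex.I * k)).cexp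
    simpa using this
  exact h1.comp_ofReal.congr_deriv (mul_comm _ _)

/-- The exponential is prescribed only strictly beyond xI. Continuity carries it to xI, and the
derivative there is fixed by the values to the right. -/
lemma IsJostSolution.deriv_eq {k : ℂ} {u u' : ℝ → ℂ} (hxI : 0 < xI) (hu : IsSolution V k u u')
    (h : ∀ x, 0 ≤ x → xI < x → u x = Complex.exp (Complex.I * k * x)) {x : ℝ} (hx : xI ≤ x) :
    u x = Complex.exp (Complex.I * k * x) ∧
      u' x = Complex.I * k * Complex.exp (Complex.I * k * x) := by
  have hd : ∀ y, xI ≤ y → u y = Complex.exp (Complex.I * k * y) := by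
    intro y hy
    have h1 : Tendsto u (𝓝[>] y) (𝓝 (u y)) :=
      ((hu.continuousOn y (hxI.le.trans hy)).mono
        fun z hz => (hxI.le.trans hy).trans (le_of_lt hz)).tendsto
    have h2 : Tendsto u (𝓝[>] y) (𝓝 (Complex.exp (Complex.I * k * y))) := by
      refine Tendsto.congr' (eventually_nhdsWithin_of_forall fun z hz =>
        (h z ((hxI.le.trans hy).trans (le_of_lt hz)) (hy.trans_lt hz)).symm) ?_
      exact ((hasDerivAt_cexp_I_mul k y).continuousAt.tendsto).mono_left nhdsWithin_le_nhds
    exact tendsto_nhds_unique h1 h2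
  refine ⟨hd x hx, ?_⟩
  have h1 : HasDerivWithinAt u (u' x) (Ici x) x :=
    (hu x (hxI.le.trans hx)).1.mono (Ici_subset_Ici.mpr (hxI.le.trans hx))
  have h2 : HasDerivWithinAt u (Complex.I * k * Complex.exp (Complex.I * k * x)) (Ici x) x :=
    (hasDerivAt_cexp_I_mul k x).hasDerivWithinAt.congr (fun y hy => hd y (hx.trans hy)) (hd x hx)
  exact (uniqueDiffOn_Ici x x self_mem_Ici).eq_deriv _ h1 h2

lemma exists_isJostSolution (hV : IsPotential xI V) (hxI : 0 < xI) (k : ℂ) :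
    ∃ u, IsJostSolution V xI k u := by
  have hp := isSolution_sol hV 1 0 k
  have ht := isSolution_sol hV 0 1 k
  have hW := hp.wronskian ht hxI.le
  simp only [sol_zero hV, one_mul, zero_mul, sub_zero] at hW
  set e := Complex.exp (Complex.I * k * xI)
  -- Cramer's rule: with Wronskian 1, these coefficients match the data of e^{ikx} at xI.
  have hu := hp.lin_comb ht
    (e * ((sol V 0 1 k xI).2 - Complex.I * k * (sol V 0 1 k xI).1))
    (e * (Complex.I * k * (sol V 1 0 k xI).1 - (sol V 1 0 k xI).2))
  obtain ⟨B, -, hB⟩ := hV.exists_bound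
  refine ⟨_, ⟨_, hu⟩, fun x _ hx => ?_⟩
  refine (solution_unique hB hxI.le (hu.mono_Ici hxI.le)
    (w := fun x => Complex.exp (Complex.I * k * x))
    (w' := fun x => Complex.I * k * Complex.exp (Complex.I * k * x)) (fun y hy => ⟨?_, ?_⟩)
    ?_ ?_ hx.le).1
  · exact (hasDerivAt_cexp_I_mul k y).hasDerivWithinAt
  · rw [hV.eq_zero_of_le hxI hy]
    refine ((hasDerivAt_cexp_I_mul k y).const_mul (Complex.I * k)).hasDerivWithinAt.congr_deriv ?_
    push_cast
    linear_combination (k ^ 2 * Complex.exp (Complex.I * k * y)) * Complex.I_sq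
  · linear_combination e * hW
  · linear_combination Complex.I * k * e * hW

/-- The derivative of the Jost solution. -/
def jostDeriv (V : ℝ → ℝ) (xI : ℝ) (x : ℝ) (k : ℂ) : ℂ :=
  derivWithin (fun x => jost V xI x k) (Ici 0) x

lemma isJostSolution_jost (hV : IsPotential xI V) (hxI : 0 < xI) (k : ℂ) :
    IsJostSolution V xI k (fun x => jost V xI x k) :=
  Classical.epsilon_spec (p := IsJostSolution V xI k) (exists_isJostSolution hV hxI k)

lemma isSolution_jost (hV : IsPotential xI V) (hxI : 0 < xI) (k : ℂ) :
    IsSolution V k (fun x => jost V xI x k) (fun x => jostDeriv V xI x k) := by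
  obtain ⟨⟨u', hu⟩, -⟩ := isJostSolution_jost hV hxI k
  have he : ∀ x, 0 ≤ x → jostDeriv V xI x k = u' x := fun x hx =>
    (hu x hx).1.derivWithin (uniqueDiffOn_Ici 0 x hx)
  refine fun x hx => ⟨?_, (hu x hx).2.congr he (he x hx)⟩
  exact (hu x hx).1.congr_deriv (he x hx).symm

lemma jost_eq_exp (hV : IsPotential xI V) (hxI : 0 < xI) (k : ℂ) {x : ℝ} (hx : xI ≤ x) :
    jost V xI x k = Complex.exp (Complex.I * k * x) ∧
      jostDeriv V xI x k = Complex.I * k * Complex.exp (Complex.I * k * x) :=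
  IsJostSolution.deriv_eq hxI (isSolution_jost hV hxI k) (isJostSolution_jost hV hxI k).2 hx

lemma jostFun_eq (V : ℝ → ℝ) (xI h : ℝ) (k : ℂ) :
    jostFun V xI h k = jost V xI 0 k * h + jostDeriv V xI 0 k := rfl

/-- The Wronskian with the solution of data (0,1) is evaluated at 0 and at xI. `jostFun_eq_exp` does
the same with the regular solution. Both formulas show that the quantities are entire in k. -/
lemma jost_zero_eq (hV : IsPotential xI V) (hxI : 0 < xI) (k : ℂ) :
    jost V xI 0 k = Complex.exp (Complex.I * k * xI) *
      ((sol V 0 1 k xI).2 - Complex.I * k * (sol V 0 1 k xI).1) := by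
  have := (isSolution_jost hV hxI k).wronskian (isSolution_sol hV 0 1 k) hxI.le
  simp only [sol_zero hV, (jost_eq_exp hV hxI k le_rfl).1, (jost_eq_exp hV hxI k le_rfl).2] at this
  linear_combination -this

lemma jostFun_eq_exp (hV : IsPotential xI V) (hxI : 0 < xI) (h : ℝ) (k : ℂ) :
    jostFun V xI h k = Complex.exp (Complex.I * k * xI) *
      (Complex.I * k * (sol V 1 (-h) k xI).1 - (sol V 1 (-h) k xI).2) := by
  have := (isSolution_sol hV 1 (-h) k).wronskian (isSolution_jost hV hxI k) hxI.le
  simp only [sol_zero hV, (jost_eq_exp hV hxI k le_rfl).1, (jost_eq_exp hV hxI k le_rfl).2] at this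
  rw [jostFun_eq]
  linear_combination -this

/-- In this basis the coefficients are the numerator and the denominator of the Weyl function; at a
zero of the denominator the Jost solution is a multiple of the regular one. -/
lemma jost_eq_lin_comb (hV : IsPotential xI V) (hxI : 0 < xI) (h : ℝ) (k : ℂ) {x : ℝ}
    (hx : 0 ≤ x) : jost V xI x k = jost V xI 0 k * (sol V 1 (-h) k x).1 +
      jostFun V xI h k * (sol V 0 1 k x).1 := by
  refine ((isSolution_jost hV hxI k).unique hV
    ((isSolution_sol hV 1 (-h) k).lin_comb (isSolution_sol hV 0 1 k) _ _) ?_ ?_ hx).1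
  · simp [sol_zero hV]
  · simp only [sol_zero hV, jostFun_eq]
    ring

lemma differentiable_jost_zero (hV : IsPotential xI V) (hxI : 0 < xI) :
    Differentiable ℂ (fun k => jost V xI 0 k) := by
  have h1 := (differentiable_sol hV 0 1 hxI.le).1
  have h2 := (differentiable_sol hV 0 1 hxI.le).2
  simp only [jost_zero_eq hV hxI]
  fun_prop

lemma differentiable_jostFun (hV : IsPotential xI V) (hxI : 0 < xI) (h : ℝ) :
    Differentiable ℂ (jostFun V xI h) := by
  have h1 := (differentiable_sol hV 1 (-h) hxI.le).1
  have h2 := (differentiable_sol hV 1 (-h) hxI.le).2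
  have : jostFun V xI h = _ := funext fun k => jostFun_eq_exp hV hxI h k
  rw [this]
  fun_prop

lemma differentiable_jost (hV : IsPotential xI V) (hxI : 0 < xI) {x : ℝ} (hx : 0 ≤ x) :
    Differentiable ℂ (fun k => jost V xI x k) := by
  have h1 := (differentiable_sol hV 1 (-(0 : ℝ)) hx).1
  have h2 := (differentiable_sol hV 0 1 hx).1
  have h3 := differentiable_jost_zero hV hxI
  have h4 := differentiable_jostFun hV hxI 0
  simp only [fun k => jost_eq_lin_comb hV hxI 0 k hx]
  fun_prop

end Jost

/-! ### Growth of exponentials, sines and cosines in the complex plane -/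

section Trig

lemma norm_cexp_I_mul (k : ℂ) (x : ℝ) :
    ‖Complex.exp (Complex.I * k * x)‖ = Real.exp (-(k.im * x)) := by
  rw [Complex.norm_exp]
  congr 1
  simp

lemma norm_sin_le (z : ℂ) : ‖Complex.sin z‖ ≤ Real.exp |z.im| := by
  have h1 : ‖Complex.exp (-z * Complex.I)‖ ≤ Real.exp |z.im| := by
    rw [Complex.norm_exp]
    simpa using le_abs_self z.im
  have h2 : ‖Complex.exp (z * Complex.I)‖ ≤ Real.exp |z.im| := by
    rw [Complex.norm_exp]
    simpa using neg_le_abs z.im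
  rw [Complex.sin, norm_div, norm_mul, Complex.norm_I, Complex.norm_two]
  linarith [norm_sub_le (Complex.exp (-z * Complex.I)) (Complex.exp (z * Complex.I))]

lemma norm_cos_le (z : ℂ) : ‖Complex.cos z‖ ≤ Real.exp |z.im| := by
  have h1 : ‖Complex.exp (-z * Complex.I)‖ ≤ Real.exp |z.im| := by
    rw [Complex.norm_exp]
    simpa using le_abs_self z.im
  have h2 : ‖Complex.exp (z * Complex.I)‖ ≤ Real.exp |z.im| := by
    rw [Complex.norm_exp]
    simpa using neg_le_abs z.im
  rw [Complex.cos, norm_div, Complex.norm_two]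
  linarith [norm_add_le (Complex.exp (z * Complex.I)) (Complex.exp (-z * Complex.I))]

lemma norm_sin_mul_ofReal_le {k : ℂ} (hk : 0 ≤ k.im) {s d : ℝ} (hs : |s| ≤ d) :
    ‖Complex.sin (k * s)‖ ≤ Real.exp (k.im * d) := by
  refine (norm_sin_le _).trans (Real.exp_le_exp.mpr ?_)
  simp only [Complex.mul_im, Complex.ofReal_im, mul_zero, Complex.ofReal_re, zero_add]
  rw [abs_mul, abs_of_nonneg hk]
  gcongr

lemma norm_cos_mul_ofReal_le {k : ℂ} (hk : 0 ≤ k.im) {s d : ℝ} (hs : |s| ≤ d) :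
    ‖Complex.cos (k * s)‖ ≤ Real.exp (k.im * d) := by
  refine (norm_cos_le _).trans (Real.exp_le_exp.mpr ?_)
  simp only [Complex.mul_im, Complex.ofReal_im, mul_zero, Complex.ofReal_re, zero_add]
  rw [abs_mul, abs_of_nonneg hk]
  gcongr

end Trig

/-! ### Oscillatory integrals against the potential -/

section ByParts

variable {xI : ℝ} {V : ℝ → ℝ}

/-- Integration by parts against an absolutely continuous function. -/
lemma integral_primitive_mul {V' : ℝ → ℝ} (hV' : IntegrableOn V' (Ioi 0)) {E e : ℝ → ℂ} {L : ℝ}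
    (hL : 0 ≤ L) (hE : ∀ t, HasDerivAt E (e t) t) (he : Continuous e) :
    ∫ t in (0 : ℝ)..L, ((∫ s in (0 : ℝ)..t, V' s : ℝ) : ℂ) * e t =
      ∫ s in (0 : ℝ)..L, (V' s : ℂ) * (E L - E s) := by
  set μ := volume.restrict (Ioc (0 : ℝ) L)
  have hV1 : Integrable (fun s => (V' s : ℂ)) μ :=
    (IntegrableOn.mono_set hV' Ioc_subset_Ioi_self).ofReal
  have he1 : Integrable e μ := (he.integrableOn_Icc (a := 0) (b := L)).mono_set Ioc_subset_Icc_self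
  -- Integration by parts is Fubini on the triangle s ≤ t ≤ L, encoded by an indicator.
  have hint : Integrable (Function.uncurry fun t s => (Iic t).indicator (fun s => (V' s : ℂ) * e t) s)
      (μ.prod μ) := by
    have h1 : Integrable (fun p : ℝ × ℝ => e p.1 * (V' p.2 : ℂ)) (μ.prod μ) := he1.mul_prod hV1
    have h2 := h1.indicator (s := {p : ℝ × ℝ | p.2 ≤ p.1})
      (measurableSet_le measurable_snd measurable_fst)
    refine h2.congr (Eventually.of_forall fun p => ?_)
    simp only [Function.uncurry, indicator, mem_ofPred_eq, mem_Iic, mul_comm]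
  have hswap := integral_integral_swap hint
  rw [intervalIntegral.integral_of_le hL, intervalIntegral.integral_of_le hL]
  calc _ = ∫ t, ∫ s, (Iic t).indicator (fun s => (V' s : ℂ) * e t) s ∂μ ∂μ := by
        refine setIntegral_congr_fun measurableSet_Ioc fun t ht => ?_
        rw [integral_indicator measurableSet_Iic, Measure.restrict_restrict measurableSet_Iic,
          integral_mul_const]
        congr 1
        have : Iic t ∩ Ioc 0 L = Ioc 0 t := by
          ext s
          simp only [mem_inter_iff, mem_Iic, mem_Ioc]
          exact ⟨fun h => ⟨h.2.1, h.1⟩, fun h => ⟨h.2, h.1, h.2.trans ht.2⟩⟩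
        rw [this, intervalIntegral.integral_of_le ht.1.le, integral_complex_ofReal]
    _ = _ := hswap
    _ = _ := by
        refine setIntegral_congr_fun measurableSet_Ioc fun s hs => ?_
        have h1 : ∀ t, (Iic t).indicator (fun s => (V' s : ℂ) * e t) s =
            (Ici s).indicator (fun t => (V' s : ℂ) * e t) t := fun t => by
          simp only [indicator, mem_Iic, mem_Ici]
        simp only [h1]
        rw [integral_indicator measurableSet_Ici, Measure.restrict_restrict measurableSet_Ici,
          integral_const_mul]
        congr 1
        have : Ici s ∩ Ioc 0 L = Icc s L := by
          ext t
          simp only [mem_inter_iff, mem_Ici, mem_Ioc, mem_Icc]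
          exact ⟨fun h => ⟨h.1, h.2.2⟩, fun h => ⟨h.1, hs.1.trans_le h.1, h.2⟩⟩
        rw [this, integral_Icc_eq_integral_Ioc, ← intervalIntegral.integral_of_le hs.2]
        exact intervalIntegral.integral_eq_sub_of_hasDerivAt (fun t _ => hE t)
          (he.intervalIntegrable _ _)

/-- Integration by parts moves the derivative onto V, and V' is integrable, so only the size of the
primitive E matters. For e oscillating with frequency k, E carries an extra factor 1/k. -/
lemma IsPotential.exists_oscillatory_bound (hV : IsPotential xI V) :
    ∃ C, 0 ≤ C ∧ ∀ (E e : ℝ → ℂ) (L D : ℝ), 0 ≤ L → (∀ t, HasDerivAt E (e t) t) → Continuous e →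
      (∀ t ∈ Icc 0 L, ‖E t‖ ≤ D) → ‖∫ t in (0 : ℝ)..L, (V t : ℂ) * e t‖ ≤ C * D := by
  obtain ⟨V', hV', hVV'⟩ := hV.deriv_integrable
  have hI : 0 ≤ ∫ s in Ioi (0 : ℝ), |V' s| := integral_nonneg fun _ => abs_nonneg _
  -- Both factors 2 come from |E L − E s| ≤ 2D.
  refine ⟨2 * |V 0| + 2 * ∫ s in Ioi (0 : ℝ), |V' s|, by positivity,
    fun E e L D hL hE he hD => ?_⟩
  have hD0 : 0 ≤ D := (norm_nonneg _).trans (hD 0 ⟨le_rfl, hL⟩)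
  have hc : Continuous fun x : ℝ => ∫ t in (0 : ℝ)..x, (Ioi (0 : ℝ)).indicator V' t :=
    intervalIntegral.continuous_primitive (fun a b =>
      ((integrable_indicator_iff measurableSet_Ioi).mpr hV').intervalIntegrable) 0
  have hEc : Continuous E := continuous_iff_continuousAt.mpr fun t => (hE t).continuousAt
  have hVint : IntervalIntegrable V' volume 0 L :=
    (intervalIntegrable_iff_integrableOn_Ioc_of_le hL).mpr (hV'.mono_set Ioc_subset_Ioi_self)
  have h1 : ∫ t in (0 : ℝ)..L, (V t : ℂ) * e t =
      V 0 * (E L - E 0) + ∫ s in (0 : ℝ)..L, (V' s : ℂ) * (E L - E s) := by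
    rw [← integral_primitive_mul hV' hL hE he]
    have : ∫ t in (0 : ℝ)..L, (V 0 : ℂ) * e t = V 0 * (E L - E 0) := by
      rw [intervalIntegral.integral_const_mul,
        intervalIntegral.integral_eq_sub_of_hasDerivAt (fun t _ => hE t)
          (he.intervalIntegrable _ _)]
    rw [← this, ← intervalIntegral.integral_add]
    · refine intervalIntegral.integral_congr fun t ht => ?_
      rw [uIcc_of_le hL] at ht
      rw [hVV' t ht.1]
      push_cast
      ring
    · exact Continuous.intervalIntegrable (by fun_prop) _ _
    · refine ContinuousOn.intervalIntegrable (ContinuousOn.mul ?_ he.continuousOn)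
      refine (Complex.continuous_ofReal.comp_continuousOn (f := fun t => V t - V 0)
        ((hV.continuousOn.mono ?_).sub continuousOn_const)).congr fun t ht => ?_
      · rw [uIcc_of_le hL]
        exact Icc_subset_Ici_self
      · rw [uIcc_of_le hL] at ht
        simp [hVV' t ht.1]
  rw [h1]
  have hb : ∀ s ∈ Icc 0 L, ‖E L - E s‖ ≤ 2 * D := fun s hs =>
    (norm_sub_le _ _).trans (by linarith [hD L ⟨hL, le_rfl⟩, hD s hs])
  have h2 : ‖∫ s in (0 : ℝ)..L, (V' s : ℂ) * (E L - E s)‖ ≤ 2 * (∫ s in Ioi (0 : ℝ), |V' s|) * D := by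
    calc _ ≤ ∫ s in (0 : ℝ)..L, |V' s| * (2 * D) := by
          refine intervalIntegral.norm_integral_le_of_norm_le hL
            (Eventually.of_forall fun s hs => ?_) (hVint.abs.mul_const _)
          rw [norm_mul, Complex.norm_real, Real.norm_eq_abs]
          gcongr
          exact hb s (Ioc_subset_Icc_self hs)
      _ = (∫ s in (0 : ℝ)..L, |V' s|) * (2 * D) := intervalIntegral.integral_mul_const _ _
      _ ≤ (∫ s in Ioi (0 : ℝ), |V' s|) * (2 * D) := by
          rw [intervalIntegral.integral_of_le hL]
          gcongr
          · exact Eventually.of_forall fun _ => abs_nonneg _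
          · exact hV'.abs
          · exact Ioc_subset_Ioi_self
      _ = _ := by ring
  calc _ ≤ ‖(V 0 : ℂ) * (E L - E 0)‖ + _ := norm_add_le _ _
    _ ≤ |V 0| * (2 * D) + 2 * (∫ s in Ioi (0 : ℝ), |V' s|) * D := by
        refine add_le_add ?_ h2
        rw [norm_mul, Complex.norm_real, Real.norm_eq_abs]
        gcongr
        exact hb 0 ⟨le_rfl, hL⟩
    _ = _ := by ring

end ByParts

/-! ### An a priori bound from a maximum -/

section SupBound

/-- A self-improving weighted bound. -/
lemma norm_le_of_self_improving {u : ℝ → ℂ} {L w C : ℝ} (hL : 0 ≤ L)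
    (hu : ContinuousOn u (Icc 0 L))
    (h : ∀ M, 0 ≤ M → (∀ s ∈ Icc 0 L, ‖u s‖ ≤ M * Real.exp (w * s)) →
      ∀ s ∈ Icc 0 L, ‖u s‖ ≤ (C + M / 2) * Real.exp (w * s)) :
    ∀ s ∈ Icc 0 L, ‖u s‖ ≤ 2 * C * Real.exp (w * s) := by
  have hc : ContinuousOn (fun s => ‖u s‖ * Real.exp (-(w * s))) (Icc 0 L) :=
    hu.norm.mul (by fun_prop)
  -- With M the maximum of the weighted norm, the hypothesis at the maximum point reads M ≤ C + M/2,
  -- hence M ≤ 2C.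
  obtain ⟨s₀, hs₀, hmax⟩ := isCompact_Icc.exists_isMaxOn ⟨0, ⟨le_rfl, hL⟩⟩ hc
  set M := ‖u s₀‖ * Real.exp (-(w * s₀))
  have hee : ∀ s, Real.exp (-(w * s)) * Real.exp (w * s) = 1 := fun s => by
    rw [← Real.exp_add]; simp
  have hM : ∀ s ∈ Icc 0 L, ‖u s‖ ≤ M * Real.exp (w * s) := fun s hs => by
    have h1 : ‖u s‖ * Real.exp (-(w * s)) ≤ M := hmax hs
    calc ‖u s‖ = ‖u s‖ * Real.exp (-(w * s)) * Real.exp (w * s) := by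
          rw [mul_assoc, hee, mul_one]
      _ ≤ _ := by gcongr
  have h2 := h M (by positivity) hM s₀ hs₀
  have h3 : M ≤ C + M / 2 := by
    calc M ≤ (C + M / 2) * Real.exp (w * s₀) * Real.exp (-(w * s₀)) := by
          simp only [M]; gcongr
      _ = C + M / 2 := by rw [mul_assoc, mul_comm (Real.exp (w * s₀)), hee, mul_one]
  intro s hs
  refine (hM s hs).trans ?_
  gcongr
  linarith

end SupBound

/-! ### Asymptotics of the Jost solution for large k -/

section Jost

variable {xI : ℝ} {V : ℝ → ℝ}

/-- Variation of constants. -/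
lemma IsSolution.variation_of_constants (hV : IsPotential xI V) {k : ℂ} (hk : k ≠ 0)
    {u u' : ℝ → ℂ} (hu : IsSolution V k u u') (s : ℝ) {a b : ℝ} (ha : 0 ≤ a) (hab : a ≤ b) :
    k⁻¹ * ∫ t in a..b, (V t : ℂ) * u t * Complex.sin (k * (s - t : ℝ)) =
      (u b * Complex.cos (k * (s - b : ℝ)) + u' b * Complex.sin (k * (s - b : ℝ)) / k) -
      (u a * Complex.cos (k * (s - a : ℝ)) + u' a * Complex.sin (k * (s - a : ℝ)) / k) := by
  rw [← intervalIntegral.integral_const_mul]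
  refine integral_eq_sub_of_hasDerivWithinAt_Ici (F := fun t => u t * Complex.cos (k * (s - t : ℝ))
    + u' t * Complex.sin (k * (s - t : ℝ)) / k) (fun t ht => ?_) ?_ ha hab
  · have h0 : HasDerivAt (fun t : ℝ => k * ((s - t : ℝ) : ℂ)) (-k) t := by
      have := ((hasDerivAt_id t).const_sub s).ofReal_comp.const_mul k
      simpa using this
    have h1 := (Complex.hasDerivAt_cos (k * ((s - t : ℝ) : ℂ))).comp t h0
    have h2 := (Complex.hasDerivAt_sin (k * ((s - t : ℝ) : ℂ))).comp t h0
    have := ((hu t ht).1.mul h1.hasDerivWithinAt).add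
      (((hu t ht).2.mul h2.hasDerivWithinAt).div_const k)
    refine this.congr_deriv ?_
    simp only [Function.comp_apply]
    field_simp
    ring
  · have h1 := hV.continuousOn
    have h2 := hu.continuousOn
    exact continuousOn_const.mul (((Complex.continuous_ofReal.comp_continuousOn h1).mul h2).mul
      (by fun_prop))

/-- Variation of constants between s and a point L ≥ xI, where the boundary term is the free
exponential; propagated back to s it is e^{iks}. -/
lemma jost_integral_eq (hV : IsPotential xI V) (hxI : 0 < xI) {k : ℂ} (hk : k ≠ 0) {s L : ℝ}
    (hs : 0 ≤ s) (hsL : s ≤ L) (hL : xI ≤ L) :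
    Complex.exp (Complex.I * k * s) - jost V xI s k =
      k⁻¹ * ∫ t in s..L, (V t : ℂ) * jost V xI t k * Complex.sin (k * (s - t : ℝ)) := by
  rw [(isSolution_jost hV hxI k).variation_of_constants hV hk s hs hsL]
  simp only [jost_eq_exp hV hxI k hL, sub_self, Complex.ofReal_zero, mul_zero, Complex.cos_zero,
    Complex.sin_zero, mul_one, zero_div, add_zero]
  congr 1
  have h1 : Complex.exp (Complex.I * k * s) =
      Complex.exp (Complex.I * k * L) * Complex.exp (k * (s - L : ℝ) * Complex.I) := by
    rw [← Complex.exp_add]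
    congr 1
    push_cast
    ring
  rw [h1, Complex.exp_mul_I]
  field_simp

/-- In the Volterra equation the decay e^{−t Im k} of the solution and the growth e^{(t−s) Im k} of
the sine multiply to e^{−s Im k}. The remaining factor BL/|k| is at most 1/2, so the bound improves
itself; one more insertion gives the O(1/k) error. -/
lemma norm_jost_le (hV : IsPotential xI V) (hxI : 0 < xI) {B : ℝ} (hB : ∀ x, 0 ≤ x → |V x| ≤ B)
    {L : ℝ} (hL : xI ≤ L) {k : ℂ} (hk0 : k ≠ 0) (hk : 0 ≤ k.im) (hkB : 2 * (B * L) ≤ ‖k‖) :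
    ∀ s ∈ Icc 0 L, ‖jost V xI s k‖ ≤ 2 * Real.exp (-k.im * s) ∧
      ‖jost V xI s k - Complex.exp (Complex.I * k * s)‖ ≤ 2 * (B * L) / ‖k‖ * Real.exp (-k.im * s)
      := by
  have hL0 : 0 ≤ L := hxI.le.trans hL
  have hB0 : 0 ≤ B := (abs_nonneg _).trans (hB 0 le_rfl)
  have hkn : 0 < ‖k‖ := norm_pos_iff.mpr hk0
  have key : ∀ M, 0 ≤ M → (∀ s ∈ Icc 0 L, ‖jost V xI s k‖ ≤ M * Real.exp (-k.im * s)) →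
      ∀ s ∈ Icc 0 L, ‖jost V xI s k - Complex.exp (Complex.I * k * s)‖ ≤
        M * (B * L) / ‖k‖ * Real.exp (-k.im * s) := by
    intro M hM h s hs
    rw [norm_sub_rev, jost_integral_eq hV hxI hk0 hs.1 hs.2 hL, norm_mul, norm_inv]
    have h1 : ‖∫ t in s..L, (V t : ℂ) * jost V xI t k * Complex.sin (k * (s - t : ℝ))‖ ≤
        (B * M * Real.exp (-k.im * s)) * |L - s| := by
      refine intervalIntegral.norm_integral_le_of_norm_le_const fun t ht => ?_
      rw [uIoc_of_le hs.2] at ht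
      have ht0 : 0 ≤ t := hs.1.trans ht.1.le
      rw [norm_mul, norm_mul, Complex.norm_real, Real.norm_eq_abs]
      calc |V t| * ‖jost V xI t k‖ * ‖Complex.sin (k * (s - t : ℝ))‖
          ≤ B * (M * Real.exp (-k.im * t)) * Real.exp (k.im * (t - s)) := by
            gcongr
            · exact hB t ht0
            · exact h t ⟨ht0, ht.2⟩
            · refine norm_sin_mul_ofReal_le hk ?_
              rw [abs_sub_comm, abs_of_nonneg (by linarith [ht.1])]
        _ = B * M * Real.exp (-k.im * s) := by
            rw [mul_assoc, mul_assoc, ← Real.exp_add, ← mul_assoc]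
            congr 2
            ring
    have h2 : |L - s| ≤ L := by
      rw [abs_of_nonneg (by linarith [hs.2])]
      linarith [hs.1]
    calc ‖k‖⁻¹ * ‖∫ t in s..L, (V t : ℂ) * jost V xI t k * Complex.sin (k * (s - t : ℝ))‖
        ≤ ‖k‖⁻¹ * ((B * M * Real.exp (-k.im * s)) * L) := by
          gcongr
          exact h1.trans (by gcongr)
      _ = _ := by
          field_simp
  have hb : ∀ s ∈ Icc 0 L, ‖jost V xI s k‖ ≤ 2 * 1 * Real.exp (-k.im * s) := by
    refine norm_le_of_self_improving hL0
      ((isSolution_jost hV hxI k).continuousOn.mono Icc_subset_Ici_self) fun M hM h s hs => ?_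
    have h1 := key M hM h s hs
    have h2 : M * (B * L) / ‖k‖ ≤ M / 2 := by
      rw [div_le_div_iff₀ hkn two_pos]
      nlinarith
    have h3 := norm_cexp_I_mul k s
    rw [← neg_mul] at h3
    calc ‖jost V xI s k‖ ≤ ‖Complex.exp (Complex.I * k * s)‖ +
          ‖jost V xI s k - Complex.exp (Complex.I * k * s)‖ := by
          simpa using norm_add_le (Complex.exp (Complex.I * k * s))
            (jost V xI s k - Complex.exp (Complex.I * k * s))
      _ ≤ Real.exp (-k.im * s) + M / 2 * Real.exp (-k.im * s) := by
          rw [h3]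
          gcongr
          exact h1.trans (by gcongr)
      _ = _ := by ring
  simp only [mul_one] at hb
  exact fun s hs => ⟨hb s hs, key 2 two_pos.le hb s hs⟩

/-- The identity `i k f(0) - f'(0) = ∫ e^{ikt} V f dt`. -/
lemma jost_zero_sub_deriv (hV : IsPotential xI V) (hxI : 0 < xI) (k : ℂ) :
    Complex.I * k * jost V xI 0 k - jostDeriv V xI 0 k =
      ∫ t in (0 : ℝ)..xI, (V t : ℂ) * jost V xI t k * Complex.exp (Complex.I * k * t) := by
  have hu := isSolution_jost hV hxI k
  -- At xI the bracket f' − ikf vanishes, because f is the exponential there, so only the endpoint 0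
  -- contributes.
  have := integral_eq_sub_of_hasDerivWithinAt_Ici
    (F := fun t => (jostDeriv V xI t k - Complex.I * k * jost V xI t k) *
      Complex.exp (Complex.I * k * t))
    (F' := fun t => (V t : ℂ) * jost V xI t k * Complex.exp (Complex.I * k * t))
    (fun t ht => by
      have := ((hu t ht).2.sub ((hu t ht).1.const_mul (Complex.I * k))).mul
        (hasDerivAt_cexp_I_mul k t).hasDerivWithinAt
      refine this.congr_deriv ?_
      simp only [Pi.sub_apply]
      linear_combination (-k ^ 2 * jost V xI t k * Complex.exp (Complex.I * k * t)) * Complex.I_sq)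
    (((Complex.continuous_ofReal.comp_continuousOn hV.continuousOn).mul hu.continuousOn).mul
      (by fun_prop)) le_rfl hxI.le
  rw [this]
  simp only [jost_eq_exp hV hxI k le_rfl, Complex.ofReal_zero, mul_zero, Complex.exp_zero]
  ring

/-- The point is the second-order expansion k f(0,k)/f_h(k) = 1/i + h/k + O(1/k²). It needs ik f(0)
− f'(0) = O(1/k), which comes from the oscillation of ∫ V e^{2ikt} dt; the rest is algebra. -/
theorem jost_asymptotics (hV : IsPotential xI V) (hxI : 0 < xI) (h : ℝ) {L : ℝ} (hL : xI ≤ L) :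
    ∃ C K : ℝ, 0 ≤ C ∧ 1 ≤ K ∧ ∀ k : ℂ, 0 ≤ k.im → K ≤ ‖k‖ →
      (∀ x ∈ Icc 0 L, ‖jost V xI x k - Complex.exp (Complex.I * k * x)‖ ≤
        C / ‖k‖ * Real.exp (-k.im * x)) ∧
      ‖jostFun V xI h k - Complex.I * k‖ ≤ C ∧ ‖k‖ / 2 ≤ ‖jostFun V xI h k‖ ∧
      ‖k * jost V xI 0 k / jostFun V xI h k - 1 / Complex.I - h / k‖ ≤ C / ‖k‖ ^ 2 := by
  obtain ⟨B, hB0, hB⟩ := hV.exists_bound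
  obtain ⟨C₀, hC₀, hosc⟩ := hV.exists_oscillatory_bound
  have hL0 : 0 ≤ L := hxI.le.trans hL
  -- C₂/|k| bounds the weighted error of f against e^{ikx}, C₁/|k| bounds ik f(0) − f'(0), C₃ bounds
  -- f_h − ik, and C₅ collects the part of the final numerator not involving f_h − ik.
  set C₂ := 2 * (B * L) with hC₂
  have hC₂0 : 0 ≤ C₂ := by positivity
  set C₁ := C₀ + B * C₂ * L with hC₁
  have hC₁0 : 0 ≤ C₁ := by positivity
  set C₃ := |h| * (1 + C₂) + C₂ + C₁ with hC₃
  have hC₃0 : 0 ≤ C₃ := by positivity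
  set C₅ := C₁ + |h| * C₂ with hC₅
  have hC₅0 : 0 ≤ C₅ := by positivity
  -- The threshold gives |k| ≥ C₂, needed for the a priori bound, and C₃ ≤ |k|/2, whence |f_h| ≥
  -- |k|/2.
  refine ⟨C₂ + C₃ + 2 * (C₅ + |h| * C₃), 1 + C₂ + 2 * C₃, by positivity, by linarith,
    fun k hk hkK => ?_⟩
  have hk1 : 1 ≤ ‖k‖ := by linarith
  have hkn : 0 < ‖k‖ := by linarith
  have hk0 : k ≠ 0 := norm_pos_iff.mp hkn
  have hf := fun s hs => (norm_jost_le hV hxI hB hL hk0 hk (by linarith) s hs).2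
  have hpart : 0 ≤ C₃ + 2 * (C₅ + |h| * C₃) := by positivity
  -- the value at the origin
  have hf0 : ‖jost V xI 0 k - 1‖ ≤ C₂ / ‖k‖ := by simpa using hf 0 ⟨le_rfl, hL0⟩
  have hf0' : ‖jost V xI 0 k - 1‖ ≤ C₂ := hf0.trans (div_le_self hC₂0 hk1)
  have hfn : ‖jost V xI 0 k‖ ≤ 1 + C₂ := by
    have := norm_add_le (1 : ℂ) (jost V xI 0 k - 1)
    simp only [add_sub_cancel, norm_one] at this
    linarith
  have hint : ‖Complex.I * k * jost V xI 0 k - jostDeriv V xI 0 k‖ ≤ C₁ / ‖k‖ := by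
    have hu := isSolution_jost hV hxI k
    have hVc : ContinuousOn (fun t => (V t : ℂ)) (uIcc 0 xI) := by
      rw [uIcc_of_le hxI.le]
      exact (Complex.continuous_ofReal.comp_continuousOn hV.continuousOn).mono Icc_subset_Ici_self
    have hjc : ContinuousOn (fun t => jost V xI t k) (uIcc 0 xI) := by
      rw [uIcc_of_le hxI.le]
      exact hu.continuousOn.mono Icc_subset_Ici_self
    have hec : ContinuousOn (fun t : ℝ => Complex.exp (Complex.I * k * t)) (uIcc 0 xI) := by
      fun_prop
    -- Replacing f by e^{ikt} leaves a purely oscillatory integral with frequency 2k and an error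
    -- that is already O(1/k).
    have hsplit : ∫ t in (0 : ℝ)..xI, (V t : ℂ) * jost V xI t k * Complex.exp (Complex.I * k * t) =
        (∫ t in (0 : ℝ)..xI, (V t : ℂ) * Complex.exp (Complex.I * (2 * k) * t)) +
        ∫ t in (0 : ℝ)..xI, (V t : ℂ) * (jost V xI t k - Complex.exp (Complex.I * k * t)) *
          Complex.exp (Complex.I * k * t) := by
      rw [← intervalIntegral.integral_add]
      · refine intervalIntegral.integral_congr fun t _ => ?_
        have : Complex.exp (Complex.I * (2 * k) * t) =
            Complex.exp (Complex.I * k * t) * Complex.exp (Complex.I * k * t) := by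
          rw [← Complex.exp_add]
          congr 1
          ring
        simp only [this]
        ring
      · exact (hVc.mul (by fun_prop)).intervalIntegrable
      · exact ((hVc.mul (hjc.sub hec)).mul hec).intervalIntegrable
    rw [jost_zero_sub_deriv hV hxI, hsplit]
    have h1 : ‖∫ t in (0 : ℝ)..xI, (V t : ℂ) * Complex.exp (Complex.I * (2 * k) * t)‖ ≤
        C₀ * (1 / ‖k‖) := by
      refine hosc (fun t => (Complex.I * (2 * k))⁻¹ * Complex.exp (Complex.I * (2 * k) * t)) _ xI _
        hxI.le (fun t => ?_) (by fun_prop) fun t ht => ?_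
      · refine ((hasDerivAt_cexp_I_mul (2 * k) t).const_mul _).congr_deriv ?_
        have : Complex.I * (2 * k) ≠ 0 := by simp [hk0]
        field_simp
      · rw [norm_mul, norm_cexp_I_mul, norm_inv, norm_mul, norm_mul, Complex.norm_I,
          Complex.norm_two, one_mul]
        have : Real.exp (-((2 * k).im * t)) ≤ 1 := by
          rw [Real.exp_le_one_iff]
          have : (2 * k).im = 2 * k.im := by simp
          rw [this]
          have := mul_nonneg hk ht.1
          linarith
        calc (2 * ‖k‖)⁻¹ * Real.exp (-((2 * k).im * t)) ≤ (1 * ‖k‖)⁻¹ * 1 := by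
              gcongr
              norm_num
          _ = 1 / ‖k‖ := by simp
    have h2 : ‖∫ t in (0 : ℝ)..xI, (V t : ℂ) * (jost V xI t k - Complex.exp (Complex.I * k * t)) *
          Complex.exp (Complex.I * k * t)‖ ≤ B * (C₂ / ‖k‖) * |xI - 0| := by
      refine intervalIntegral.norm_integral_le_of_norm_le_const fun t ht => ?_
      rw [uIoc_of_le hxI.le] at ht
      have hee : Real.exp (-k.im * t) ≤ 1 := by
        rw [Real.exp_le_one_iff]
        have := mul_nonneg hk ht.1.le
        linarith
      rw [norm_mul, norm_mul, Complex.norm_real, Real.norm_eq_abs, norm_cexp_I_mul, ← neg_mul]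
      calc _ ≤ B * (C₂ / ‖k‖ * 1) * 1 := by
            gcongr
            · exact hB t ht.1.le
            · exact (hf t ⟨ht.1.le, ht.2.trans hL⟩).trans (by gcongr)
        _ = _ := by ring
    rw [sub_zero, abs_of_pos hxI] at h2
    calc _ ≤ _ := norm_add_le _ _
      _ ≤ C₀ * (1 / ‖k‖) + B * (C₂ / ‖k‖) * L := add_le_add h1 (h2.trans (by gcongr))
      _ = _ := by rw [hC₁]; ring
  have hint' : ‖Complex.I * k * jost V xI 0 k - jostDeriv V xI 0 k‖ ≤ C₁ :=
    hint.trans (div_le_self hC₁0 hk1)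
  have hhn : ‖(h : ℂ)‖ = |h| := by rw [Complex.norm_real, Real.norm_eq_abs]
  have hJ : ‖jostFun V xI h k - Complex.I * k‖ ≤ C₃ := by
    have e : jostFun V xI h k - Complex.I * k = h * jost V xI 0 k +
        Complex.I * k * (jost V xI 0 k - 1) -
        (Complex.I * k * jost V xI 0 k - jostDeriv V xI 0 k) := by
      rw [jostFun_eq]; ring
    rw [e]
    refine (norm_sub_le _ _).trans (add_le_add ((norm_add_le _ _).trans (add_le_add ?_ ?_)) hint')
    · rw [norm_mul, hhn]
      gcongr
    · rw [norm_mul, norm_mul, Complex.norm_I, one_mul]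
      calc _ ≤ ‖k‖ * (C₂ / ‖k‖) := by gcongr
        _ = C₂ := by field_simp
  have hJl : ‖k‖ / 2 ≤ ‖jostFun V xI h k‖ := by
    have h1 : ‖Complex.I * k‖ ≤ ‖jostFun V xI h k‖ + ‖jostFun V xI h k - Complex.I * k‖ := by
      have := norm_sub_le (jostFun V xI h k) (jostFun V xI h k - Complex.I * k)
      rwa [sub_sub_cancel] at this
    rw [norm_mul, Complex.norm_I, one_mul] at h1
    linarith
  have hJ0 : jostFun V xI h k ≠ 0 := norm_pos_iff.mp (by linarith)
  refine ⟨fun x hx => (hf x hx).trans ?_, hJ.trans (by linarith [mul_nonneg (abs_nonneg h) hC₃0]), hJl, ?_⟩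
  · gcongr
    linarith
  -- All terms of lower order cancel: the numerator is bounded while the denominator has order k².
  · have e : k * jost V xI 0 k / jostFun V xI h k - 1 / Complex.I - h / k =
        (((Complex.I * k * jost V xI 0 k - jostDeriv V xI 0 k) - h * (jost V xI 0 k - 1)) * k -
          Complex.I * h * (jostFun V xI h k - Complex.I * k)) /
        (Complex.I * jostFun V xI h k * k) := by
      have hI := Complex.I_ne_zero
      field_simp
      rw [jostFun_eq]
      linear_combination (-(h * k : ℂ)) * Complex.I_sq
    have hnum : ‖((Complex.I * k * jost V xI 0 k - jostDeriv V xI 0 k) -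
        h * (jost V xI 0 k - 1)) * k - Complex.I * h * (jostFun V xI h k - Complex.I * k)‖ ≤
        C₅ + |h| * C₃ := by
      refine (norm_sub_le _ _).trans (add_le_add ?_ ?_)
      · rw [norm_mul]
        calc _ ≤ (C₁ / ‖k‖ + |h| * (C₂ / ‖k‖)) * ‖k‖ := by
              gcongr
              refine (norm_sub_le _ _).trans (add_le_add hint ?_)
              rw [norm_mul, hhn]
              gcongr
          _ = C₅ := by
              rw [hC₅]
              field_simp
      · rw [norm_mul, norm_mul, Complex.norm_I, one_mul, hhn]
        gcongr
    rw [e, norm_div, norm_mul, norm_mul, Complex.norm_I, one_mul]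
    have hpos : 0 < ‖k‖ / 2 * ‖k‖ := by positivity
    calc _ ≤ (C₅ + |h| * C₃) / (‖k‖ / 2 * ‖k‖) := by gcongr
      _ = 2 * (C₅ + |h| * C₃) / ‖k‖ ^ 2 := by field_simp
      _ ≤ _ := by
          gcongr
          linarith

end Jost

/-! ### Asymptotics of the regular solution for large k -/

section Regular

variable {xI : ℝ} {V : ℝ → ℝ}

/-- The same self-improving argument as for the Jost solution, now started at 0 and with growth e^{s
Im k} in place of decay. -/
lemma norm_regular_le (hV : IsPotential xI V) (h : ℝ) {B : ℝ} (hB : ∀ x, 0 ≤ x → |V x| ≤ B)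
    {L : ℝ} (hL : 0 ≤ L) {k : ℂ} (hk1 : 1 ≤ ‖k‖) (hk : 0 ≤ k.im) (hkB : 2 * (B * L) ≤ ‖k‖) :
    ∀ s ∈ Icc 0 L, ‖(sol V 1 (-h) k s).1 - Complex.cos (k * s)‖ ≤
      (|h| + 2 * (1 + |h|) * (B * L)) / ‖k‖ * Real.exp (k.im * s) := by
  have hB0 : 0 ≤ B := (abs_nonneg _).trans (hB 0 le_rfl)
  have hkn : 0 < ‖k‖ := by linarith
  have hk0 : k ≠ 0 := norm_pos_iff.mp hkn
  have hu := isSolution_sol hV 1 (-h) k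
  have key : ∀ M, 0 ≤ M → (∀ s ∈ Icc 0 L, ‖(sol V 1 (-h) k s).1‖ ≤ M * Real.exp (k.im * s)) →
      ∀ s ∈ Icc 0 L, ‖(sol V 1 (-h) k s).1 - Complex.cos (k * s)‖ ≤
        (|h| + M * (B * L)) / ‖k‖ * Real.exp (k.im * s) := by
    intro M hM hb s hs
    have e := hu.variation_of_constants hV hk0 s le_rfl hs.1
    simp only [sub_self, Complex.ofReal_zero, mul_zero, Complex.cos_zero, Complex.sin_zero, mul_one,
      zero_div, add_zero, sub_zero, sol_zero hV, one_mul] at e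
    have e2 : (sol V 1 (-h) k s).1 - Complex.cos (k * s) = -h * Complex.sin (k * s) / k +
        k⁻¹ * ∫ t in (0 : ℝ)..s, (V t : ℂ) * (sol V 1 (-h) k t).1 *
          Complex.sin (k * (s - t : ℝ)) := by
      rw [e]; ring
    have h1 : ‖∫ t in (0 : ℝ)..s, (V t : ℂ) * (sol V 1 (-h) k t).1 *
          Complex.sin (k * (s - t : ℝ))‖ ≤ (B * M * Real.exp (k.im * s)) * |s - 0| := by
      refine intervalIntegral.norm_integral_le_of_norm_le_const fun t ht => ?_
      rw [uIoc_of_le hs.1] at ht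
      rw [norm_mul, norm_mul, Complex.norm_real, Real.norm_eq_abs]
      calc _ ≤ B * (M * Real.exp (k.im * t)) * Real.exp (k.im * (s - t)) := by
            gcongr
            · exact hB t ht.1.le
            · exact hb t ⟨ht.1.le, ht.2.trans hs.2⟩
            · refine norm_sin_mul_ofReal_le hk ?_
              rw [abs_of_nonneg (by linarith [ht.2])]
        _ = B * M * Real.exp (k.im * s) := by
            rw [mul_assoc, mul_assoc, ← Real.exp_add, ← mul_assoc]
            congr 2
            ring
    rw [sub_zero, abs_of_nonneg hs.1] at h1
    rw [e2]
    calc _ ≤ _ := norm_add_le _ _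
      _ ≤ |h| * Real.exp (k.im * s) / ‖k‖ + ‖k‖⁻¹ * (B * M * Real.exp (k.im * s) * L) := by
          rw [norm_div, norm_mul, norm_mul, norm_neg, Complex.norm_real, Real.norm_eq_abs, norm_inv]
          gcongr
          · exact norm_sin_mul_ofReal_le hk (abs_of_nonneg hs.1).le
          · exact h1.trans (by gcongr; exact hs.2)
      _ = _ := by field_simp
  have hb : ∀ s ∈ Icc 0 L, ‖(sol V 1 (-h) k s).1‖ ≤ 2 * (1 + |h|) * Real.exp (k.im * s) := by
    refine norm_le_of_self_improving hL (hu.continuousOn.mono Icc_subset_Ici_self)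
      fun M hM hb s hs => ?_
    have h1 := key M hM hb s hs
    have h2 : (|h| + M * (B * L)) / ‖k‖ ≤ |h| + M / 2 := by
      rw [div_le_iff₀ hkn]
      nlinarith [abs_nonneg h]
    have h3 := norm_cos_mul_ofReal_le hk (abs_of_nonneg hs.1).le
    calc ‖(sol V 1 (-h) k s).1‖ ≤ ‖Complex.cos (k * s)‖ +
          ‖(sol V 1 (-h) k s).1 - Complex.cos (k * s)‖ := by
          simpa using norm_add_le (Complex.cos (k * s))
            ((sol V 1 (-h) k s).1 - Complex.cos (k * s))
      _ ≤ Real.exp (k.im * s) + (|h| + M / 2) * Real.exp (k.im * s) := by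
          gcongr
          exact h1.trans (by gcongr)
      _ = _ := by ring
  exact key _ (by positivity) hb

/-- The value `h - ½ ∫₀ˣ V` of the transformation kernel on the diagonal. -/
def diagValue (V : ℝ → ℝ) (h x : ℝ) : ℝ := h - 1 / 2 * ∫ t in (0 : ℝ)..x, V t

/-- Put φ ≈ cos kt in the Volterra integral and use sin k(x−t) cos kt = ½ sin kx + ½ sin k(x−2t).
The first term contributes ½ sin(kx) ∫₀ˣ V, which joins the term −h sin(kx)/k; the second oscillates
and gains a further 1/k. -/
theorem regular_asymptotics (hV : IsPotential xI V) (h : ℝ) {x : ℝ} (hx : 0 ≤ x) :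
    ∃ C K : ℝ, 0 ≤ C ∧ 1 ≤ K ∧ ∀ k : ℂ, 0 ≤ k.im → K ≤ ‖k‖ →
      ‖Complex.cos (k * x) - diagValue V h x * (Complex.sin (k * x) / k) -
        (sol V 1 (-h) k x).1‖ ≤ C / ‖k‖ ^ 2 * Real.exp (k.im * x) := by
  obtain ⟨B, hB0, hB⟩ := hV.exists_bound
  obtain ⟨C₀, hC₀, hosc⟩ := hV.exists_oscillatory_bound
  set C₁ := |h| + 2 * (1 + |h|) * (B * x) with hC₁
  have hC₁0 : 0 ≤ C₁ := by positivity
  refine ⟨B * C₁ * x + C₀, 1 + 2 * (B * x), by positivity, by nlinarith, fun k hk hkK => ?_⟩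
  have hBx : 0 ≤ B * x := by positivity
  have hk1 : 1 ≤ ‖k‖ := by linarith
  have hkn : 0 < ‖k‖ := by linarith
  have hk0 : k ≠ 0 := norm_pos_iff.mp hkn
  have hφ := norm_regular_le hV h hB hx hk1 hk (by linarith)
  have hu := isSolution_sol hV 1 (-h) k
  have e := hu.variation_of_constants hV hk0 x le_rfl hx
  simp only [sub_self, Complex.ofReal_zero, mul_zero, Complex.cos_zero, Complex.sin_zero, mul_one,
    zero_div, add_zero, sub_zero, sol_zero hV, one_mul] at e
  have hVc : ContinuousOn (fun t => (V t : ℂ)) (uIcc 0 x) := by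
    rw [uIcc_of_le hx]
    exact (Complex.continuous_ofReal.comp_continuousOn hV.continuousOn).mono Icc_subset_Ici_self
  have huc : ContinuousOn (fun t => (sol V 1 (-h) k t).1) (uIcc 0 x) := by
    rw [uIcc_of_le hx]
    exact hu.continuousOn.mono Icc_subset_Ici_self
  have hsplit : ∫ t in (0 : ℝ)..x, (V t : ℂ) * (sol V 1 (-h) k t).1 *
        Complex.sin (k * (x - t : ℝ)) =
      (∫ t in (0 : ℝ)..x, (V t : ℂ) * ((sol V 1 (-h) k t).1 - Complex.cos (k * t)) *
        Complex.sin (k * (x - t : ℝ))) +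
      (Complex.sin (k * x) / 2 * (∫ t in (0 : ℝ)..x, V t : ℝ) +
        1 / 2 * ∫ t in (0 : ℝ)..x, (V t : ℂ) * Complex.sin (k * (x - 2 * t : ℝ))) := by
    rw [← intervalIntegral.integral_ofReal, ← intervalIntegral.integral_const_mul,
      ← intervalIntegral.integral_const_mul, ← intervalIntegral.integral_add,
      ← intervalIntegral.integral_add]
    · refine intervalIntegral.integral_congr fun t _ => ?_
      have h1 : Complex.sin (k * x) = Complex.sin (k * (x - t : ℝ)) * Complex.cos (k * t) +
          Complex.cos (k * (x - t : ℝ)) * Complex.sin (k * t) := by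
        rw [← Complex.sin_add]
        congr 1
        push_cast
        ring
      have h2 : Complex.sin (k * (x - 2 * t : ℝ)) =
          Complex.sin (k * (x - t : ℝ)) * Complex.cos (k * t) -
          Complex.cos (k * (x - t : ℝ)) * Complex.sin (k * t) := by
        rw [← Complex.sin_sub]
        congr 1
        push_cast
        ring
      simp only [h1, h2]
      ring
    · exact ((hVc.mul (huc.sub (by fun_prop))).mul (by fun_prop)).intervalIntegrable
    · refine ContinuousOn.intervalIntegrable ?_
      exact (continuousOn_const.mul hVc).add
        (continuousOn_const.mul (hVc.mul (by fun_prop)))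
    · exact (continuousOn_const.mul hVc).intervalIntegrable
    · exact (continuousOn_const.mul (hVc.mul (by fun_prop))).intervalIntegrable
  have h1 : ‖∫ t in (0 : ℝ)..x, (V t : ℂ) * ((sol V 1 (-h) k t).1 - Complex.cos (k * t)) *
        Complex.sin (k * (x - t : ℝ))‖ ≤ (B * C₁ / ‖k‖ * Real.exp (k.im * x)) * |x - 0| := by
    refine intervalIntegral.norm_integral_le_of_norm_le_const fun t ht => ?_
    rw [uIoc_of_le hx] at ht
    rw [norm_mul, norm_mul, Complex.norm_real, Real.norm_eq_abs]
    calc _ ≤ B * (C₁ / ‖k‖ * Real.exp (k.im * t)) * Real.exp (k.im * (x - t)) := by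
          gcongr
          · exact hB t ht.1.le
          · exact hφ t ⟨ht.1.le, ht.2⟩
          · refine norm_sin_mul_ofReal_le hk ?_
            rw [abs_of_nonneg (by linarith [ht.2])]
      _ = B * C₁ / ‖k‖ * Real.exp (k.im * x) := by
          have : Real.exp (k.im * x) = Real.exp (k.im * t) * Real.exp (k.im * (x - t)) := by
            rw [← Real.exp_add]
            congr 1
            ring
          rw [this]
          ring
  rw [sub_zero, abs_of_nonneg hx] at h1
  have h2 : ‖∫ t in (0 : ℝ)..x, (V t : ℂ) * Complex.sin (k * (x - 2 * t : ℝ))‖ ≤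
      C₀ * (1 / ‖k‖ * Real.exp (k.im * x)) := by
    refine hosc (fun t => (2 * k)⁻¹ * Complex.cos (k * (x - 2 * t : ℝ))) _ x _ hx (fun t => ?_)
      (by fun_prop) fun t ht => ?_
    · have h0 : HasDerivAt (fun t : ℝ => k * ((x - 2 * t : ℝ) : ℂ)) (-(2 * k)) t := by
        have := (((hasDerivAt_id t).const_mul 2).const_sub x).ofReal_comp.const_mul k
        refine this.congr_deriv ?_
        push_cast
        ring
      have h1 := ((Complex.hasDerivAt_cos (k * ((x - 2 * t : ℝ) : ℂ))).comp t h0).const_mul (2 * k)⁻¹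
      refine h1.congr_deriv ?_
      field_simp
    · rw [norm_mul, norm_inv, norm_mul, Complex.norm_two]
      have : ‖Complex.cos (k * (x - 2 * t : ℝ))‖ ≤ Real.exp (k.im * x) :=
        norm_cos_mul_ofReal_le hk (abs_le.mpr ⟨by linarith [ht.2], by linarith [ht.1]⟩)
      calc _ ≤ (1 * ‖k‖)⁻¹ * Real.exp (k.im * x) := by
            gcongr
            norm_num
        _ = _ := by simp
  have e2 : Complex.cos (k * x) - diagValue V h x * (Complex.sin (k * x) / k) -
        (sol V 1 (-h) k x).1 = -(k⁻¹ * ((∫ t in (0 : ℝ)..x, (V t : ℂ) *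
          ((sol V 1 (-h) k t).1 - Complex.cos (k * t)) * Complex.sin (k * (x - t : ℝ))) +
        1 / 2 * ∫ t in (0 : ℝ)..x, (V t : ℂ) * Complex.sin (k * (x - 2 * t : ℝ)))) := by
    rw [hsplit] at e
    have hd : (diagValue V h x : ℂ) = h - 1 / 2 * ((∫ t in (0 : ℝ)..x, V t : ℝ) : ℂ) := by
      simp only [diagValue, Complex.ofReal_sub, Complex.ofReal_mul, Complex.ofReal_div,
        Complex.ofReal_one, Complex.ofReal_ofNat]
    rw [hd]
    linear_combination e
  rw [e2, norm_neg, norm_mul, norm_inv]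
  calc _ ≤ ‖k‖⁻¹ * (B * C₁ / ‖k‖ * Real.exp (k.im * x) * x +
        1 * (C₀ * (1 / ‖k‖ * Real.exp (k.im * x)))) := by
        gcongr
        refine (norm_add_le _ _).trans (add_le_add h1 ?_)
        rw [norm_mul]
        gcongr
        norm_num
    _ = _ := by
        field_simp

end Regular

/-! ### Zeros of the Jost function in the closed upper half-plane -/

section Spectral

variable {xI : ℝ} {V : ℝ → ℝ}

lemma hasDerivWithinAt_conj {f : ℝ → ℂ} {f' : ℂ} {s : Set ℝ} {x : ℝ}
    (hf : HasDerivWithinAt f f' s x) :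
    HasDerivWithinAt (fun x => (starRingEnd ℂ) (f x)) ((starRingEnd ℂ) f') s x :=
  hf.star

/-- Lower bound for the Jost function coming from Green's identity. -/
lemma abs_re_mul_exp_le (hV : IsPotential xI V) (hxI : 0 < xI) (h : ℝ) {k : ℂ} (hk : 0 ≤ k.im) :
    |k.re| * Real.exp (-(2 * k.im * xI)) ≤ ‖jost V xI 0 k‖ * ‖jostFun V xI h k‖ := by
  have hu := isSolution_jost hV hxI k
  -- The form f̄ f' − f f̄' has derivative −4i Re k Im k |f|². Its value at xI is 2i Re k e^{−2 xI
  -- Im k}, so in the value at 0 both contributions have the sign of Re k and cannot cancel.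
  have hI := integral_eq_sub_of_hasDerivWithinAt_Ici
    (F := fun t => (starRingEnd ℂ) (jost V xI t k) * jostDeriv V xI t k -
      jost V xI t k * (starRingEnd ℂ) (jostDeriv V xI t k))
    (F' := fun t => (-(4 * k.re * k.im) * Complex.I) * ((‖jost V xI t k‖ ^ 2 : ℝ) : ℂ))
    (fun t ht => by
      have := ((hasDerivWithinAt_conj (hu t ht).1).mul (hu t ht).2).sub
        ((hu t ht).1.mul (hasDerivWithinAt_conj (hu t ht).2))
      refine this.congr_deriv ?_
      have e1 : ((‖jost V xI t k‖ ^ 2 : ℝ) : ℂ) =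
          (starRingEnd ℂ) (jost V xI t k) * jost V xI t k := by
        rw [Complex.conj_mul']
        push_cast
        rfl
      have e2 : (starRingEnd ℂ) k ^ 2 - k ^ 2 = -(4 * k.re * k.im) * Complex.I := by
        apply Complex.ext <;> (simp [pow_two]; try ring)
      rw [e1, ← e2]
      simp only [map_mul, map_sub, map_pow, Complex.conj_ofReal]
      ring)
    (by
      have := hu.continuousOn
      refine continuousOn_const.mul (Complex.continuous_ofReal.comp_continuousOn ?_)
      exact this.norm.pow 2)
    le_rfl hxI.le
  rw [intervalIntegral.integral_const_mul, intervalIntegral.integral_ofReal] at hI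
  set J := ∫ t in (0 : ℝ)..xI, ‖jost V xI t k‖ ^ 2
  have hJ : 0 ≤ J := intervalIntegral.integral_nonneg hxI.le fun t _ => by positivity
  have hend : (starRingEnd ℂ) (jost V xI xI k) * jostDeriv V xI xI k -
      jost V xI xI k * (starRingEnd ℂ) (jostDeriv V xI xI k) =
      2 * k.re * Complex.I * (Real.exp (-(2 * k.im * xI)) : ℂ) := by
    rw [(jost_eq_exp hV hxI k le_rfl).1, (jost_eq_exp hV hxI k le_rfl).2]
    have e1 : (starRingEnd ℂ) (Complex.exp (Complex.I * k * xI)) * Complex.exp (Complex.I * k * xI)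
        = (Real.exp (-(2 * k.im * xI)) : ℂ) := by
      rw [Complex.conj_mul', norm_cexp_I_mul, ← Complex.ofReal_pow, ← Real.exp_nat_mul]
      congr 2
      push_cast
      ring
    have e2 : k + (starRingEnd ℂ) k = 2 * k.re := by
      rw [Complex.add_conj]
      push_cast
      rfl
    rw [← e1]
    simp only [map_mul, Complex.conj_I]
    linear_combination (Complex.I * (starRingEnd ℂ) (Complex.exp (Complex.I * k * xI)) *
      Complex.exp (Complex.I * k * xI)) * e2
  -- Because h is real, f' may be replaced by f_h in the form at 0.
  have hzero : (starRingEnd ℂ) (jost V xI 0 k) * jostDeriv V xI 0 k -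
      jost V xI 0 k * (starRingEnd ℂ) (jostDeriv V xI 0 k) =
      (starRingEnd ℂ) (jost V xI 0 k) * jostFun V xI h k -
      jost V xI 0 k * (starRingEnd ℂ) (jostFun V xI h k) := by
    rw [jostFun_eq]
    simp only [map_add, map_mul, Complex.conj_ofReal]
    ring
  rw [hend, hzero] at hI
  have hmain : (starRingEnd ℂ) (jost V xI 0 k) * jostFun V xI h k -
      jost V xI 0 k * (starRingEnd ℂ) (jostFun V xI h k) =
      Complex.I * ((2 * k.re * (Real.exp (-(2 * k.im * xI)) + 2 * k.im * J) : ℝ) : ℂ) := by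
    push_cast
    push_cast at hI
    linear_combination hI
  have hn := congrArg norm hmain
  rw [norm_mul, Complex.norm_I, one_mul, Complex.norm_real, Real.norm_eq_abs, abs_mul, abs_mul,
    abs_two, abs_of_nonneg (a := Real.exp (-(2 * k.im * xI)) + 2 * k.im * J) (by positivity)] at hn
  have hle := norm_sub_le ((starRingEnd ℂ) (jost V xI 0 k) * jostFun V xI h k)
    (jost V xI 0 k * (starRingEnd ℂ) (jostFun V xI h k))
  rw [hn, norm_mul, norm_mul, Complex.norm_conj, Complex.norm_conj] at hle
  have h3 : |k.re| * Real.exp (-(2 * k.im * xI)) ≤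
      |k.re| * (Real.exp (-(2 * k.im * xI)) + 2 * k.im * J) := by
    gcongr
    have : 0 ≤ 2 * k.im * J := by positivity
    linarith
  linarith

/-- Self-adjointness in disguise: k² must be real, so zeros lie on the imaginary axis. -/
lemma jostFun_ne_zero (hV : IsPotential xI V) (hxI : 0 < xI) (h : ℝ) {k : ℂ} (hk : 0 ≤ k.im)
    (hre : k.re ≠ 0) : jostFun V xI h k ≠ 0 := by
  intro h0
  have := abs_re_mul_exp_le hV hxI h hk
  rw [h0, norm_zero, mul_zero] at this
  have : 0 < |k.re| * Real.exp (-(2 * k.im * xI)) :=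
    mul_pos (abs_pos.mpr hre) (Real.exp_pos _)
  linarith

/-- Approach the zero horizontally, along k + s with s real. Green's bound gives |s| e^{−2 xI Im k}
≤ |f(0,k+s)| |f_h(k+s)|, so the difference quotient of f_h cannot tend to 0. The argument includes k
= 0. -/
lemma deriv_jostFun_ne_zero (hV : IsPotential xI V) (hxI : 0 < xI) (h : ℝ) {k : ℂ}
    (hk : 0 ≤ k.im) (h0 : jostFun V xI h k = 0) : deriv (jostFun V xI h) k ≠ 0 := by
  intro hd
  have hre : k.re = 0 := by
    by_contra hre
    exact jostFun_ne_zero hV hxI h hk hre h0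
  have h1 : HasDerivAt (jostFun V xI h) 0 k := hd ▸ (differentiable_jostFun hV hxI h k).hasDerivAt
  have h2 : HasDerivAt (fun s : ℝ => jostFun V xI h (k + s)) 0 0 := by
    have h3 : HasDerivAt (fun s : ℝ => k + (s : ℂ)) 1 0 := by
      simpa using (Complex.ofRealCLM.hasDerivAt (x := (0 : ℝ))).const_add k
    have h4 : HasDerivAt (jostFun V xI h) 0 (k + ((0 : ℝ) : ℂ)) := by simpa using h1
    exact (h4.comp (0 : ℝ) h3).congr_deriv (zero_mul _)
  have h3 := (hasDerivAt_iff_tendsto_slope.mp h2).norm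
  have h4 : Tendsto (fun s : ℝ => ‖jost V xI 0 (k + s)‖) (𝓝[≠] 0) (𝓝 ‖jost V xI 0 k‖) := by
    have hc : Continuous fun s : ℝ => ‖jost V xI 0 (k + s)‖ :=
      ((differentiable_jost_zero hV hxI).continuous.comp (by fun_prop)).norm
    have := hc.tendsto 0
    simp only [Complex.ofReal_zero, add_zero] at this
    exact this.mono_left nhdsWithin_le_nhds
  have h5 := h4.mul h3
  rw [norm_zero, mul_zero] at h5
  have h6 : Real.exp (-(2 * k.im * xI)) ≤ 0 := by
    refine ge_of_tendsto h5 (eventually_nhdsWithin_of_forall fun s hs => ?_)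
    have h7 := abs_re_mul_exp_le hV hxI h (k := k + s) (by simpa using hk)
    simp only [Complex.add_re, hre, Complex.ofReal_re, zero_add, Complex.add_im, Complex.ofReal_im,
      add_zero] at h7
    have hs' : 0 < |s| := abs_pos.mpr hs
    rw [slope_def_module, norm_smul, Complex.ofReal_zero, add_zero, h0, sub_zero, sub_zero, norm_inv,
      Real.norm_eq_abs]
    calc _ = |s|⁻¹ * (|s| * Real.exp (-(2 * k.im * xI))) := by field_simp
      _ ≤ |s|⁻¹ * (‖jost V xI 0 (k + s)‖ * ‖jostFun V xI h (k + s)‖) := by gcongr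
      _ = _ := by ring
  linarith [Real.exp_pos (-(2 * k.im * xI))]

/-- The zeros of the Jost function in the closed upper half-plane. -/
lemma finite_jostFun_zeros (hV : IsPotential xI V) (hxI : 0 < xI) (h : ℝ) :
    {k : ℂ | 0 ≤ k.im ∧ jostFun V xI h k = 0}.Finite := by
  obtain ⟨C, K, hC, hK, hJ⟩ := jost_asymptotics hV hxI h le_rfl
  set Z := {k : ℂ | 0 ≤ k.im ∧ jostFun V xI h k = 0}
  by_contra hinf
  have hsub : Z ⊆ Metric.closedBall 0 K := fun k hk => by
    rw [mem_closedBall_zero_iff]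
    by_contra! hlt
    have := (hJ k hk.1 hlt.le).2.2.1
    rw [hk.2, norm_zero] at this
    linarith
  have hclosed : IsClosed Z := (isClosed_le continuous_const Complex.continuous_im).inter
    (isClosed_eq (differentiable_jostFun hV hxI h).continuous continuous_const)
  -- Infinitely many zeros in the disc would accumulate at a zero, where the nonvanishing derivative
  -- excludes other zeros nearby.
  obtain ⟨z, -, hz⟩ := Set.Infinite.exists_accPt_of_subset_isCompact (s := Z) hinf
    (isCompact_closedBall (0 : ℂ) K) hsub
  have hzZ : z ∈ Z := hclosed.closure_subset (mem_closure_iff_clusterPt.mpr hz.clusterPt)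
  have hd := deriv_jostFun_ne_zero hV hxI h hzZ.1 hzZ.2
  have := ((differentiable_jostFun hV hxI h z).hasDerivAt).eventually_ne (c := 0) hd
  have h1 := accPt_iff_frequently_nhdsNE.mp hz
  exact h1 (this.mono fun w hw hwZ => hw hwZ.2)

end Spectral

/-! ### Simple poles and removal of principal parts -/

section Poles

lemma analyticAt_dslope {f : ℂ → ℂ} {z₀ : ℂ} (hf : AnalyticAt ℂ f z₀) :
    AnalyticAt ℂ (dslope f z₀) z₀ := by
  obtain ⟨p, hp⟩ := hf
  exact ⟨_, hp.has_fpower_series_dslope_fslope⟩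

/-- `F` has at `z₀` at most a simple pole with residue `ρ`. -/
def HasSimplePoleAt (F : ℂ → ℂ) (ρ z₀ : ℂ) : Prop :=
  ∃ G : ℂ → ℂ, AnalyticAt ℂ G z₀ ∧ ∀ᶠ z in 𝓝[≠] z₀, F z = ρ / (z - z₀) + G z

/-- Factor D = (z − z₀) q with q(z₀) = D'(z₀); the analytic part is then the divided difference of
N/q. N may vanish at z₀, in which case the residue is 0. -/
lemma hasSimplePoleAt_div {N D : ℂ → ℂ} {z₀ : ℂ} (hN : AnalyticAt ℂ N z₀) (hD : AnalyticAt ℂ D z₀)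
    (h0 : D z₀ = 0) (hd : deriv D z₀ ≠ 0) :
    HasSimplePoleAt (fun z => N z / D z) (N z₀ / deriv D z₀) z₀ := by
  have hq := analyticAt_dslope hD
  have hq0 : dslope D z₀ z₀ ≠ 0 := by rwa [dslope_same]
  have hH : AnalyticAt ℂ (fun z => N z / dslope D z₀ z) z₀ := hN.div hq hq0
  refine ⟨dslope (fun z => N z / dslope D z₀ z) z₀, analyticAt_dslope hH, ?_⟩
  filter_upwards [self_mem_nhdsWithin, (hq.continuousAt.eventually_ne hq0).filter_mono
    nhdsWithin_le_nhds] with z hz hqz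
  have hz' : z - z₀ ≠ 0 := sub_ne_zero.mpr hz
  have e1 : D z = (z - z₀) * dslope D z₀ z := by
    have := sub_smul_dslope D z₀ z
    rw [h0, sub_zero, smul_eq_mul] at this
    exact this.symm
  have e2 := sub_smul_dslope (fun z => N z / dslope D z₀ z) z₀ z
  simp only [smul_eq_mul, dslope_same] at e2
  have e3 : dslope (fun z => N z / dslope D z₀ z) z₀ z =
      (N z / dslope D z₀ z - N z₀ / deriv D z₀) / (z - z₀) := by
    rw [eq_div_iff hz', ← e2]
    ring
  rw [e3, e1]
  field_simp
  ring

lemma HasSimplePoleAt.sub_analytic {F G : ℂ → ℂ} {ρ z₀ : ℂ} (hF : HasSimplePoleAt F ρ z₀)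
    (hG : AnalyticAt ℂ G z₀) : HasSimplePoleAt (fun z => F z - G z) ρ z₀ := by
  obtain ⟨H, hH, h⟩ := hF
  exact ⟨fun z => H z - G z, hH.sub hG, h.mono fun z hz => by
    dsimp only
    rw [hz]
    ring⟩

/-- Subtraction of finitely many principal parts. -/
lemma exists_analytic_part {F : ℂ → ℂ} {T : Finset ℂ} {ρ : ℂ → ℂ}
    (hpole : ∀ t ∈ T, HasSimplePoleAt F (ρ t) t) :
    ∃ P : ℂ → ℂ, (∀ z, (z ∈ T ∨ AnalyticAt ℂ F z) → AnalyticAt ℂ P z) ∧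
      ∀ z, z ∉ T → F z = P z + ∑ t ∈ T, ρ t / (z - t) := by
  classical
  choose! G hG hFG using hpole
  have hev : ∀ z : ℂ, ∀ᶠ w in 𝓝[≠] z, w ∉ T := fun z => by
    have : ((T : Set ℂ) \ {z}).Finite := T.finite_toSet.subset sdiff_subset
    have h2 := this.isClosed.isOpen_compl.mem_nhds (x := z) (by simp)
    filter_upwards [mem_nhdsWithin_of_mem_nhds h2, self_mem_nhdsWithin] with w hw hwz hwT
    exact hw ⟨hwT, hwz⟩
  have hsum : ∀ z : ℂ, ∀ S : Finset ℂ, z ∉ S → AnalyticAt ℂ (fun w => ∑ t ∈ S, ρ t / (w - t)) z :=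
    fun z S hz => by
      refine Finset.analyticAt_fun_sum _ fun t ht => ?_
      refine analyticAt_const.div (analyticAt_id.sub analyticAt_const) ?_
      exact sub_ne_zero.mpr fun h => hz (h ▸ ht)
  -- At a pole the value of F is arbitrary, so P uses the local analytic part minus the other
  -- principal parts.
  let P : ℂ → ℂ := fun z => if z ∈ T then G z z - ∑ s ∈ T.erase z, ρ s / (z - s)
    else F z - ∑ t ∈ T, ρ t / (z - t)
  refine ⟨P, fun z hz => ?_, fun z hz => by simp [P, hz]⟩
  by_cases hzT : z ∈ T
  · have hA : AnalyticAt ℂ (fun w => G z w - ∑ s ∈ T.erase z, ρ s / (w - s)) z :=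
      (hG z hzT).sub (hsum z _ (Finset.notMem_erase z T))
    refine hA.congr ?_
    rw [EventuallyEq, ← nhdsNE_sup_pure z, eventually_sup]
    refine ⟨?_, by simp [P, hzT]⟩
    filter_upwards [hFG z hzT, hev z] with w hw hwT
    simp only [P, hwT, if_false]
    rw [hw, ← Finset.add_sum_erase T _ hzT]
    ring
  · have hF := hz.resolve_left hzT
    refine (hF.sub (hsum z T hzT)).congr ?_
    have : ∀ᶠ w in 𝓝 z, w ∉ T := T.finite_toSet.isClosed.isOpen_compl.mem_nhds hzT
    filter_upwards [this] with w hw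
    simp [P, hw]

end Poles

/-! ### Contour integrals over the rectangle [−R, R] × [0, R] -/

section Rectangle

open Complex in
/-- The integral over the boundary of the rectangle `[-R, R] × [0, R]`. -/
def rectIntegral (R : ℝ) (f : ℂ → ℂ) : ℂ :=
  (∫ x in (-R)..R, f x) - (∫ x in (-R)..R, f (x + R * I)) + I * (∫ y in (0 : ℝ)..R, f (R + y * I)) -
    I * ∫ y in (0 : ℝ)..R, f (-R + y * I)

/-- A set containing the boundary of the rectangle `[-R, R] × [0, R]`. -/
def rectEdge (R : ℝ) : Set ℂ := {z | 0 ≤ z.im ∧ (z.im = 0 ∨ R ≤ ‖z‖)}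

variable {R : ℝ}

lemma bottom_mem_rectEdge (x : ℝ) : (x : ℂ) ∈ rectEdge R := by simp [rectEdge]

open Complex in
lemma top_mem_rectEdge (hR : 0 ≤ R) (x : ℝ) : (x + R * I : ℂ) ∈ rectEdge R := by
  refine ⟨by simpa using hR, Or.inr ?_⟩
  have := Complex.abs_im_le_norm (x + R * I)
  simp only [add_im, ofReal_im, mul_im, ofReal_re, I_im, mul_one, I_re, mul_zero, add_zero,
    zero_add] at this
  exact (le_abs_self R).trans this

open Complex in
lemma right_mem_rectEdge {y : ℝ} (hy : 0 ≤ y) : (R + y * I : ℂ) ∈ rectEdge R := by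
  refine ⟨by simpa using hy, Or.inr ?_⟩
  have := Complex.abs_re_le_norm (R + y * I)
  simp only [add_re, ofReal_re, mul_re, I_re, mul_zero, ofReal_im, I_im, mul_one, sub_self,
    add_zero] at this
  exact (le_abs_self R).trans this

open Complex in
lemma left_mem_rectEdge {y : ℝ} (hy : 0 ≤ y) : (-R + y * I : ℂ) ∈ rectEdge R := by
  refine ⟨by simpa using hy, Or.inr ?_⟩
  have := Complex.abs_re_le_norm (-R + y * I)
  simp only [add_re, neg_re, ofReal_re, mul_re, I_re, mul_zero, ofReal_im, I_im, mul_one, sub_self,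
    add_zero, abs_neg] at this
  exact (le_abs_self R).trans this

open Complex in
lemma rectIntegral_integrable (hR : 0 ≤ R) {f : ℂ → ℂ} (hf : ∀ z ∈ rectEdge R, ContinuousAt f z) :
    IntervalIntegrable (fun x : ℝ => f x) volume (-R) R ∧
    IntervalIntegrable (fun x : ℝ => f (x + R * I)) volume (-R) R ∧
    IntervalIntegrable (fun y : ℝ => f (R + y * I)) volume 0 R ∧
    IntervalIntegrable (fun y : ℝ => f (-R + y * I)) volume 0 R := by
  refine ⟨?_, ?_, ?_, ?_⟩
  · exact (continuous_iff_continuousAt.mpr fun x => ContinuousAt.comp (f := fun x : ℝ => (x : ℂ))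
      (hf _ (bottom_mem_rectEdge x)) (by fun_prop)).intervalIntegrable _ _
  · exact (continuous_iff_continuousAt.mpr fun x => ContinuousAt.comp
      (f := fun x : ℝ => (x + R * I : ℂ))
      (hf _ (top_mem_rectEdge hR x)) (by fun_prop)).intervalIntegrable _ _
  · refine ContinuousOn.intervalIntegrable fun y hy => ?_
    rw [uIcc_of_le hR] at hy
    exact (ContinuousAt.comp (f := fun y : ℝ => (R + y * I : ℂ))
      (hf _ (right_mem_rectEdge hy.1)) (by fun_prop)).continuousWithinAt
  · refine ContinuousOn.intervalIntegrable fun y hy => ?_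
    rw [uIcc_of_le hR] at hy
    exact (ContinuousAt.comp (f := fun y : ℝ => (-R + y * I : ℂ))
      (hf _ (left_mem_rectEdge hy.1)) (by fun_prop)).continuousWithinAt

lemma rectIntegral_add (hR : 0 ≤ R) {f g : ℂ → ℂ} (hf : ∀ z ∈ rectEdge R, ContinuousAt f z)
    (hg : ∀ z ∈ rectEdge R, ContinuousAt g z) :
    rectIntegral R (fun z => f z + g z) = rectIntegral R f + rectIntegral R g := by
  obtain ⟨f1, f2, f3, f4⟩ := rectIntegral_integrable hR hf
  obtain ⟨g1, g2, g3, g4⟩ := rectIntegral_integrable hR hg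
  simp only [rectIntegral]
  rw [intervalIntegral.integral_add f1 g1, intervalIntegral.integral_add f2 g2,
    intervalIntegral.integral_add f3 g3, intervalIntegral.integral_add f4 g4]
  ring

lemma rectIntegral_const_mul (c : ℂ) (f : ℂ → ℂ) :
    rectIntegral R (fun z => c * f z) = c * rectIntegral R f := by
  simp only [rectIntegral, intervalIntegral.integral_const_mul]
  ring

lemma rectIntegral_sum (hR : 0 ≤ R) {ι : Type*} (S : Finset ι) {f : ι → ℂ → ℂ}
    (hf : ∀ i ∈ S, ∀ z ∈ rectEdge R, ContinuousAt (f i) z) :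
    rectIntegral R (fun z => ∑ i ∈ S, f i z) = ∑ i ∈ S, rectIntegral R (f i) := by
  classical
  induction S using Finset.induction_on with
  | empty => simp [rectIntegral]
  | insert a S ha ih =>
    simp only [Finset.sum_insert ha]
    rw [rectIntegral_add hR (hf a (Finset.mem_insert_self _ _)), ih fun i hi =>
      hf i (Finset.mem_insert_of_mem hi)]
    intro z hz
    exact tendsto_finsetSum _ fun i hi => hf i (Finset.mem_insert_of_mem hi) z hz

open Complex in
lemma rectIntegral_eq_zero (hR : 0 ≤ R) {f : ℂ → ℂ} (hf : ∀ z : ℂ, 0 ≤ z.im → AnalyticAt ℂ f z) :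
    rectIntegral R f = 0 := by
  have := Complex.integral_boundary_rect_eq_zero_of_differentiableOn f (-R : ℂ) (R + R * I) ?_
  · simpa [rectIntegral] using this
  · intro z hz
    refine (hf z ?_).differentiableAt.differentiableWithinAt
    have h2 := hz.2
    simp only [mem_preimage, neg_im, ofReal_im, neg_zero, add_im, mul_im, ofReal_re, I_im, mul_one,
      I_re, mul_zero, add_zero, zero_add, uIcc_of_le hR] at h2
    exact h2.1

open Complex in
-- Each side is a difference of logarithms of z − w. On the left side z − w meets the cut of the
-- logarithm, so log(−(z − w)) is used there; the mismatches at the two left corners are πi each.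
lemma rectIntegral_inv_sub {w : ℂ} (hw : 0 < w.im) (hwR : ‖w‖ < R) :
    rectIntegral R (fun z => (z - w)⁻¹) = 2 * Real.pi * I := by
  have hre : |w.re| < R := (abs_re_le_norm w).trans_lt hwR
  have him : w.im < R := ((le_abs_self _).trans (abs_im_le_norm w)).trans_lt hwR
  obtain ⟨hre1, hre2⟩ := abs_lt.mp hre
  have hR : 0 < R := hw.trans him
  have h1 : ∫ x in (-R)..R, ((x : ℂ) - w)⁻¹ = log (R - w) - log (-R - w) := by
    have hs : ∀ x : ℝ, (x : ℂ) - w ∈ slitPlane := fun x => Or.inr (by simp [hw.ne'])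
    have := intervalIntegral.integral_eq_sub_of_hasDerivAt (a := -R) (b := R)
      (f := fun x : ℝ => log ((x : ℂ) - w)) (f' := fun x : ℝ => ((x : ℂ) - w)⁻¹)
      (fun x _ => by
        have h := ((ofRealCLM.hasDerivAt (x := x)).sub_const w).clog_real (hs x)
        simpa using h)
      (Continuous.intervalIntegrable (Continuous.inv₀ (by fun_prop)
        fun x => slitPlane_ne_zero (hs x)) _ _)
    simpa using this
  have h2 : ∫ x in (-R)..R, ((x : ℂ) + R * I - w)⁻¹ =
      log (R + R * I - w) - log (-R + R * I - w) := by
    have hs : ∀ x : ℝ, (x : ℂ) + R * I - w ∈ slitPlane := fun x => Or.inr (by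
      simp only [sub_im, add_im, ofReal_im, mul_im, ofReal_re, I_im, I_re, mul_one, mul_zero]
      linarith)
    have := intervalIntegral.integral_eq_sub_of_hasDerivAt (a := -R) (b := R)
      (f := fun x : ℝ => log ((x : ℂ) + R * I - w)) (f' := fun x : ℝ => ((x : ℂ) + R * I - w)⁻¹)
      (fun x _ => by
        have h := (((ofRealCLM.hasDerivAt (x := x)).add_const (R * I)).sub_const w).clog_real (hs x)
        simpa using h)
      (Continuous.intervalIntegrable (Continuous.inv₀ (by fun_prop)
        fun x => slitPlane_ne_zero (hs x)) _ _)
    simpa using this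
  have hI : ∀ y : ℝ, HasDerivAt (fun y : ℝ => (y : ℂ) * I) I y := fun y => by
    simpa using (ofRealCLM.hasDerivAt (x := y)).mul_const I
  have h3 : I * ∫ y in (0 : ℝ)..R, ((R : ℂ) + y * I - w)⁻¹ = log (R + R * I - w) - log (R - w) := by
    have hs : ∀ y : ℝ, (R : ℂ) + y * I - w ∈ slitPlane := fun y => Or.inl (by
      simp only [sub_re, add_re, ofReal_re, mul_re, I_re, mul_zero, ofReal_im, I_im]
      linarith)
    rw [← intervalIntegral.integral_const_mul]
    have := intervalIntegral.integral_eq_sub_of_hasDerivAt (a := 0) (b := R)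
      (f := fun y : ℝ => log ((R : ℂ) + y * I - w)) (f' := fun y : ℝ => I * ((R : ℂ) + y * I - w)⁻¹)
      (fun y _ => (((hI y).const_add (R : ℂ)).sub_const w).clog_real (hs y))
      (Continuous.intervalIntegrable (continuous_const.mul (Continuous.inv₀ (by fun_prop)
        fun x => slitPlane_ne_zero (hs x))) _ _)
    simpa using this
  have h4 : I * ∫ y in (0 : ℝ)..R, (-(R : ℂ) + y * I - w)⁻¹ =
      log (-(-R + R * I - w)) - log (-(-R - w)) := by
    have hs : ∀ y : ℝ, -(-(R : ℂ) + y * I - w) ∈ slitPlane := fun y => Or.inl (by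
      simp only [neg_re, sub_re, add_re, ofReal_re, mul_re, I_re, mul_zero, ofReal_im, I_im]
      linarith)
    rw [← intervalIntegral.integral_const_mul]
    have := intervalIntegral.integral_eq_sub_of_hasDerivAt (a := 0) (b := R)
      (f := fun y : ℝ => log (-(-(R : ℂ) + y * I - w)))
      (f' := fun y : ℝ => I * (-(R : ℂ) + y * I - w)⁻¹)
      (fun y _ => by
        have h := (((hI y).const_add (-(R : ℂ))).sub_const w).neg.clog_real (hs y)
        refine h.congr_deriv ?_
        simp only [Pi.neg_apply]
        rw [neg_div_neg_eq, div_eq_mul_inv])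
      (Continuous.intervalIntegrable (continuous_const.mul (Continuous.inv₀ (by fun_prop)
        fun x => neg_ne_zero.mp (slitPlane_ne_zero (hs x)))) _ _)
    simpa using this
  have ha : log (-R + R * I - w) - log (-(-R + R * I - w)) = Real.pi * I := by
    have him : 0 < (-R + R * I - w : ℂ).im := by
      simp only [sub_im, add_im, neg_im, ofReal_im, mul_im, ofReal_re, I_im, I_re, mul_one, mul_zero]
      linarith
    rw [log, log, norm_neg, arg_neg_eq_arg_sub_pi_of_im_pos him]
    push_cast
    ring
  have hb : log (-(-R - w)) - log (-R - w) = Real.pi * I := by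
    have him : (-R - w : ℂ).im < 0 := by
      simp only [sub_im, neg_im, ofReal_im]
      linarith
    rw [log, log, norm_neg, arg_neg_eq_arg_add_pi_of_im_neg him]
    push_cast
    ring
  simp only [rectIntegral]
  rw [h1, h2, h3, h4]
  linear_combination ha + hb

end Rectangle

/-! ### Real integrals by closing the contour upwards -/

section Residues

open Complex in
/-- Evaluation of an integral over the real line by closing the contour in the upper half-plane. -/
theorem tendsto_integral_of_residues {F : ℂ → ℂ} {T : Finset ℂ} {ρ : ℂ → ℂ} {a C₁ C₂ K : ℝ}
    (hT : ∀ t ∈ T, 0 ≤ t.im) (hreal : ∀ t ∈ T, t.im = 0 → ρ t = 0)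
    (hF : ∀ z, 0 ≤ z.im → z ∉ T → AnalyticAt ℂ F z)
    (hpole : ∀ t ∈ T, HasSimplePoleAt F (ρ t) t)
    (ha : 0 < a) (hC₁ : 0 ≤ C₁) (hC₂ : 0 ≤ C₂)
    (hb : ∀ z : ℂ, 0 ≤ z.im → K ≤ ‖z‖ → ‖F z‖ ≤ C₁ / ‖z‖ * Real.exp (-a * z.im) + C₂ / ‖z‖ ^ 2) :
    Tendsto (fun R : ℝ => ∫ x in (-R)..R, F x) atTop (𝓝 (2 * Real.pi * I * ∑ t ∈ T, ρ t)) := by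
  classical
  obtain ⟨P, hP, hFP⟩ := exists_analytic_part hpole
  have hP' : ∀ z : ℂ, 0 ≤ z.im → AnalyticAt ℂ P z := fun z hz => hP z (by
    by_cases h : z ∈ T
    · exact Or.inl h
    · exact Or.inr (hF z hz h))
  -- Points of T on the real axis have residue 0 and drop out, so no pole lies on the contour.
  set T' := T.filter fun t => 0 < t.im
  have hTT' : ∀ g : ℂ → ℂ, ∑ t ∈ T, ρ t * g t = ∑ t ∈ T', ρ t * g t := fun g => by
    rw [Finset.sum_filter_of_ne]
    intro t ht hne
    refine (hT t ht).lt_of_ne fun h => hne ?_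
    rw [hreal t ht h.symm, zero_mul]
  have hsumT : ∑ t ∈ T, ρ t = ∑ t ∈ T', ρ t := by simpa using hTT' 1
  obtain ⟨K', hK'⟩ : ∃ K' : ℝ, ∀ t ∈ T, ‖t‖ < K' := by
    obtain ⟨M, hM⟩ := (T.image fun t => ‖t‖).exists_le
    exact ⟨M + 1, fun t ht => (hM _ (Finset.mem_image_of_mem _ ht)).trans_lt (by linarith)⟩
  have hFP' : ∀ z, z ∉ T → F z = P z + ∑ t ∈ T', ρ t * (z - t)⁻¹ := fun z hz => by
    rw [hFP z hz, ← hTT']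
    simp [div_eq_mul_inv]
  have main : ∀ R : ℝ, 1 ≤ R → K ≤ R → K' ≤ R →
      ‖(∫ x in (-R)..R, F x) - 2 * Real.pi * I * ∑ t ∈ T, ρ t‖ ≤ (4 * C₁ / a + 4 * C₂) / R := by
    intro R hR1 hRK hRK'
    have hR0 : 0 < R := by linarith
    have hinv : ∀ t ∈ T', ∀ z ∈ rectEdge R, ContinuousAt (fun z => (z - t)⁻¹) z := by
      intro t ht z hz
      have htT := (Finset.mem_filter.mp ht)
      refine ContinuousAt.inv₀ (by fun_prop) (sub_ne_zero.mpr ?_)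
      rintro rfl
      rcases hz.2 with h | h
      · linarith [htT.2]
      · linarith [hK' z htT.1]
    have hrect : rectIntegral R (fun z => P z + ∑ t ∈ T', ρ t * (z - t)⁻¹) =
        2 * Real.pi * I * ∑ t ∈ T, ρ t := by
      rw [rectIntegral_add hR0.le (fun z hz => (hP' z hz.1).continuousAt),
        rectIntegral_eq_zero hR0.le hP', rectIntegral_sum hR0.le, hsumT, Finset.mul_sum, zero_add]
      · refine Finset.sum_congr rfl fun t ht => ?_
        have htT := (Finset.mem_filter.mp ht)
        rw [rectIntegral_const_mul, rectIntegral_inv_sub htT.2 ((hK' t htT.1).trans_le hRK')]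
        ring
      · exact fun t ht z hz => continuousAt_const.mul (hinv t ht z hz)
      · intro z hz
        exact tendsto_finsetSum _ fun t ht => continuousAt_const.mul (hinv t ht z hz)
    have hnotT : ∀ z : ℂ, R ≤ ‖z‖ → z ∉ T := fun z hz hzT => by linarith [hK' z hzT]
    have etop : ∫ x in (-R)..R, (P (x + R * I) + ∑ t ∈ T', ρ t * ((x + R * I) - t)⁻¹) =
        ∫ x in (-R)..R, F (x + R * I) := by
      refine intervalIntegral.integral_congr fun x _ => (hFP' _ (hnotT _ ?_)).symm
      have := (top_mem_rectEdge hR0.le x).2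
      exact this.resolve_left (by simp [hR0.ne'])
    have hnr : ∀ y : ℝ, R ≤ ‖(R + y * I : ℂ)‖ := fun y => by
      have := Complex.abs_re_le_norm (R + y * I)
      simp only [add_re, ofReal_re, mul_re, I_re, mul_zero, ofReal_im, I_im, mul_one, sub_self,
        add_zero] at this
      exact (le_abs_self R).trans this
    have hnl : ∀ y : ℝ, R ≤ ‖(-R + y * I : ℂ)‖ := fun y => by
      have := Complex.abs_re_le_norm (-R + y * I)
      simp only [add_re, neg_re, ofReal_re, mul_re, I_re, mul_zero, ofReal_im, I_im, mul_one,
        sub_self, add_zero, abs_neg] at this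
      exact (le_abs_self R).trans this
    have hnt : ∀ x : ℝ, R ≤ ‖(x + R * I : ℂ)‖ := fun x =>
      (top_mem_rectEdge hR0.le x).2.resolve_left (by simp [hR0.ne'])
    have eright : ∫ y in (0 : ℝ)..R, (P (R + y * I) + ∑ t ∈ T', ρ t * ((R + y * I) - t)⁻¹) =
        ∫ y in (0 : ℝ)..R, F (R + y * I) :=
      intervalIntegral.integral_congr fun y _ => (hFP' _ (hnotT _ (hnr y))).symm
    have eleft : ∫ y in (0 : ℝ)..R, (P (-R + y * I) + ∑ t ∈ T', ρ t * ((-R + y * I) - t)⁻¹) =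
        ∫ y in (0 : ℝ)..R, F (-R + y * I) :=
      intervalIntegral.integral_congr fun y _ => (hFP' _ (hnotT _ (hnl y))).symm
    -- On the real axis F may have arbitrary values at the finitely many points of T, a null set.
    have ebot : ∫ x in (-R)..R, (P x + ∑ t ∈ T', ρ t * ((x : ℂ) - t)⁻¹) =
        ∫ x in (-R)..R, F x := by
      refine intervalIntegral.integral_congr_ae ?_
      have hfin : ((fun x : ℝ => (x : ℂ)) ⁻¹' (T : Set ℂ)).Finite :=
        T.finite_toSet.preimage (Complex.ofReal_injective.injOn)
      filter_upwards [hfin.countable.ae_notMem volume] with x hx _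
      exact (hFP' _ hx).symm
    simp only [rectIntegral] at hrect
    rw [etop, eright, eleft, ebot] at hrect
    have e : (∫ x in (-R)..R, F x) - 2 * Real.pi * I * ∑ t ∈ T, ρ t =
        (∫ x in (-R)..R, F (x + R * I)) - I * (∫ y in (0 : ℝ)..R, F (R + y * I)) +
        I * ∫ y in (0 : ℝ)..R, F (-R + y * I) := by
      linear_combination hrect
    have hb' : ∀ z : ℂ, 0 ≤ z.im → R ≤ ‖z‖ →
        ‖F z‖ ≤ C₁ / R * Real.exp (-a * z.im) + C₂ / R ^ 2 := fun z hz hzR =>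
      (hb z hz (hRK.trans hzR)).trans (by gcongr)
    -- The decay e^{−aR} on the top side has to beat its length 2R; a single power of R suffices
    -- since F already carries 1/R.
    have hexp : Real.exp (-a * R) ≤ 1 / (a * R) := by
      rw [neg_mul, Real.exp_neg, ← one_div]
      exact one_div_le_one_div_of_le (by positivity) (by linarith [Real.add_one_le_exp (a * R)])
    have htop : ‖∫ x in (-R)..R, F (x + R * I)‖ ≤ 2 * C₁ / a / R + 2 * C₂ / R := by
      have := intervalIntegral.norm_integral_le_of_norm_le_const (a := -R) (b := R)
        (f := fun x : ℝ => F (x + R * I)) (C := C₁ / R * (1 / (a * R)) + C₂ / R ^ 2)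
        (fun x _ => by
          refine (hb' _ (by simpa using hR0.le) (hnt x)).trans ?_
          gcongr
          simpa using hexp)
      refine this.trans (le_of_eq ?_)
      rw [abs_of_pos (by linarith)]
      field_simp
      ring
    have hside : ∀ f : ℝ → ℂ, (∀ y, 0 ≤ y → ‖f y‖ ≤ C₁ / R * Real.exp (-a * y) + C₂ / R ^ 2) →
        ‖∫ y in (0 : ℝ)..R, f y‖ ≤ C₁ / a / R + C₂ / R := by
      intro f hf
      have h1 : ‖∫ y in (0 : ℝ)..R, f y‖ ≤
          ∫ y in (0 : ℝ)..R, (C₁ / R * Real.exp (-a * y) + C₂ / R ^ 2) :=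
        intervalIntegral.norm_integral_le_of_norm_le hR0.le
          (Eventually.of_forall fun y hy => hf y hy.1.le)
          (Continuous.intervalIntegrable (by fun_prop) _ _)
      have h2 : ∫ y in (0 : ℝ)..R, (C₁ / R * Real.exp (-a * y) + C₂ / R ^ 2) =
          C₁ / R * ((1 - Real.exp (-a * R)) / a) + C₂ / R := by
        rw [intervalIntegral.integral_add (Continuous.intervalIntegrable (by fun_prop) _ _)
          (Continuous.intervalIntegrable (by fun_prop) _ _), intervalIntegral.integral_const_mul,
          intervalIntegral.integral_comp_mul_left (fun t => Real.exp t) (neg_ne_zero.mpr ha.ne')]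
        simp [integral_exp]
        field_simp
        ring
      rw [h2] at h1
      refine h1.trans ?_
      gcongr
      calc C₁ / R * ((1 - Real.exp (-a * R)) / a) ≤ C₁ / R * (1 / a) := by
            gcongr
            linarith [Real.exp_pos (-a * R)]
        _ = _ := by field_simp
    have hright := hside (fun y => F (R + y * I)) fun y hy => by
      simpa using hb' (R + y * I) (by simpa using hy) (hnr y)
    have hleft := hside (fun y => F (-R + y * I)) fun y hy => by
      simpa using hb' (-R + y * I) (by simpa using hy) (hnl y)
    rw [e]
    calc _ ≤ ‖∫ x in (-R)..R, F (x + R * I)‖ + ‖I * ∫ y in (0 : ℝ)..R, F (R + y * I)‖ +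
          ‖I * ∫ y in (0 : ℝ)..R, F (-R + y * I)‖ :=
          (norm_add_le _ _).trans (by gcongr; exact norm_sub_le _ _)
      _ ≤ (2 * C₁ / a / R + 2 * C₂ / R) + (C₁ / a / R + C₂ / R) + (C₁ / a / R + C₂ / R) := by
          rw [norm_mul, norm_mul, norm_I, one_mul, one_mul]
          gcongr
      _ = _ := by ring
  rw [tendsto_iff_norm_sub_tendsto_zero]
  refine squeeze_zero' (Eventually.of_forall fun _ => norm_nonneg _)
    ((eventually_ge_atTop (max 1 (max K K'))).mono fun R hR => main R ?_ ?_ ?_)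
    (tendsto_const_nhds.div_atTop tendsto_id)
  · exact (le_max_left _ _).trans hR
  · exact ((le_max_left _ _).trans (le_max_right _ _)).trans hR
  · exact ((le_max_right _ _).trans (le_max_right _ _)).trans hR

end Residues

/-! ### The branch of the square root and its boundary values on the cut -/

section UpperSqrt

lemma upperSqrt_sq (lam : ℂ) : upperSqrt lam ^ 2 = lam := by
  rw [upperSqrt, mul_pow, Complex.I_sq]
  have := Complex.cpow_nat_inv_pow (-lam) two_ne_zero
  simp only [Nat.cast_ofNat] at this
  rw [one_div, this]
  ring

lemma neg_I_mul_sq (k : ℂ) : (-Complex.I * k) ^ 2 = -k ^ 2 := by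
  rw [mul_pow, neg_sq, Complex.I_sq]
  ring

/-- −k² = (−ik)² with Re(−ik) = Im k > 0, so the principal root returns −ik. -/
lemma upperSqrt_of_sq {k : ℂ} (hk : 0 < k.im) : upperSqrt (k ^ 2) = k := by
  have h1 : 0 < (-Complex.I * k).re := by simpa using hk
  rw [upperSqrt, ← neg_I_mul_sq, one_div, Complex.sq_cpow_two_inv h1]
  linear_combination (-k) * Complex.I_sq

lemma neg_sq_mem_slitPlane {k : ℂ} (hk : 0 < k.im) : -k ^ 2 ∈ Complex.slitPlane := by
  rw [Complex.mem_slitPlane_iff]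
  simp only [Complex.neg_re, Complex.neg_im, pow_two, Complex.mul_re, Complex.mul_im]
  by_cases h : k.re = 0
  · left
    rw [h]
    nlinarith
  · right
    have : k.re * k.im ≠ 0 := mul_ne_zero h hk.ne'
    intro h2
    apply this
    linarith

lemma analyticAt_upperSqrt {k : ℂ} (hk : 0 < k.im) : AnalyticAt ℂ upperSqrt (k ^ 2) :=
  analyticAt_const.mul ((analyticAt_id.neg).cpow analyticAt_const (neg_sq_mem_slitPlane hk))

lemma hasDerivAt_upperSqrt {k : ℂ} (hk : 0 < k.im) :
    HasDerivAt upperSqrt (2 * k)⁻¹ (k ^ 2) := by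
  have hk0 : k ≠ 0 := fun h => by simp [h] at hk
  have hd := (analyticAt_upperSqrt hk).differentiableAt.hasDerivAt
  have h1 := hd.pow 2
  have h2 : HasDerivAt (upperSqrt ^ 2) 1 (k ^ 2) := by
    have : upperSqrt ^ 2 = id := funext fun z => upperSqrt_sq z
    rw [this]
    exact hasDerivAt_id _
  have h3 := h1.unique h2
  rw [upperSqrt_of_sq hk] at h3
  refine hd.congr_deriv ?_
  norm_num at h3
  rw [inv_eq_one_div, eq_div_iff (by simpa using hk0), mul_comm]
  exact h3

lemma ofReal_sq_cpow_aux {c : ℝ} (hc : 0 < c) (σ : ℝ) :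
    Complex.exp (((Real.log (c ^ 2) : ℝ) + σ * (Real.pi * Complex.I)) / 2) =
      c * Complex.exp (σ * (Real.pi / 2 * Complex.I)) := by
  rw [Real.log_pow]
  have : (((2 : ℕ) * Real.log c : ℝ) + σ * (Real.pi * Complex.I)) / 2 =
      (Real.log c : ℂ) + σ * (Real.pi / 2 * Complex.I) := by
    push_cast
    ring
  rw [this, Complex.exp_add, ← Complex.ofReal_exp, Real.exp_log hc]

/-- The boundary values of the square root from above and from below the cut. -/
lemma tendsto_upperSqrt_above {c : ℝ} (hc : 0 < c) :
    Tendsto (fun z : ℂ => upperSqrt ((c : ℂ) ^ 2 + Complex.I * z)) (𝓝[{z : ℂ | 0 < z.re}] 0)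
      (𝓝 (c : ℂ)) := by
  -- For Re z > 0 the point −(c² + iz) lies below the negative axis, where the logarithm tends to
  -- log c² − πi.
  have h0 := Complex.tendsto_log_nhdsWithin_im_neg_of_re_neg_of_im_zero (z := ((-c ^ 2 : ℝ) : ℂ))
    (by rw [Complex.ofReal_re, neg_lt_zero]; positivity) (Complex.ofReal_im _)
  have hmap : Tendsto (fun z : ℂ => -((c : ℂ) ^ 2 + Complex.I * z)) (𝓝[{z : ℂ | 0 < z.re}] 0)
      (𝓝[{z : ℂ | z.im < 0}] ((-c ^ 2 : ℝ) : ℂ)) := by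
    refine tendsto_nhdsWithin_iff.mpr ⟨?_, eventually_nhdsWithin_of_forall fun z hz => ?_⟩
    · have : Continuous fun z : ℂ => -((c : ℂ) ^ 2 + Complex.I * z) := by fun_prop
      have h := this.tendsto 0
      simp only [mul_zero, add_zero] at h
      push_cast
      exact h.mono_left nhdsWithin_le_nhds
    · have : ((c : ℂ) ^ 2).im = 0 := by rw [← Complex.ofReal_pow]; exact Complex.ofReal_im _
      simpa [this] using hz
  have h1 := ((((h0.comp hmap).div_const 2).cexp).const_mul Complex.I)
  have e : Complex.I * Complex.exp (((Real.log ‖((-c ^ 2 : ℝ) : ℂ)‖ : ℝ) - Real.pi * Complex.I) / 2)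
      = c := by
    have := ofReal_sq_cpow_aux hc (-1)
    have hn : ‖((-c ^ 2 : ℝ) : ℂ)‖ = c ^ 2 := by
      rw [Complex.norm_real, Real.norm_eq_abs, abs_neg, abs_of_nonneg (sq_nonneg c)]
    push_cast at this
    rw [hn, sub_eq_add_neg, ← neg_one_mul, ← mul_assoc]
    rw [neg_one_mul, neg_mul]
    rw [neg_one_mul, neg_one_mul, Complex.exp_neg, Complex.exp_pi_div_two_mul_I, Complex.inv_I]
      at this
    rw [this]
    linear_combination (-(c : ℂ)) * Complex.I_sq
  rw [e] at h1
  refine h1.congr' (eventually_nhdsWithin_of_forall fun z hz => ?_)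
  have hz0 : -((c : ℂ) ^ 2 + Complex.I * z) ≠ 0 := by
    intro h
    have := congrArg Complex.im h
    have h2 : ((c : ℂ) ^ 2).im = 0 := by rw [← Complex.ofReal_pow]; exact Complex.ofReal_im _
    simp [h2] at this
    exact absurd this (ne_of_gt hz)
  simp only [upperSqrt, Function.comp_apply]
  rw [Complex.cpow_def_of_ne_zero hz0]
  congr 2
  ring

/-- Now −(c² − iz) approaches the cut from above, and the root tends to −c. With c = −k this makes
the lower boundary value, used for k < 0, an evaluation at k itself. -/
lemma tendsto_upperSqrt_below {c : ℝ} (hc : 0 < c) :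
    Tendsto (fun z : ℂ => upperSqrt ((c : ℂ) ^ 2 - Complex.I * z)) (𝓝[{z : ℂ | 0 < z.re}] 0)
      (𝓝 (-c : ℂ)) := by
  have h0 := Complex.tendsto_log_nhdsWithin_im_nonneg_of_re_neg_of_im_zero
    (z := ((-c ^ 2 : ℝ) : ℂ)) (by rw [Complex.ofReal_re, neg_lt_zero]; positivity)
    (Complex.ofReal_im _)
  have hmap : Tendsto (fun z : ℂ => -((c : ℂ) ^ 2 - Complex.I * z)) (𝓝[{z : ℂ | 0 < z.re}] 0)
      (𝓝[{z : ℂ | 0 ≤ z.im}] ((-c ^ 2 : ℝ) : ℂ)) := by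
    refine tendsto_nhdsWithin_iff.mpr ⟨?_, eventually_nhdsWithin_of_forall fun z hz => ?_⟩
    · have : Continuous fun z : ℂ => -((c : ℂ) ^ 2 - Complex.I * z) := by fun_prop
      have h := this.tendsto 0
      simp only [mul_zero, sub_zero] at h
      push_cast
      exact h.mono_left nhdsWithin_le_nhds
    · have : ((c : ℂ) ^ 2).im = 0 := by rw [← Complex.ofReal_pow]; exact Complex.ofReal_im _
      simpa [this] using (le_of_lt hz : (0 : ℝ) ≤ z.re)
  have h1 := ((((h0.comp hmap).div_const 2).cexp).const_mul Complex.I)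
  have e : Complex.I * Complex.exp (((Real.log ‖((-c ^ 2 : ℝ) : ℂ)‖ : ℝ) + Real.pi * Complex.I) / 2)
      = -c := by
    have := ofReal_sq_cpow_aux hc 1
    have hn : ‖((-c ^ 2 : ℝ) : ℂ)‖ = c ^ 2 := by
      rw [Complex.norm_real, Real.norm_eq_abs, abs_neg, abs_of_nonneg (sq_nonneg c)]
    push_cast at this
    rw [one_mul, one_mul, Complex.exp_pi_div_two_mul_I] at this
    rw [hn, this]
    linear_combination (c : ℂ) * Complex.I_sq
  rw [e] at h1
  refine h1.congr' (eventually_nhdsWithin_of_forall fun z hz => ?_)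
  have hz0 : -((c : ℂ) ^ 2 - Complex.I * z) ≠ 0 := by
    intro h
    have := congrArg Complex.im h
    have h2 : ((c : ℂ) ^ 2).im = 0 := by rw [← Complex.ofReal_pow]; exact Complex.ofReal_im _
    simp [h2] at this
    exact absurd this (ne_of_gt hz)
  simp only [upperSqrt, Function.comp_apply]
  rw [Complex.cpow_def_of_ne_zero hz0]
  congr 2
  ring

end UpperSqrt

/-! ### Boundary values of the Weyl function, norming constants, and the residue formula -/

section SpectralData

variable {xI : ℝ} {V : ℝ → ℝ}

instance neBot_nhdsWithin_re_pos : (𝓝[{z : ℂ | 0 < z.re}] (0 : ℂ)).NeBot := by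
  rw [← mem_closure_iff_nhdsWithin_neBot, Complex.closure_setOfPred_lt_re]
  simp

/-- For either sign of k the root of λ tends to k along the prescribed approach, and f(0,·)/f_h is
continuous at real k ≠ 0, where f_h has no zeros. -/
lemma jFun_eq (hV : IsPotential xI V) (hxI : 0 < xI) (h : ℝ) {k : ℝ} (hk : k ≠ 0) :
    jFun (weyl V xI h) k = jost V xI 0 k / jostFun V xI h k - 1 / (Complex.I * k) := by
  have hne : jostFun V xI h k ≠ 0 := jostFun_ne_zero hV hxI h (by simp) (by simpa using hk)
  have hc : ContinuousAt (fun z => jost V xI 0 z / jostFun V xI h z) (k : ℂ) :=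
    (differentiable_jost_zero hV hxI).continuous.continuousAt.div
      (differentiable_jostFun hV hxI h).continuous.continuousAt hne
  rw [jFun]
  congr 1
  split_ifs with hpos
  · refine Tendsto.limUnder_eq ?_
    exact hc.tendsto.comp (tendsto_upperSqrt_above hpos)
  · have hneg : 0 < -k := neg_pos.mpr (lt_of_le_of_ne (not_lt.mp hpos) hk)
    have h1 := tendsto_upperSqrt_below hneg
    simp only [Complex.ofReal_neg, neg_neg, neg_sq] at h1
    refine Tendsto.limUnder_eq ?_
    exact hc.tendsto.comp h1

lemma residue_eq {F : ℂ → ℂ} {ρ z₀ : ℂ} (hF : HasSimplePoleAt F ρ z₀) : residue F z₀ = ρ := by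
  obtain ⟨G, hG, hFG⟩ := hF
  obtain ⟨ε, hε, hball⟩ := Metric.eventually_nhds_iff_ball.mp
    ((eventually_nhdsWithin_iff.mp hFG).and hG.eventually_analyticAt)
  refine Tendsto.limUnder_eq (tendsto_const_nhds.congr' ?_)
  filter_upwards [Ioo_mem_nhdsGT hε] with r hr
  have hsub : Metric.closedBall z₀ r ⊆ Metric.ball z₀ ε := Metric.closedBall_subset_ball hr.2
  have hGd : ∀ z ∈ Metric.closedBall z₀ r, DifferentiableAt ℂ G z := fun z hz =>
    (hball z (hsub hz)).2.differentiableAt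
  have h1 : (∮ z in C(z₀, r), F z) = ∮ z in C(z₀, r), (ρ * (z - z₀)⁻¹ + G z) := by
    refine circleIntegral.integral_congr hr.1.le fun z hz => ?_
    have hz' : z ≠ z₀ := fun h => by
      rw [h, mem_sphere_iff_norm, sub_self, norm_zero] at hz
      exact hr.1.ne hz
    rw [(hball z (hsub (Metric.sphere_subset_closedBall hz))).1 hz', div_eq_mul_inv]
  have hGc : ContinuousOn G (Metric.closedBall z₀ r) := fun z hz =>
    (hGd z hz).continuousAt.continuousWithinAt
  have h2 : (∮ z in C(z₀, r), G z) = 0 :=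
    Complex.circleIntegral_eq_zero_of_differentiable_on_off_countable hr.1.le countable_empty hGc
      fun z hz => hGd z (Metric.ball_subset_closedBall hz.1)
  have hinv : ContinuousOn (fun z => ρ * (z - z₀)⁻¹) (Metric.sphere z₀ r) := by
    refine continuousOn_const.mul (ContinuousOn.inv₀ (by fun_prop) fun z hz => ?_)
    rw [mem_sphere_iff_norm] at hz
    exact norm_pos_iff.mp (by rw [hz]; exact hr.1)
  rw [h1, circleIntegral.integral_add (hinv.circleIntegrable hr.1.le)
    ((hGc.mono Metric.sphere_subset_closedBall).circleIntegrable hr.1.le), h2, add_zero,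
    circleIntegral.integral_const_mul, circleIntegral.integral_sub_center_inv z₀ hr.1.ne']
  have : (2 * Real.pi * Complex.I : ℂ) ≠ 0 := by simp [Real.pi_ne_zero]
  field_simp

/-- The residue in λ of f(0,k)/f_h(k), a quotient with simple zero in the denominator; the factor 2k
is dλ/dk. -/
lemma normConst_eq (hV : IsPotential xI V) (hxI : 0 < xI) (h : ℝ) {k : ℂ}
    (hk : k ∈ eigenvalues V xI h) :
    normConst V xI h k = 2 * k * jost V xI 0 k / deriv (jostFun V xI h) k := by
  have hk0 : k ≠ 0 := fun h0 => by
    have := hk.1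
    simp [h0] at this
  have hd := deriv_jostFun_ne_zero hV hxI h hk.1.le hk.2
  have hs := upperSqrt_of_sq hk.1
  have hsa := analyticAt_upperSqrt hk.1
  have hN : AnalyticAt ℂ (fun z => jost V xI 0 (upperSqrt z)) (k ^ 2) :=
    ((differentiable_jost_zero hV hxI).analyticAt _).comp hsa
  have hD : AnalyticAt ℂ (fun z => jostFun V xI h (upperSqrt z)) (k ^ 2) :=
    ((differentiable_jostFun hV hxI h).analyticAt _).comp hsa
  have hdD : HasDerivAt (fun z => jostFun V xI h (upperSqrt z))
      (deriv (jostFun V xI h) k * (2 * k)⁻¹) (k ^ 2) := by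
    have h1 : HasDerivAt (jostFun V xI h) (deriv (jostFun V xI h) k) (upperSqrt (k ^ 2)) := by
      rw [hs]
      exact (differentiable_jostFun hV hxI h k).hasDerivAt
    exact h1.comp _ (hasDerivAt_upperSqrt hk.1)
  have := residue_eq (hasSimplePoleAt_div hN hD (by rw [hs]; exact hk.2) (by
    rw [hdD.deriv]
    exact mul_ne_zero hd (inv_ne_zero (by simpa using hk0))))
  rw [hdD.deriv, hs] at this
  refine this.trans ?_
  field_simp

lemma finite_eigenvalues (hV : IsPotential xI V) (hxI : 0 < xI) (h : ℝ) :
    (eigenvalues V xI h).Finite :=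
  (finite_jostFun_zeros hV hxI h).subset fun _ hk => ⟨hk.1.le, hk.2⟩

open Complex in
/-- Closing the contour for a meromorphic function with the Jost function as denominator. -/
theorem tendsto_integral_div_jostFun (hV : IsPotential xI V) (hxI : 0 < xI) (h : ℝ)
    {N E : ℂ → ℂ} (hN : Differentiable ℂ N) (hN0 : N 0 = 0)
    (hE : ∀ z, 0 ≤ z.im → AnalyticAt ℂ E z) {a C₁ C₂ K : ℝ}
    (ha : 0 < a) (hC₁ : 0 ≤ C₁) (hC₂ : 0 ≤ C₂)
    (hb : ∀ z : ℂ, 0 ≤ z.im → K ≤ ‖z‖ → ‖N z / jostFun V xI h z - E z‖ ≤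
      C₁ / ‖z‖ * Real.exp (-a * z.im) + C₂ / ‖z‖ ^ 2) :
    Tendsto (fun R : ℝ => ∫ x in (-R)..R, (N x / jostFun V xI h x - E x)) atTop
      (𝓝 (2 * Real.pi * I * ∑ t ∈ (finite_eigenvalues hV hxI h).toFinset,
        N t / deriv (jostFun V xI h) t)) := by
  classical
  have hD := differentiable_jostFun hV hxI h
  set T := (finite_jostFun_zeros hV hxI h).toFinset with hTdef
  have hT : ∀ t, t ∈ T ↔ 0 ≤ t.im ∧ jostFun V xI h t = 0 := fun t => by simp [hTdef]
  -- The only possible real zero of f_h is 0, and there N vanishes, so the singularity is removable.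
  have hreal : ∀ t ∈ T, t.im = 0 → N t / deriv (jostFun V xI h) t = 0 := fun t ht him => by
    have hre : t.re = 0 := by
      by_contra hre
      exact jostFun_ne_zero hV hxI h him.ge hre ((hT t).mp ht).2
    have : t = 0 := Complex.ext hre him
    rw [this, hN0, zero_div]
  have hsum : ∑ t ∈ (finite_eigenvalues hV hxI h).toFinset, N t / deriv (jostFun V xI h) t =
      ∑ t ∈ T, N t / deriv (jostFun V xI h) t := by
    refine Finset.sum_subset (fun t ht => ?_) fun t ht hnt => hreal t ht ?_
    · rw [Set.Finite.mem_toFinset] at ht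
      exact (hT t).mpr ⟨ht.1.le, ht.2⟩
    · rw [Set.Finite.mem_toFinset] at hnt
      have h1 := (hT t).mp ht
      by_contra hne
      exact hnt ⟨lt_of_le_of_ne h1.1 (Ne.symm hne), h1.2⟩
  rw [hsum]
  refine tendsto_integral_of_residues (F := fun z => N z / jostFun V xI h z - E z)
    (fun t ht => ((hT t).mp ht).1) hreal (fun z hz hzT => ?_) (fun t ht => ?_) ha hC₁ hC₂ hb
  · refine ((hN.analyticAt z).div (hD.analyticAt z) fun h0 => hzT ((hT z).mpr ⟨hz, h0⟩)).sub
      (hE z hz)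
  · have h1 := (hT t).mp ht
    exact (hasSimplePoleAt_div (hN.analyticAt t) (hD.analyticAt t) h1.2
      (deriv_jostFun_ne_zero hV hxI h h1.1 h1.2)).sub_analytic (hE t h1.1)

end SpectralData

/-! ### Parity on symmetric intervals -/

section Symmetric

lemma integral_neg_self {f : ℝ → ℂ} (R : ℝ) : ∫ k in (-R)..R, f (-k) = ∫ k in (-R)..R, f k := by
  rw [intervalIntegral.integral_comp_neg, neg_neg]

lemma intervalIntegrable_neg_self {f : ℝ → ℂ} {R : ℝ} (hf : IntervalIntegrable f volume (-R) R) :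
    IntervalIntegrable (fun k => f (-k)) volume (-R) R := by
  have := ((IntervalIntegrable.iff_comp_neg (f := f) (a := -R) (b := R)).mp hf).symm
  rwa [neg_neg] at this

lemma integral_symmetrize {f : ℝ → ℂ} {R : ℝ} (hf : IntervalIntegrable f volume (-R) R) :
    ∫ k in (-R)..R, f k = 1 / 2 * ∫ k in (-R)..R, (f k + f (-k)) := by
  rw [intervalIntegral.integral_add hf (intervalIntegrable_neg_self hf), integral_neg_self]
  ring

lemma integral_odd_eq_zero {f : ℝ → ℂ} (hodd : ∀ k, f (-k) = -f k) (R : ℝ) :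
    ∫ k in (-R)..R, f k = 0 := by
  have h := integral_neg_self (f := f) R
  simp only [hodd, intervalIntegral.integral_neg] at h
  have h2 : (2 : ℂ) * ∫ k in (-R)..R, f k = 0 := by linear_combination -h
  simpa using h2

lemma tendsto_integral_neg_self {f : ℝ → ℂ} (hf : Integrable f) :
    Tendsto (fun R : ℝ => ∫ k in (-R)..R, f k) atTop (𝓝 (∫ k, f k)) :=
  intervalIntegral_tendsto_integral hf tendsto_neg_atTop_atBot tendsto_id

end Symmetric

/-! ### Convergence and continuity of the kernels g and K -/

section Spectral

variable {xI : ℝ} {V : ℝ → ℝ}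

/-- The regularized spectral density `k j(k) - h k / (1 + k²)`. -/
def specDensity (V : ℝ → ℝ) (xI h k : ℝ) : ℂ :=
  k * jFun (weyl V xI h) k - ((h * k / (1 + k ^ 2) : ℝ) : ℂ)

lemma mul_jFun_eq (hV : IsPotential xI V) (hxI : 0 < xI) (h : ℝ) {k : ℝ} (hk : k ≠ 0) :
    k * jFun (weyl V xI h) k = k * jost V xI 0 k / jostFun V xI h k - 1 / Complex.I := by
  rw [jFun_eq hV hxI h hk]
  have : (k : ℂ) ≠ 0 := by exact_mod_cast hk
  have := Complex.I_ne_zero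
  field_simp

lemma exists_le_inv_one_add_sq {f : ℝ → ℂ} {M C K : ℝ} (hC : 0 ≤ C)
    (h1 : ∀ k, k ≠ 0 → |k| ≤ K → ‖f k‖ ≤ M) (h2 : ∀ k, K ≤ |k| → 1 ≤ |k| → ‖f k‖ ≤ C / |k| ^ 2)
    (hK : 1 ≤ K) : ∃ A, 0 ≤ A ∧ ∀ k, k ≠ 0 → ‖f k‖ ≤ A * (1 + k ^ 2)⁻¹ := by
  have hM : 0 ≤ M := (norm_nonneg _).trans (h1 1 one_ne_zero (by simpa using hK))
  refine ⟨M * (1 + K ^ 2) + 2 * C, by positivity, fun k hk => ?_⟩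
  have hk2 : 0 < 1 + k ^ 2 := by positivity
  rw [← div_eq_mul_inv, le_div_iff₀ hk2]
  rcases le_or_gt |k| K with h | h
  · calc ‖f k‖ * (1 + k ^ 2) ≤ M * (1 + K ^ 2) := by
          refine mul_le_mul ?_ (add_le_add_right ?_ 1) hk2.le hM
          · exact h1 k hk h
          · exact sq_le_sq' (neg_le_of_abs_le h) (le_of_abs_le h)
      _ ≤ _ := by linarith
  · have hk1 : 1 ≤ |k| := hK.trans h.le
    calc ‖f k‖ * (1 + k ^ 2) ≤ C / |k| ^ 2 * (|k| ^ 2 + |k| ^ 2) := by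
          refine mul_le_mul ?_ (add_le_add ?_ ?_) hk2.le (by positivity)
          · exact h2 k h.le hk1
          · nlinarith
          · exact (sq_abs k).ge
      _ = 2 * C := by
          field_simp
          ring
      _ ≤ _ := by
          have : 0 ≤ M * (1 + K ^ 2) := by positivity
          linarith

/-- At infinity the h/k term of k j(k) is cancelled up to h/(k(1+k²)). Near 0, where f_h may vanish,
Green's bound gives |k f(0,k)/f_h(k)| ≤ |f(0,k)|². -/
lemma exists_specDensity_bound (hV : IsPotential xI V) (hxI : 0 < xI) (h : ℝ) :
    ∃ A, 0 ≤ A ∧ ∀ k : ℝ, k ≠ 0 → ‖specDensity V xI h k‖ ≤ A * (1 + k ^ 2)⁻¹ := by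
  obtain ⟨C, K, hC, hK, hJ⟩ := jost_asymptotics hV hxI h le_rfl
  have hc : Continuous fun k : ℝ => jost V xI 0 k :=
    (differentiable_jost_zero hV hxI).continuous.comp Complex.continuous_ofReal
  obtain ⟨M, hM⟩ := (isCompact_Icc (a := -K) (b := K)).exists_bound_of_continuousOn hc.continuousOn
  refine exists_le_inv_one_add_sq (M := M ^ 2 + 1 + |h|) (C := C + |h|) (K := K) (by positivity)
    (fun k hk hkK => ?_) (fun k hkK hk1 => ?_) hK
  · have hM' := hM k (abs_le.mp hkK)
    rw [specDensity, mul_jFun_eq hV hxI h hk]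
    have h1 := abs_re_mul_exp_le hV hxI h (k := (k : ℂ)) (by simp)
    simp only [Complex.ofReal_re, Complex.ofReal_im, mul_zero, zero_mul, neg_zero, Real.exp_zero,
      mul_one] at h1
    have hne : jostFun V xI h k ≠ 0 := jostFun_ne_zero hV hxI h (by simp) (by simpa using hk)
    have h2 : ‖k * jost V xI 0 k / jostFun V xI h k‖ ≤ M ^ 2 := by
      rw [norm_div, norm_mul, Complex.norm_real, Real.norm_eq_abs, div_le_iff₀ (norm_pos_iff.mpr hne)]
      calc _ ≤ (‖jost V xI 0 k‖ * ‖jostFun V xI h k‖) * ‖jost V xI 0 k‖ := by gcongr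
        _ = ‖jost V xI 0 k‖ ^ 2 * ‖jostFun V xI h k‖ := by ring
        _ ≤ _ := by gcongr
    have h3 : ‖((h * k / (1 + k ^ 2) : ℝ) : ℂ)‖ ≤ |h| := by
      rw [Complex.norm_real, Real.norm_eq_abs, abs_div, abs_mul,
        abs_of_pos (by positivity : 0 < 1 + k ^ 2), div_le_iff₀ (by positivity)]
      have : |k| ≤ 1 + k ^ 2 := by
        rw [← sq_abs]
        nlinarith [sq_nonneg (|k| - 1)]
      gcongr
    calc _ ≤ _ := norm_sub_le _ _
      _ ≤ (M ^ 2 + 1) + |h| := by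
          refine add_le_add ((norm_sub_le _ _).trans (add_le_add h2 ?_)) h3
          simp
      _ = _ := rfl
  · have hk : k ≠ 0 := fun h0 => by
      rw [h0, abs_zero] at hk1
      linarith
    have hkc : (k : ℂ) ≠ 0 := by exact_mod_cast hk
    have h1 := (hJ k (by simp) (by simpa using hkK)).2.2.2
    rw [Complex.norm_real, Real.norm_eq_abs] at h1
    have e : specDensity V xI h k = (k * jost V xI 0 k / jostFun V xI h k - 1 / Complex.I - h / k) +
        ((h / (k * (1 + k ^ 2)) : ℝ) : ℂ) := by
      rw [specDensity, mul_jFun_eq hV hxI h hk]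
      have : (h / (k * (1 + k ^ 2)) : ℝ) = h / k - h * k / (1 + k ^ 2) := by
        field_simp
        ring
      rw [this]
      push_cast
      ring
    rw [e, add_div]
    refine (norm_add_le _ _).trans (add_le_add h1 ?_)
    rw [Complex.norm_real, Real.norm_eq_abs, abs_div, abs_mul,
      abs_of_pos (by positivity : 0 < 1 + k ^ 2)]
    gcongr
    rw [← sq_abs k]
    nlinarith [sq_nonneg |k|]

lemma integrable_specDensity (hV : IsPotential xI V) (hxI : 0 < xI) (h : ℝ) :
    Integrable (specDensity V xI h) := by
  obtain ⟨A, -, hA⟩ := exists_specDensity_bound hV hxI h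
  refine (integrable_inv_one_add_sq.const_mul A).mono' ?_ ?_
  · have hc : ContinuousOn (specDensity V xI h) {0}ᶜ := by
      have h1 : Continuous fun k : ℝ => jost V xI 0 k :=
        (differentiable_jost_zero hV hxI).continuous.comp Complex.continuous_ofReal
      have h2 : Continuous fun k : ℝ => jostFun V xI h k :=
        (differentiable_jostFun hV hxI h).continuous.comp Complex.continuous_ofReal
      have h3 : Continuous fun k : ℝ => ((h * k / (1 + k ^ 2) : ℝ) : ℂ) :=
        Complex.continuous_ofReal.comp (Continuous.div (by fun_prop) (by fun_prop)
          fun k => by positivity)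
      have h4 : ContinuousOn (fun k : ℝ => k * jost V xI 0 k / jostFun V xI h k - 1 / Complex.I -
          ((h * k / (1 + k ^ 2) : ℝ) : ℂ)) {0}ᶜ := by
        refine ((ContinuousOn.div (Complex.continuous_ofReal.mul h1).continuousOn h2.continuousOn
          fun k hk => ?_).sub continuousOn_const).sub h3.continuousOn
        exact jostFun_ne_zero hV hxI h (by simp) (by simpa using hk)
      refine h4.congr fun k hk => ?_
      rw [specDensity, mul_jFun_eq hV hxI h hk]
    have := hc.aestronglyMeasurable (μ := volume) (measurableSet_singleton 0).compl
    rwa [restrict_compl_singleton] at this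
  · filter_upwards [(countable_singleton (0 : ℝ)).ae_notMem volume] with k hk
    exact hA k hk

lemma integrable_specDensity_mul (hV : IsPotential xI V) (hxI : 0 < xI) (h : ℝ) {ψ : ℝ → ℂ}
    (hc : Continuous ψ) {M : ℝ} (hM : ∀ k, ‖ψ k‖ ≤ M) :
    Integrable (fun k => specDensity V xI h k * ψ k) :=
  (integrable_specDensity hV hxI h).mul_bdd (c := M) hc.aestronglyMeasurable (Eventually.of_forall hM)

/-- Principal value integrals against `k j(k)` of even functions. -/
lemma pv_mul_jFun (hV : IsPotential xI V) (hxI : 0 < xI) (h : ℝ) {ψ F : ℝ → ℂ}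
    (hF : ∀ k, F k = k * jFun (weyl V xI h) k * ψ k)
    (hc : Continuous ψ) (heven : ∀ k, ψ (-k) = ψ k) {M : ℝ} (hM : ∀ k, ‖ψ k‖ ≤ M) :
    PVConverges F ∧ Tendsto (fun R : ℝ => ∫ k in (-R)..R, F k) atTop
      (𝓝 (∫ k, specDensity V xI h k * ψ k)) ∧
      pvIntegral F = ∫ k, specDensity V xI h k * ψ k := by
  have hint := integrable_specDensity_mul hV hxI h hc hM
  have ho : Continuous fun k : ℝ => ((h * k / (1 + k ^ 2) : ℝ) : ℂ) * ψ k :=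
    (Complex.continuous_ofReal.comp (Continuous.div (by fun_prop) (by fun_prop)
          fun k => by positivity)).mul hc
  have e : F = fun k => specDensity V xI h k * ψ k + ((h * k / (1 + k ^ 2) : ℝ) : ℂ) * ψ k :=
    funext fun k => by rw [hF, specDensity]; ring
  -- The subtracted term hk/(1+k²) is odd and ψ is even, so it disappears on symmetric intervals and
  -- the principal value becomes an absolutely convergent integral.
  have h1 : ∀ R : ℝ, ∫ k in (-R)..R, F k = ∫ k in (-R)..R, specDensity V xI h k * ψ k := fun R => by
    rw [e, intervalIntegral.integral_add hint.intervalIntegrable (ho.intervalIntegrable _ _),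
      integral_odd_eq_zero (f := fun k : ℝ => ((h * k / (1 + k ^ 2) : ℝ) : ℂ) * ψ k) (fun k => ?_) R,
      add_zero]
    rw [heven, ← neg_mul, ← Complex.ofReal_neg]
    congr 3
    ring
  have h2 : Tendsto (fun R : ℝ => ∫ k in (-R)..R, F k) atTop
      (𝓝 (∫ k, specDensity V xI h k * ψ k)) := by
    simp only [h1]
    exact tendsto_integral_neg_self hint
  refine ⟨⟨fun R => ?_, _, h2⟩, h2, h2.limUnder_eq⟩
  rw [e]
  exact hint.intervalIntegrable.add (ho.intervalIntegrable _ _)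

lemma norm_ofReal_cos_le (k x : ℝ) : ‖Complex.cos (k * x)‖ ≤ 1 := by
  rw [← Complex.ofReal_mul, ← Complex.ofReal_cos, Complex.norm_real]
  exact Real.abs_cos_le_one _

lemma continuous_integral_specDensity_mul_cos (hV : IsPotential xI V) (hxI : 0 < xI) (h : ℝ)
    {ψ : ℝ → ℂ} (hc : Continuous ψ) {M : ℝ} (hM : ∀ k, ‖ψ k‖ ≤ M) :
    Continuous fun y : ℝ => ∫ k : ℝ, specDensity V xI h k * (ψ k * Complex.cos (k * y)) := by
  have hint := integrable_specDensity_mul hV hxI h hc hM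
  refine continuous_of_dominated (bound := fun k => ‖specDensity V xI h k * ψ k‖)
    (fun y => ?_) (fun y => Eventually.of_forall fun k => ?_) hint.norm
    (Eventually.of_forall fun k => by fun_prop)
  · simp only [← mul_assoc]
    exact hint.aestronglyMeasurable.mul (by fun_prop : Continuous fun k : ℝ =>
      Complex.cos (k * y)).aestronglyMeasurable
  · rw [← mul_assoc, norm_mul]
    exact mul_le_of_le_one_right (norm_nonneg _) (norm_ofReal_cos_le k y)

lemma gIntegrand_pv (hV : IsPotential xI V) (hxI : 0 < xI) (h x y : ℝ) :
    PVConverges (gIntegrand V xI h x y) ∧ pvIntegral (gIntegrand V xI h x y) =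
      ∫ k, specDensity V xI h k * (Complex.cos (k * x) * Complex.cos (k * y)) := by
  have := pv_mul_jFun hV hxI h (F := gIntegrand V xI h x y)
    (ψ := fun k : ℝ => Complex.cos (k * x) * Complex.cos (k * y))
    (fun k => by rw [gIntegrand]; ring) (by fun_prop) (fun k => by simp) (M := 1 * 1)
    (fun k => by
      rw [norm_mul]
      gcongr <;> exact norm_ofReal_cos_le _ _)
  exact ⟨this.1, this.2.2⟩

/-- The eigenvalues as a finite set. -/
def eigenFinset (hV : IsPotential xI V) (hxI : 0 < xI) (h : ℝ) : Finset ℂ :=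
  (finite_eigenvalues hV hxI h).toFinset

lemma gKernel_eq (hV : IsPotential xI V) (hxI : 0 < xI) (h x y : ℝ) :
    gKernel V xI h x y = Complex.I / Real.pi *
      (∫ k, specDensity V xI h k * (Complex.cos (k * x) * Complex.cos (k * y))) +
      ∑ t ∈ eigenFinset hV hxI h,
        Complex.cos (t * x) * normConst V xI h t * Complex.cos (t * y) := by
  rw [gKernel, (gIntegrand_pv hV hxI h x y).2,
    finsum_mem_eq_finite_toFinset_sum _ (finite_eigenvalues hV hxI h)]
  rfl

lemma continuous_gKernel (hV : IsPotential xI V) (hxI : 0 < xI) (h y : ℝ) :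
    Continuous fun x => gKernel V xI h x y := by
  simp only [gKernel_eq hV hxI]
  refine (continuous_const.mul ?_).add (by fun_prop)
  have := continuous_integral_specDensity_mul_cos hV hxI h
    (ψ := fun k : ℝ => Complex.cos (k * y)) (by fun_prop) (fun k => norm_ofReal_cos_le k y)
  refine this.congr fun x => integral_congr_ae (Eventually.of_forall fun k => ?_)
  dsimp only
  ring

lemma exists_norm_regular_le (hV : IsPotential xI V) (h : ℝ) {x : ℝ} (hx : 0 ≤ x) :
    ∃ M, ∀ k : ℝ, ‖(sol V 1 (-h) k x).1‖ ≤ M := by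
  obtain ⟨C, K, hC, hK, hr⟩ := regular_asymptotics hV h hx
  have hc : Continuous fun k : ℝ => (sol V 1 (-h) k x).1 :=
    (differentiable_sol hV 1 (-h) hx).1.continuous.comp Complex.continuous_ofReal
  obtain ⟨M, hM⟩ := (isCompact_Icc (a := -K) (b := K)).exists_bound_of_continuousOn hc.continuousOn
  refine ⟨max M (1 + |diagValue V h x| + C), fun k => ?_⟩
  rcases le_or_gt |k| K with hk | hk
  · exact (hM k (abs_le.mp hk)).trans (le_max_left _ _)
  · refine le_trans ?_ (le_max_right _ _)
    have hk1 : 1 ≤ |k| := hK.trans hk.le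
    have h1 := hr k (by simp) (by simpa using hk.le)
    simp only [Complex.ofReal_im, zero_mul, Real.exp_zero, mul_one, Complex.norm_real,
      Real.norm_eq_abs] at h1
    have h2 : C / |k| ^ 2 ≤ C := div_le_self hC (one_le_pow₀ hk1)
    have h3 : ‖diagValue V h x * (Complex.sin (k * x) / k)‖ ≤ |diagValue V h x| := by
      rw [norm_mul, norm_div, Complex.norm_real, Complex.norm_real, Real.norm_eq_abs,
        Real.norm_eq_abs, ← Complex.ofReal_mul, ← Complex.ofReal_sin, Complex.norm_real]
      refine mul_le_of_le_one_right (abs_nonneg _) ?_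
      rw [div_le_one (by linarith)]
      exact (Real.abs_sin_le_one _).trans hk1
    have h4 := norm_ofReal_cos_le k x
    have e : (sol V 1 (-h) k x).1 = Complex.cos (k * x) -
        diagValue V h x * (Complex.sin (k * x) / k) -
        (Complex.cos (k * x) - diagValue V h x * (Complex.sin (k * x) / k) -
          (sol V 1 (-h) k x).1) := by ring
    rw [e]
    exact (norm_sub_le _ _).trans (add_le_add ((norm_sub_le _ _).trans (add_le_add h4 h3))
      (h1.trans h2))

lemma KIntegrand_pv (hV : IsPotential xI V) (hxI : 0 < xI) (h : ℝ) {x : ℝ} (hx : 0 ≤ x) (y : ℝ) :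
    PVConverges (KIntegrand V xI h x y) ∧
      Tendsto (fun R : ℝ => ∫ k in (-R)..R, KIntegrand V xI h x y k) atTop
        (𝓝 (∫ k : ℝ, specDensity V xI h k * ((sol V 1 (-h) k x).1 * Complex.cos (k * y)))) ∧
      pvIntegral (KIntegrand V xI h x y) =
        ∫ k : ℝ, specDensity V xI h k * ((sol V 1 (-h) k x).1 * Complex.cos (k * y)) := by
  obtain ⟨M, hM⟩ := exists_norm_regular_le hV h hx
  have hc : Continuous fun k : ℝ => (sol V 1 (-h) k x).1 :=
    (differentiable_sol hV 1 (-h) hx).1.continuous.comp Complex.continuous_ofReal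
  exact pv_mul_jFun hV hxI h (F := KIntegrand V xI h x y)
    (ψ := fun k : ℝ => (sol V 1 (-h) k x).1 * Complex.cos (k * y))
    (fun k => by rw [KIntegrand, regular_eq hV h k hx]; ring) (hc.mul (by fun_prop))
    (fun k => by simp [sol_neg]) (M := M * 1)
    (fun k => by
      rw [norm_mul]
      have := (norm_nonneg _).trans (hM 0)
      gcongr
      · exact hM k
      · exact norm_ofReal_cos_le _ _)

lemma KKernel_eq (hV : IsPotential xI V) (hxI : 0 < xI) (h : ℝ) {x : ℝ} (hx : 0 ≤ x) (y : ℝ) :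
    KKernel V xI h x y = Complex.I / Real.pi *
      (∫ k : ℝ, specDensity V xI h k * ((sol V 1 (-h) k x).1 * Complex.cos (k * y))) +
      ∑ t ∈ eigenFinset hV hxI h,
        (sol V 1 (-h) t x).1 * normConst V xI h t * Complex.cos (t * y) := by
  rw [KKernel, (KIntegrand_pv hV hxI h hx y).2.2,
    finsum_mem_eq_finite_toFinset_sum _ (finite_eigenvalues hV hxI h)]
  simp only [regular_eq hV h _ hx]
  rfl

lemma continuous_KKernel (hV : IsPotential xI V) (hxI : 0 < xI) (h : ℝ) {x : ℝ} (hx : 0 ≤ x) :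
    Continuous fun y => KKernel V xI h x y := by
  simp only [KKernel_eq hV hxI h hx]
  obtain ⟨M, hM⟩ := exists_norm_regular_le hV h hx
  have hc : Continuous fun k : ℝ => (sol V 1 (-h) k x).1 :=
    (differentiable_sol hV 1 (-h) hx).1.continuous.comp Complex.continuous_ofReal
  exact (continuous_const.mul (continuous_integral_specDensity_mul_cos hV hxI h hc hM)).add
    (by fun_prop)

lemma KKernel_neg (hV : IsPotential xI V) (hxI : 0 < xI) (h : ℝ) {x : ℝ} (hx : 0 ≤ x) (y : ℝ) :
    KKernel V xI h x (-y) = KKernel V xI h x y := by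
  simp [KKernel_eq hV hxI h hx]

lemma gKernel_neg (hV : IsPotential xI V) (hxI : 0 < xI) (h x y : ℝ) :
    gKernel V xI h (-x) y = gKernel V xI h x y := by
  simp [gKernel_eq hV hxI h]

end Spectral

/-! ### Entire functions given by integrals, and Dirichlet's integral -/

section EntireIntegrals

lemma differentiable_integral_of_hasDerivAt {e e' : ℂ → ℝ → ℂ}
    (h : ∀ k t, HasDerivAt (fun k => e k t) (e' k t) k)
    (he : Continuous (Function.uncurry e)) (he' : Continuous (Function.uncurry e')) {a : ℝ}
    (ha : 0 ≤ a) : Differentiable ℂ fun k => ∫ t in (0 : ℝ)..a, e k t := by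
  intro k
  have hK : IsCompact (Metric.closedBall k 1 ×ˢ Icc (0 : ℝ) a) :=
    (isCompact_closedBall k 1).prod isCompact_Icc
  obtain ⟨M, hM⟩ := hK.exists_bound_of_continuousOn he'.continuousOn
  have hc : ∀ k, Continuous (e k) := fun k => he.comp (by fun_prop : Continuous fun t => (k, t))
  have hc' : ∀ k, Continuous (e' k) := fun k => he'.comp (by fun_prop : Continuous fun t => (k, t))
  refine (intervalIntegral.hasDerivAt_integral_of_dominated_loc_of_deriv_le
    (F := e) (F' := e') (bound := fun _ => M)
    (Metric.ball_mem_nhds k one_pos) (Eventually.of_forall fun k => (hc k).aestronglyMeasurable)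
    ((hc k).intervalIntegrable _ _) ((hc' k).aestronglyMeasurable)
    (Eventually.of_forall fun t ht z hz => ?_) (by simp)
    (Eventually.of_forall fun t ht z hz => h z t)).2.differentiableAt
  rw [uIoc_of_le ha] at ht
  exact hM (z, t) ⟨Metric.ball_subset_closedBall hz, ht.1.le, ht.2⟩

lemma differentiable_integral_mul_cos {κ : ℝ → ℂ} (hκ : Continuous κ) {a : ℝ} (ha : 0 ≤ a) :
    Differentiable ℂ fun k : ℂ => ∫ t in (0 : ℝ)..a, κ t * Complex.cos (k * t) := by
  refine differentiable_integral_of_hasDerivAt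
    (e := fun k t => κ t * Complex.cos (k * t)) (e' := fun k t => κ t * (-Complex.sin (k * t) * t))
    (fun k t => ?_) (by unfold Function.uncurry; fun_prop) (by unfold Function.uncurry; fun_prop) ha
  have h1 : HasDerivAt (fun k : ℂ => k * (t : ℂ)) (t : ℂ) k := by
    simpa using (hasDerivAt_id k).mul_const (t : ℂ)
  exact (h1.ccos).const_mul _

lemma differentiable_integral_cexp {a : ℝ} (ha : 0 ≤ a) :
    Differentiable ℂ fun k : ℂ => ∫ t in (0 : ℝ)..a, Complex.exp (Complex.I * k * t) := by
  refine differentiable_integral_of_hasDerivAt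
    (e := fun k t => Complex.exp (Complex.I * k * t))
    (e' := fun k t => Complex.exp (Complex.I * k * t) * (Complex.I * t))
    (fun k t => ?_) (by unfold Function.uncurry; fun_prop) (by unfold Function.uncurry; fun_prop) ha
  have h1 : HasDerivAt (fun k : ℂ => Complex.I * k * (t : ℂ)) (Complex.I * t) k := by
    simpa using ((hasDerivAt_id k).const_mul Complex.I).mul_const (t : ℂ)
  exact h1.cexp

/-- The entire function `sin(a k) / k`. -/
def sinQuot (a : ℝ) (k : ℂ) : ℂ := ∫ t in (0 : ℝ)..a, Complex.cos (k * t)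

lemma differentiable_sinQuot {a : ℝ} (ha : 0 ≤ a) : Differentiable ℂ (sinQuot a) := by
  have := differentiable_integral_mul_cos (κ := fun _ => 1) continuous_const ha
  simp only [one_mul] at this
  exact this

lemma sinQuot_mul (a : ℝ) (k : ℂ) : k * sinQuot a k = Complex.sin (k * a) := by
  rw [sinQuot, ← intervalIntegral.integral_const_mul,
    intervalIntegral.integral_eq_sub_of_hasDerivAt (f := fun t : ℝ => Complex.sin (k * t))
    (fun t _ => ?_) (Continuous.intervalIntegrable (by fun_prop) _ _)]
  · simp
  · have h0 : HasDerivAt (fun t : ℝ => k * (t : ℂ)) k t := by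
      simpa using (Complex.ofRealCLM.hasDerivAt (x := t)).const_mul k
    exact ((Complex.hasDerivAt_sin (k * t)).comp t h0).congr_deriv (mul_comm _ _)

lemma sinQuot_eq {a : ℝ} {k : ℂ} (hk : k ≠ 0) : sinQuot a k = Complex.sin (k * a) / k := by
  rw [eq_div_iff hk, mul_comm, sinQuot_mul]

lemma sinQuot_neg (a : ℝ) (k : ℂ) : sinQuot a (-k) = sinQuot a k := by
  simp [sinQuot]

lemma integral_cexp_mul (a : ℝ) (k : ℂ) :
    Complex.I * k * ∫ t in (0 : ℝ)..a, Complex.exp (Complex.I * k * t) =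
      Complex.exp (Complex.I * k * a) - 1 := by
  rw [← intervalIntegral.integral_const_mul,
    intervalIntegral.integral_eq_sub_of_hasDerivAt (fun t _ => hasDerivAt_cexp_I_mul k t)
    (Continuous.intervalIntegrable (by fun_prop) _ _)]
  simp

lemma add_I_ne_zero {z : ℂ} (hz : 0 ≤ z.im) : z + Complex.I ≠ 0 := fun h => by
  have := congrArg Complex.im h
  simp at this
  linarith

lemma norm_le_norm_add_I {z : ℂ} (hz : 0 ≤ z.im) : ‖z‖ ≤ ‖z + Complex.I‖ := by
  rw [← sq_le_sq₀ (norm_nonneg _) (norm_nonneg _), Complex.sq_norm, Complex.sq_norm,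
    Complex.normSq_apply, Complex.normSq_apply]
  simp
  nlinarith

lemma integral_inv_one_add_sq_complex :
    Tendsto (fun R : ℝ => ∫ k in (-R)..R, (((1 + k ^ 2)⁻¹ : ℝ) : ℂ)) atTop (𝓝 Real.pi) := by
  have := tendsto_integral_neg_self (f := fun k : ℝ => (((1 + k ^ 2)⁻¹ : ℝ) : ℂ))
    integrable_inv_one_add_sq.ofReal
  rwa [integral_complex_ofReal, integral_univ_inv_one_add_sq] at this

lemma inv_add_I_add (k : ℝ) : 1 / ((k : ℂ) + Complex.I) + 1 / ((-k : ℝ) + Complex.I : ℂ) =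
    -2 * Complex.I * (((1 + k ^ 2)⁻¹ : ℝ) : ℂ) := by
  have h1 : (k : ℂ) + Complex.I ≠ 0 := add_I_ne_zero (by simp)
  have h2 : ((-k : ℝ) : ℂ) + Complex.I ≠ 0 := add_I_ne_zero (by simp)
  have h3 : (1 + k ^ 2 : ℂ) ≠ 0 := by
    have : (1 + k ^ 2 : ℝ) ≠ 0 := by positivity
    exact_mod_cast this
  push_cast at h2 ⊢
  field_simp
  linear_combination (2 * Complex.I) * Complex.I_sq

/-- Dirichlet's integral. -/
lemma tendsto_integral_sinQuot {a : ℝ} (ha : 0 < a) :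
    Tendsto (fun R : ℝ => ∫ k in (-R)..R, sinQuot a k) atTop (𝓝 Real.pi) := by
  set Q : ℂ → ℂ := fun z => ∫ t in (0 : ℝ)..a, Complex.exp (Complex.I * z * t)
  have hQ : Differentiable ℂ Q := differentiable_integral_cexp ha.le
  -- The function (e^{iza} − 1)/z is entire; adding 1/(z + i), whose pole is in the lower
  -- half-plane, cancels −1/z to second order. The integral therefore tends to 0, while its
  -- symmetrization is i(sin(ak)/k − 1/(1+k²)), so the limit equals ∫ dk/(1+k²) = π.
  have hlim := tendsto_integral_of_residues (F := fun z => Complex.I * Q z + 1 / (z + Complex.I))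
    (T := ∅) (ρ := 0) (a := a) (C₁ := 1) (C₂ := 1) (K := 1) (by simp) (by simp)
    (fun z hz _ => (analyticAt_const.mul (hQ.analyticAt z)).add (analyticAt_const.div
      (analyticAt_id.add analyticAt_const) (add_I_ne_zero hz))) (by simp) ha zero_le_one zero_le_one
    (fun z hz hz1 => by
      have hzn : 0 < ‖z‖ := by linarith
      have hz0 : z ≠ 0 := norm_pos_iff.mp hzn
      have e : Complex.I * Q z + 1 / (z + Complex.I) = Complex.exp (Complex.I * z * a) / z -
          Complex.I / (z * (z + Complex.I)) := by
        have h1 := integral_cexp_mul a z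
        have h2 := add_I_ne_zero hz
        have h3 : Complex.I * Q z = (Complex.exp (Complex.I * z * a) - 1) / z := by
          rw [eq_div_iff hz0, ← h1]
          ring
        rw [h3]
        field_simp
        ring
      rw [e]
      refine (norm_sub_le _ _).trans (add_le_add (le_of_eq ?_) ?_)
      · rw [norm_div, norm_cexp_I_mul, div_mul_eq_mul_div, one_mul]
        congr 2
        ring
      · rw [norm_div, norm_mul, Complex.norm_I, pow_two]
        gcongr
        exact norm_le_norm_add_I hz)
  simp only [Finset.sum_empty, mul_zero] at hlim
  have hQc : Continuous fun k : ℝ => Q k := hQ.continuous.comp Complex.continuous_ofReal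
  have hinvc : Continuous fun k : ℝ => 1 / ((k : ℂ) + Complex.I) :=
    Continuous.div (by fun_prop) (by fun_prop) fun k => add_I_ne_zero (by simp)
  have hsc : Continuous fun k : ℝ => sinQuot a k :=
    (differentiable_sinQuot ha.le).continuous.comp Complex.continuous_ofReal
  have hic : Continuous fun k : ℝ => (((1 + k ^ 2)⁻¹ : ℝ) : ℂ) :=
    Complex.continuous_ofReal.comp (Continuous.inv₀ (by fun_prop) fun k => by positivity)
  have hsym : ∀ k : ℂ, Q k + Q (-k) = 2 * sinQuot a k := fun k => by
    simp only [Q, sinQuot]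
    rw [← intervalIntegral.integral_add (Continuous.intervalIntegrable (by fun_prop) _ _)
      (Continuous.intervalIntegrable (by fun_prop) _ _), ← intervalIntegral.integral_const_mul]
    refine intervalIntegral.integral_congr fun t _ => ?_
    rw [Complex.cos]
    have e1 : Complex.I * k * t = k * t * Complex.I := by ring
    have e2 : Complex.I * -k * t = -(k * t) * Complex.I := by ring
    rw [e1, e2]
    ring
  have hval : ∀ R : ℝ, ∫ k in (-R)..R, (Complex.I * Q k + 1 / (k + Complex.I)) =
      Complex.I * ((∫ k in (-R)..R, sinQuot a k) -
        ∫ k in (-R)..R, (((1 + k ^ 2)⁻¹ : ℝ) : ℂ)) := fun R => by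
    rw [integral_symmetrize (f := fun k : ℝ => Complex.I * Q k + 1 / (k + Complex.I))
      (((continuous_const.mul hQc).add hinvc).intervalIntegrable _ _),
      ← intervalIntegral.integral_sub (hsc.intervalIntegrable _ _) (hic.intervalIntegrable _ _),
      ← intervalIntegral.integral_const_mul, ← intervalIntegral.integral_const_mul]
    refine intervalIntegral.integral_congr fun k _ => ?_
    have h1 := hsym k
    have h2 := inv_add_I_add k
    simp only [Complex.ofReal_neg] at h2 ⊢
    linear_combination (Complex.I / 2) * h1 + 1 / 2 * h2
  simp only [hval] at hlim
  have h := ((hlim.const_mul (-Complex.I))).add integral_inv_one_add_sq_complex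
  rw [mul_zero, zero_add] at h
  refine h.congr fun R => ?_
  linear_combination (-((∫ k in (-R)..R, sinQuot a k) -
        ∫ k in (-R)..R, (((1 + k ^ 2)⁻¹ : ℝ) : ℂ))) * Complex.I_sq

/-- Half the sum of the Dirichlet integrals with parameters x + y and x − y, both positive. -/
lemma tendsto_integral_sinQuot_mul_cos {x y : ℝ} (hy : |y| < x) :
    Tendsto (fun R : ℝ => ∫ k in (-R)..R, sinQuot x k * Complex.cos (k * y)) atTop
      (𝓝 Real.pi) := by
  obtain ⟨h1, h2⟩ := abs_lt.mp hy
  have hc : ∀ a : ℝ, 0 ≤ a → Continuous fun k : ℝ => sinQuot a k := fun a ha =>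
    (differentiable_sinQuot ha).continuous.comp Complex.continuous_ofReal
  have h := ((tendsto_integral_sinQuot (a := x + y) (by linarith)).add
    (tendsto_integral_sinQuot (a := x - y) (by linarith))).const_mul (1 / 2)
  have e : (1 / 2 : ℂ) * (Real.pi + Real.pi) = Real.pi := by ring
  rw [e] at h
  refine h.congr fun R => ?_
  rw [← intervalIntegral.integral_add ((hc _ (by linarith)).intervalIntegrable _ _)
    ((hc _ (by linarith)).intervalIntegrable _ _), ← intervalIntegral.integral_const_mul]
  refine intervalIntegral.integral_congr_ae ?_
  filter_upwards [(countable_singleton (0 : ℝ)).ae_notMem volume] with k hk _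
  have hk0 : (k : ℂ) ≠ 0 := by exact_mod_cast hk
  rw [sinQuot_eq hk0, sinQuot_eq hk0, sinQuot_eq hk0]
  have e1 : (k : ℂ) * ((x + y : ℝ) : ℂ) = k * x + k * y := by
    push_cast
    ring
  have e2 : (k : ℂ) * ((x - y : ℝ) : ℂ) = k * x - k * y := by
    push_cast
    ring
  rw [e1, e2, Complex.sin_add, Complex.sin_sub]
  ring

end EntireIntegrals

/-! ### The cosine transform and its inversion -/

section FourierCos

lemma integral_neg_eq {f : ℝ → ℂ} : ∫ k, f (-k) = ∫ k, f k := integral_neg_eq_self f volume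

lemma integral_mul_cexp_of_even {f : ℝ → ℂ} (hf : Integrable f) (heven : ∀ k, f (-k) = f k)
    (y : ℝ) : ∫ k : ℝ, f k * Complex.exp (Complex.I * k * y) =
      ∫ k : ℝ, f k * Complex.cos (k * y) := by
  have hint : ∀ s : ℂ, s.im = 0 → Integrable fun k : ℝ => f k * Complex.exp (Complex.I * k * s) :=
    fun s hs => hf.mul_bdd (c := 1) (by fun_prop : Continuous fun k : ℝ =>
      Complex.exp (Complex.I * k * s)).aestronglyMeasurable (Eventually.of_forall fun k => by
        rw [Complex.norm_exp]
        simp [hs])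
  have h1 : ∫ k : ℝ, f k * Complex.exp (Complex.I * k * y) =
      ∫ k : ℝ, f k * Complex.exp (Complex.I * k * (-y : ℂ)) := by
    rw [← integral_neg_eq]
    refine integral_congr_ae (Eventually.of_forall fun k => ?_)
    simp only [heven]
    push_cast
    congr 2
    ring
  have h2 : ∫ k : ℝ, f k * Complex.cos (k * y) =
      1 / 2 * ((∫ k : ℝ, f k * Complex.exp (Complex.I * k * y)) +
        ∫ k : ℝ, f k * Complex.exp (Complex.I * k * (-y : ℂ))) := by
    rw [← integral_add (hint y (by simp)) (hint (-y) (by simp)), ← integral_const_mul]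
    refine integral_congr_ae (Eventually.of_forall fun k => ?_)
    simp only
    rw [Complex.cos]
    have e1 : Complex.I * k * y = k * y * Complex.I := by ring
    have e2 : Complex.I * k * (-y : ℂ) = -(k * y) * Complex.I := by ring
    rw [e1, e2]
    ring
  rw [h2, ← h1]
  ring

/-- Cosine transform of an integrable function. -/
def cosTransform (f : ℝ → ℂ) (y : ℝ) : ℂ := 1 / Real.pi * ∫ k : ℝ, f k * Complex.cos (k * y)

lemma cosTransform_neg (f : ℝ → ℂ) (y : ℝ) : cosTransform f (-y) = cosTransform f y := by
  simp [cosTransform]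

lemma continuous_cosTransform {f : ℝ → ℂ} (hf : Integrable f) : Continuous (cosTransform f) := by
  refine continuous_const.mul (continuous_of_dominated (bound := fun k => ‖f k‖)
    (fun y => hf.aestronglyMeasurable.mul (by fun_prop : Continuous fun k : ℝ =>
      Complex.cos (k * y)).aestronglyMeasurable)
    (fun y => Eventually.of_forall fun k => ?_) hf.norm (Eventually.of_forall fun k => by fun_prop))
  rw [norm_mul]
  exact mul_le_of_le_one_right (norm_nonneg _) (norm_ofReal_cos_le k y)

lemma integral_even_interval {f : ℝ → ℂ} (hf : Continuous f) (heven : ∀ t, f (-t) = f t) (x : ℝ) :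
    ∫ t in (-x)..x, f t = 2 * ∫ t in (0 : ℝ)..x, f t := by
  rw [← intervalIntegral.integral_add_adjacent_intervals (b := 0) (hf.intervalIntegrable _ _)
    (hf.intervalIntegrable _ _)]
  have : ∫ t in (-x)..0, f t = ∫ t in (0 : ℝ)..x, f t := by
    have h := intervalIntegral.integral_comp_neg (a := 0) (b := x) f
    simp only [heven, neg_zero] at h
    exact h.symm
  rw [this]
  ring

open scoped FourierTransform in
/-- Inversion of the cosine transform when the transform is compactly supported. -/
lemma eq_integral_cosTransform {f : ℝ → ℂ} (hc : Continuous f) (hf : Integrable f)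
    (heven : ∀ k, f (-k) = f k) {x : ℝ} (hx : 0 ≤ x) (hsupp : ∀ y, x ≤ y → cosTransform f y = 0)
    (k : ℝ) : f k = ∫ t in (0 : ℝ)..x, cosTransform f t * Complex.cos (k * t) := by
  have hpi : (0 : ℝ) < 2 * Real.pi := by positivity
  have hρc := continuous_cosTransform hf
  have hsupp' : ∀ y, x ≤ |y| → cosTransform f y = 0 := fun y hy => by
    rcases abs_choice y with h | h
    · exact hsupp y (h ▸ hy)
    · rw [← cosTransform_neg]
      exact hsupp _ (h ▸ hy)
  -- The Fourier transform is normalized with e^{−2πi v ξ}, hence the rescaling by 2π; evenness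
  -- turns the exponential into a cosine.
  have hF : ∀ ξ, 𝓕 f ξ = Real.pi * cosTransform f (2 * Real.pi * ξ) := fun ξ => by
    rw [Real.fourier_real_eq_integral_exp_smul, ← cosTransform_neg, cosTransform,
      ← integral_mul_cexp_of_even hf heven]
    have : (Real.pi : ℂ) ≠ 0 := by exact_mod_cast Real.pi_ne_zero
    rw [← mul_assoc, mul_one_div_cancel this, one_mul]
    refine integral_congr_ae (Eventually.of_forall fun v => ?_)
    simp only [smul_eq_mul]
    rw [mul_comm]
    congr 2
    push_cast
    ring
  have hρcs : HasCompactSupport (cosTransform f) :=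
    HasCompactSupport.intro (isCompact_Icc (a := -x) (b := x)) fun y hy => hsupp' y (by
      by_contra! h
      exact hy ⟨(abs_lt.mp h).1.le, (abs_lt.mp h).2.le⟩)
  have hρint : Integrable (cosTransform f) := hρc.integrable_of_hasCompactSupport hρcs
  -- Compact support of the transform supplies the integrability that the inversion theorem
  -- requires.
  have hFint : Integrable (𝓕 f) := by
    have : 𝓕 f = fun ξ => Real.pi * cosTransform f (2 * Real.pi * ξ) := funext hF
    rw [this]
    exact (hρint.comp_mul_left' hpi.ne').const_mul _
  have hinv := congrFun (hc.fourierInv_fourier_eq hf hFint) k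
  rw [Real.fourierInv_eq'] at hinv
  have h1 : ∫ v : ℝ, Complex.exp ((2 * Real.pi * inner ℝ v k : ℝ) * Complex.I) • 𝓕 f v =
      ∫ v : ℝ, (fun t : ℝ => Real.pi * (cosTransform f t * Complex.exp (Complex.I * t * k)))
        (2 * Real.pi * v) := by
    refine integral_congr_ae (Eventually.of_forall fun v => ?_)
    simp only [hF, smul_eq_mul]
    have : Complex.exp ((2 * Real.pi * inner ℝ v k : ℝ) * Complex.I) =
        Complex.exp (Complex.I * (2 * Real.pi * v : ℝ) * k) := by
      congr 1
      have e : inner ℝ v k = v * k := by simp [mul_comm]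
      rw [e]
      push_cast
      ring
    rw [this]
    ring
  have h3 := Measure.integral_comp_mul_left (fun t : ℝ =>
    Real.pi * (cosTransform f t * Complex.exp (Complex.I * t * k))) (2 * Real.pi)
  rw [h1, h3, integral_const_mul,
    integral_mul_cexp_of_even hρint (cosTransform_neg f)] at hinv
  have h2 : ∫ t : ℝ, cosTransform f t * Complex.cos (t * k) =
      ∫ t in (-x)..x, cosTransform f t * Complex.cos (t * k) := by
    rw [intervalIntegral.integral_of_le (by linarith)]
    refine (setIntegral_eq_integral_of_forall_compl_eq_zero fun t ht => ?_).symm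
    rw [hsupp' t, zero_mul]
    by_contra! h
    exact ht ⟨(abs_lt.mp h).1, (abs_lt.mp h).2.le⟩
  rw [h2, integral_even_interval (by fun_prop) (fun t => by simp [cosTransform_neg])] at hinv
  rw [← hinv, abs_of_pos (by positivity), Complex.real_smul]
  have : (Real.pi : ℂ) ≠ 0 := by exact_mod_cast Real.pi_ne_zero
  push_cast
  field_simp
  simp only [mul_comm (k : ℂ)]

end FourierCos

/-! ### The transformation operator from cos kx to the regular solution -/

section Transformation

variable {xI : ℝ} {V : ℝ → ℝ}

/-- Remainder of the regular solution after its two leading terms. -/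
def regRem (V : ℝ → ℝ) (h x : ℝ) (k : ℂ) : ℂ :=
  Complex.cos (k * x) - diagValue V h x * sinQuot x k - (sol V 1 (-h) k x).1

lemma regRem_neg (V : ℝ → ℝ) (h x : ℝ) (k : ℂ) : regRem V h x (-k) = regRem V h x k := by
  simp [regRem, sinQuot_neg, sol_neg]

lemma differentiable_regRem (hV : IsPotential xI V) (h : ℝ) {x : ℝ} (hx : 0 ≤ x) :
    Differentiable ℂ (regRem V h x) := by
  have h1 := differentiable_sinQuot hx
  have h2 := (differentiable_sol hV 1 (-h) hx).1
  unfold regRem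
  fun_prop

lemma continuous_regRem (hV : IsPotential xI V) (h : ℝ) {x : ℝ} (hx : 0 ≤ x) :
    Continuous fun k : ℝ => regRem V h x k :=
  (differentiable_regRem hV h hx).continuous.comp Complex.continuous_ofReal

lemma exists_regRem_bound (hV : IsPotential xI V) (h : ℝ) {x : ℝ} (hx : 0 ≤ x) :
    ∃ C K, 0 ≤ C ∧ 1 ≤ K ∧ ∀ k : ℂ, 0 ≤ k.im → K ≤ ‖k‖ →
      ‖regRem V h x k‖ ≤ C / ‖k‖ ^ 2 * Real.exp (k.im * x) := by
  obtain ⟨C, K, hC, hK, hr⟩ := regular_asymptotics hV h hx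
  refine ⟨C, K, hC, hK, fun k hk hkK => ?_⟩
  have hk0 : k ≠ 0 := norm_pos_iff.mp (by linarith)
  rw [regRem, sinQuot_eq hk0]
  exact hr k hk hkK

lemma integrable_regRem (hV : IsPotential xI V) (h : ℝ) {x : ℝ} (hx : 0 ≤ x) :
    Integrable fun k : ℝ => regRem V h x k := by
  obtain ⟨C, K, hC, hK, hr⟩ := exists_regRem_bound hV h hx
  have hc := continuous_regRem hV h hx
  obtain ⟨M, hM⟩ := (isCompact_Icc (a := -K) (b := K)).exists_bound_of_continuousOn hc.continuousOn
  obtain ⟨A, -, hA⟩ := exists_le_inv_one_add_sq (f := fun k : ℝ => regRem V h x k) hC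
    (fun k _ hk => hM k (abs_le.mp hk)) (fun k hk _ => by
      simpa using hr k (by simp) (by simpa using hk)) hK
  refine (integrable_inv_one_add_sq.const_mul A).mono' hc.aestronglyMeasurable ?_
  filter_upwards [(countable_singleton (0 : ℝ)).ae_notMem volume] with k hk
  exact hA k hk

/-- A Paley–Wiener argument: the remainder is entire and O(e^{x Im k}/|k|²), so for y ≥ x its
product with e^{iky} is O(1/|k|²) in the upper half-plane and the contour closes without residues.
The second-order decay admits y = x, which fixes the kernel on the diagonal. -/
lemma cosTransform_regRem_eq_zero (hV : IsPotential xI V) (h : ℝ) {x : ℝ} (hx : 0 ≤ x) {y : ℝ}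
    (hy : x ≤ y) : cosTransform (fun k : ℝ => regRem V h x k) y = 0 := by
  obtain ⟨C, K, hC, hK, hr⟩ := exists_regRem_bound hV h hx
  have hd := differentiable_regRem hV h hx
  have hint := integrable_regRem hV h hx
  have hlim := tendsto_integral_of_residues
    (F := fun z => regRem V h x z * Complex.exp (Complex.I * z * y))
    (T := ∅) (ρ := 0) (a := 1) (C₁ := 0) (C₂ := C) (K := K) (by simp) (by simp)
    (fun z _ _ => by
      have : Differentiable ℂ fun z => regRem V h x z * Complex.exp (Complex.I * z * y) := by
        fun_prop
      exact this.analyticAt z) (by simp) one_pos le_rfl hC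
    (fun z hz hzK => by
      have hz1 : 0 < ‖z‖ := by linarith
      rw [zero_div, zero_mul, zero_add, norm_mul, norm_cexp_I_mul]
      calc _ ≤ C / ‖z‖ ^ 2 * Real.exp (z.im * x) * Real.exp (-(z.im * y)) := by
            gcongr
            exact hr z hz hzK
        _ = C / ‖z‖ ^ 2 * Real.exp (-(z.im * (y - x))) := by
            rw [mul_assoc, ← Real.exp_add]
            congr 2
            ring
        _ ≤ C / ‖z‖ ^ 2 * 1 := by
            gcongr
            rw [Real.exp_le_one_iff]
            have := mul_nonneg hz (sub_nonneg.mpr hy)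
            linarith
        _ = _ := mul_one _)
  have hint2 : Integrable fun k : ℝ => regRem V h x k * Complex.exp (Complex.I * k * y) :=
    hint.mul_bdd (c := 1) (by fun_prop : Continuous fun k : ℝ =>
      Complex.exp (Complex.I * k * y)).aestronglyMeasurable (Eventually.of_forall fun k => by
        rw [norm_cexp_I_mul]
        simp)
  have h0 := tendsto_nhds_unique (tendsto_integral_neg_self hint2) hlim
  rw [integral_mul_cexp_of_even hint fun k => by rw [Complex.ofReal_neg, regRem_neg]] at h0
  rw [cosTransform, h0]
  simp

/-- The kernel of the transformation operator from `cos(k x)` to the regular solution. -/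
def transKernel (V : ℝ → ℝ) (h x y : ℝ) : ℂ :=
  diagValue V h x + cosTransform (fun k : ℝ => regRem V h x k) y

lemma continuous_transKernel (hV : IsPotential xI V) (h : ℝ) {x : ℝ} (hx : 0 ≤ x) :
    Continuous (transKernel V h x) :=
  continuous_const.add (continuous_cosTransform (integrable_regRem hV h hx))

lemma transKernel_self (hV : IsPotential xI V) (h : ℝ) {x : ℝ} (hx : 0 ≤ x) :
    transKernel V h x x = diagValue V h x := by
  rw [transKernel, cosTransform_regRem_eq_zero hV h hx le_rfl, add_zero]

/-- Cosine inversion proves this for real k, and the identity theorem extends it to all k. Complex k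
are needed because the eigenvalues are not real. -/
lemma regRem_eq_integral (hV : IsPotential xI V) (h : ℝ) {x : ℝ} (hx : 0 ≤ x) (k : ℂ) :
    regRem V h x k =
      ∫ t in (0 : ℝ)..x, cosTransform (fun k : ℝ => regRem V h x k) t * Complex.cos (k * t) := by
  have hint := integrable_regRem hV h hx
  have hreal := eq_integral_cosTransform (continuous_regRem hV h hx) hint
    (fun k => by rw [Complex.ofReal_neg, regRem_neg]) hx
    fun y hy => cosTransform_regRem_eq_zero hV h hx hy
  have hd := differentiable_integral_mul_cos (continuous_cosTransform hint) hx
  refine congrFun (AnalyticOnNhd.eq_of_frequently_eq (z₀ := (0 : ℂ))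
    (fun z _ => (differentiable_regRem hV h hx).analyticAt z) (fun z _ => hd.analyticAt z) ?_) k
  have ht : Tendsto (fun k : ℝ => (k : ℂ)) (𝓝[≠] 0) (𝓝[≠] 0) := by
    refine tendsto_nhdsWithin_iff.mpr ⟨?_, ?_⟩
    · exact (Complex.continuous_ofReal.tendsto' 0 0 (by simp)).mono_left nhdsWithin_le_nhds
    · filter_upwards [self_mem_nhdsWithin] with k hk
      simpa using hk
  exact ht.frequently (Eventually.frequently (Eventually.of_forall hreal))

/-- The transformation operator. -/
lemma sol_eq_cos_sub_integral (hV : IsPotential xI V) (h : ℝ) {x : ℝ} (hx : 0 ≤ x) (k : ℂ) :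
    (sol V 1 (-h) k x).1 = Complex.cos (k * x) -
      ∫ t in (0 : ℝ)..x, transKernel V h x t * Complex.cos (k * t) := by
  have h1 := regRem_eq_integral hV h hx k
  have hc := continuous_cosTransform (integrable_regRem hV h hx)
  simp only [transKernel, add_mul]
  rw [intervalIntegral.integral_add (Continuous.intervalIntegrable (by fun_prop) _ _)
    (Continuous.intervalIntegrable (by fun_prop) _ _), ← h1, intervalIntegral.integral_const_mul,
    ← sinQuot, regRem]
  ring

end Transformation

/-! ### The spectral kernel K is the transformation kernel, and its diagonal values -/

section Diagonal

variable {xI : ℝ} {V : ℝ → ℝ}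

/-- At an eigenvalue f(x,·) = f(0,·) φ(x,·), so the summand of K is twice the residue of k f(x,k)
cos(ky)/f_h(k). -/
lemma normConst_mul_eq (hV : IsPotential xI V) (hxI : 0 < xI) (h : ℝ) {x : ℝ} (hx : 0 ≤ x) (y : ℝ)
    {t : ℂ} (ht : t ∈ eigenvalues V xI h) :
    (sol V 1 (-h) t x).1 * normConst V xI h t * Complex.cos (t * y) =
      2 * (t * jost V xI x t * Complex.cos (t * y) / deriv (jostFun V xI h) t) := by
  rw [normConst_eq hV hxI h ht, jost_eq_lin_comb hV hxI h t hx, ht.2]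
  ring

/-- After removal of the leading term the integrand is O(e^{−(x−|y|) Im k}/|k|), which lets the
contour close because |y| < x. The residues are half the summands of K, hence πi instead of 2πi. -/
lemma tendsto_integral_jost_mul_cos (hV : IsPotential xI V) (hxI : 0 < xI) (h : ℝ) {x y : ℝ}
    (hy : |y| < x) :
    Tendsto (fun R : ℝ => ∫ k in (-R)..R, (k * jost V xI x k * Complex.cos (k * y) /
      jostFun V xI h k - Complex.exp (Complex.I * k * x) * Complex.cos (k * y) / Complex.I)) atTop
      (𝓝 (Real.pi * Complex.I * ∑ t ∈ eigenFinset hV hxI h,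
        (sol V 1 (-h) t x).1 * normConst V xI h t * Complex.cos (t * y))) := by
  have hx : 0 ≤ x := (abs_nonneg y).trans hy.le
  obtain ⟨C, K, hC, hK, hJ⟩ := jost_asymptotics hV hxI h (le_max_right x xI)
  have hd := differentiable_jost hV hxI hx
  have hlim := tendsto_integral_div_jostFun hV hxI h
    (N := fun z => z * jost V xI x z * Complex.cos (z * y))
    (E := fun z => Complex.exp (Complex.I * z * x) * Complex.cos (z * y) / Complex.I)
    (by fun_prop) (by simp) (fun z _ => by
      have : Differentiable ℂ fun z =>
        Complex.exp (Complex.I * z * x) * Complex.cos (z * y) / Complex.I := by fun_prop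
      exact this.analyticAt z) (a := x - |y|) (C₁ := 4 * C) (C₂ := 0) (K := K) (by linarith)
    (by positivity) le_rfl (fun z hz hzK => by
      obtain ⟨h1, h2, h3, -⟩ := hJ z hz hzK
      have h1 := h1 x ⟨hx, le_max_left _ _⟩
      have hz1 : 0 < ‖z‖ := by linarith
      have hJ0 : jostFun V xI h z ≠ 0 := norm_pos_iff.mp (by linarith)
      have h4 := norm_cos_mul_ofReal_le hz (le_refl |y|)
      -- Two errors are separated: f against e^{izx}, and f_h against iz.
      have e : z * jost V xI x z * Complex.cos (z * y) / jostFun V xI h z -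
          Complex.exp (Complex.I * z * x) * Complex.cos (z * y) / Complex.I =
          (z * (jost V xI x z - Complex.exp (Complex.I * z * x)) / jostFun V xI h z +
            Complex.I * Complex.exp (Complex.I * z * x) *
              (jostFun V xI h z - Complex.I * z) / jostFun V xI h z) * Complex.cos (z * y) := by
        have hI := Complex.I_ne_zero
        generalize Complex.exp (Complex.I * z * x) = w
        generalize Complex.cos (z * y) = c
        field_simp
        linear_combination c * w * (z * Complex.I - jostFun V xI h z) * Complex.I_sq
      have hb1 : ‖z * (jost V xI x z - Complex.exp (Complex.I * z * x)) / jostFun V xI h z‖ ≤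
          2 * C / ‖z‖ * Real.exp (-z.im * x) := by
        rw [norm_div, norm_mul]
        calc _ ≤ ‖z‖ * (C / ‖z‖ * Real.exp (-z.im * x)) / (‖z‖ / 2) := by gcongr
          _ = _ := by field_simp
      have hb2 : ‖Complex.I * Complex.exp (Complex.I * z * x) *
          (jostFun V xI h z - Complex.I * z) / jostFun V xI h z‖ ≤
          2 * C / ‖z‖ * Real.exp (-z.im * x) := by
        rw [norm_div, norm_mul, norm_mul, norm_cexp_I_mul, Complex.norm_I, one_mul]
        calc _ ≤ Real.exp (-(z.im * x)) * C / (‖z‖ / 2) := by gcongr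
          _ = _ := by
            rw [neg_mul]
            field_simp
      rw [e, norm_mul, zero_div, add_zero]
      calc _ ≤ (2 * C / ‖z‖ * Real.exp (-z.im * x) + 2 * C / ‖z‖ * Real.exp (-z.im * x)) *
            Real.exp (z.im * |y|) := by
            gcongr
            exact (norm_add_le _ _).trans (add_le_add hb1 hb2)
        _ = 4 * C / ‖z‖ * (Real.exp (-z.im * x) * Real.exp (z.im * |y|)) := by ring
        _ = _ := by
            rw [← Real.exp_add]
            congr 2
            ring)
  convert hlim using 2
  rw [Finset.mul_sum, Finset.mul_sum]
  refine Finset.sum_congr rfl fun t ht => ?_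
  rw [normConst_mul_eq hV hxI h hx y ((finite_eigenvalues hV hxI h).mem_toFinset.mp ht)]
  ring

/-- Eliminate f(0,k) φ by means of f = f(0) φ + f_h θ, with θ the solution of data (0,1), and write
e^{ikx} = cos kx + i sin kx. What remains is a part for the contour, the quantity (cos kx − φ)/i
times cos ky, and an odd part. -/
lemma KIntegrand_decomp (hV : IsPotential xI V) (hxI : 0 < xI) (h : ℝ) {x : ℝ} (hx : 0 ≤ x) (y : ℝ)
    {k : ℝ} (hk : k ≠ 0) :
    KIntegrand V xI h x y k = (k * jost V xI x k * Complex.cos (k * y) / jostFun V xI h k -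
        Complex.exp (Complex.I * k * x) * Complex.cos (k * y) / Complex.I) +
      1 / Complex.I * (diagValue V h x * (sinQuot x k * Complex.cos (k * y)) +
        regRem V h x k * Complex.cos (k * y)) +
      (Complex.sin (k * x) - k * (sol V 0 1 k x).1) * Complex.cos (k * y) := by
  have hne : jostFun V xI h k ≠ 0 := jostFun_ne_zero hV hxI h (by simp) (by simpa using hk)
  have e1 : KIntegrand V xI h x y k = (k * jFun (weyl V xI h) k) *
      (sol V 1 (-h) k x).1 * Complex.cos (k * y) := by
    rw [KIntegrand, regular_eq hV h k hx]
    ring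
  have e2 : Complex.exp (Complex.I * k * x) =
      Complex.cos (k * x) + Complex.I * Complex.sin (k * x) := by
    have : Complex.I * k * x = k * x * Complex.I := by ring
    rw [this, Complex.exp_mul_I]
    ring
  rw [e1, mul_jFun_eq hV hxI h hk, jost_eq_lin_comb hV hxI h k hx, e2, regRem]
  have hI := Complex.I_ne_zero
  field_simp
  ring

/-- The contour integral contributes (i/π)(πi) times the eigenvalue sum and cancels that sum.
Dirichlet's integral turns the sin(kx)/k term into the constant `diagValue`, the remainder gives its
cosine transform, and the odd part vanishes. -/
lemma KKernel_eq_transKernel (hV : IsPotential xI V) (hxI : 0 < xI) (h : ℝ) {x y : ℝ}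
    (hy : |y| < x) : KKernel V xI h x y = transKernel V h x y := by
  have hx : 0 ≤ x := (abs_nonneg y).trans hy.le
  have hI := Complex.I_ne_zero
  have hpi : (Real.pi : ℂ) ≠ 0 := by exact_mod_cast Real.pi_ne_zero
  set A : ℝ → ℂ := fun k => k * jost V xI x k * Complex.cos (k * y) / jostFun V xI h k -
        Complex.exp (Complex.I * k * x) * Complex.cos (k * y) / Complex.I with hA
  set B : ℝ → ℂ := fun k => sinQuot x k * Complex.cos (k * y) with hB
  set D : ℝ → ℂ := fun k => regRem V h x k * Complex.cos (k * y) with hD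
  set O : ℝ → ℂ := fun k => (Complex.sin (k * x) - k * (sol V 0 1 k x).1) * Complex.cos (k * y)
    with hO
  have hBc : Continuous B := ((differentiable_sinQuot hx).continuous.comp
    Complex.continuous_ofReal).mul (by fun_prop)
  have hDint : Integrable D := (integrable_regRem hV h hx).mul_bdd (c := 1)
    (by fun_prop : Continuous fun k : ℝ => Complex.cos (k * y)).aestronglyMeasurable
    (Eventually.of_forall fun k => norm_ofReal_cos_le k y)
  have hDc : Continuous D := (continuous_regRem hV h hx).mul (by fun_prop)
  have hOc : Continuous O := by
    have : Continuous fun k : ℝ => (sol V 0 1 k x).1 :=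
      (differentiable_sol hV 0 1 hx).1.continuous.comp Complex.continuous_ofReal
    fun_prop
  obtain ⟨⟨hKint, -⟩, hKlim, -⟩ := KIntegrand_pv hV hxI h hx y
  have hdec : ∀ k : ℝ, k ≠ 0 → KIntegrand V xI h x y k =
      A k + 1 / Complex.I * (diagValue V h x * B k + D k) + O k :=
    fun k hk => KIntegrand_decomp hV hxI h hx y hk
  have hval : ∀ R : ℝ, ∫ k in (-R)..R, KIntegrand V xI h x y k = (∫ k in (-R)..R, A k) +
      1 / Complex.I * (diagValue V h x * (∫ k in (-R)..R, B k) + ∫ k in (-R)..R, D k) := fun R => by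
    have hrest : Continuous fun k => 1 / Complex.I * (diagValue V h x * B k + D k) + O k := by
      fun_prop
    have hAint : IntervalIntegrable A volume (-R) R := by
      refine ((hKint R).sub (hrest.intervalIntegrable _ _)).congr_ae ?_
      refine ae_restrict_of_ae ?_
      filter_upwards [(countable_singleton (0 : ℝ)).ae_notMem volume] with k hk
      simp only [hdec k hk]
      ring
    have h1 : ∫ k in (-R)..R, KIntegrand V xI h x y k =
        ∫ k in (-R)..R, (A k + 1 / Complex.I * (diagValue V h x * B k + D k) + O k) := by
      refine intervalIntegral.integral_congr_ae ?_
      filter_upwards [(countable_singleton (0 : ℝ)).ae_notMem volume] with k hk _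
      exact hdec k hk
    have hi : ∀ {f : ℝ → ℂ}, Continuous f → IntervalIntegrable f volume (-R) R :=
      fun hf => hf.intervalIntegrable _ _
    rw [h1, intervalIntegral.integral_add (hAint.add (hi (by fun_prop))) (hi hOc),
      intervalIntegral.integral_add hAint (hi (by fun_prop)), intervalIntegral.integral_const_mul,
      intervalIntegral.integral_add (hi (by fun_prop)) (hi hDc), intervalIntegral.integral_const_mul,
      integral_odd_eq_zero (f := O) fun k => by simp only [hO, Complex.ofReal_neg, sol_neg]; simp; ring]
    ring
  have hlim := (tendsto_integral_jost_mul_cos hV hxI h hy).add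
    ((((tendsto_integral_sinQuot_mul_cos hy).const_mul (diagValue V h x : ℂ)).add
      (tendsto_integral_neg_self hDint)).const_mul (1 / Complex.I))
  have huniq := tendsto_nhds_unique hKlim (hlim.congr fun R => (hval R).symm)
  rw [KKernel_eq hV hxI h hx, huniq, transKernel, cosTransform]
  simp only [hD]
  generalize (∑ t ∈ eigenFinset hV hxI h,
    (sol V 1 (-h) t x).1 * normConst V xI h t * Complex.cos (t * y)) = S
  generalize (∫ k : ℝ, regRem V h x k * Complex.cos (k * y)) = r
  field_simp
  linear_combination S * Real.pi * Complex.I_sq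

/-- At x = 0 there is no y with |y| < x from which to take a limit. Instead k f(0)/f_h − 1/i −
h/(k+i) = O(1/k²) is integrated by residues; these cancel the eigenvalue sum, and the even part
−ih/(1+k²) of h/(k+i) produces h. -/
lemma KKernel_zero_zero (hV : IsPotential xI V) (hxI : 0 < xI) (h : ℝ) :
    KKernel V xI h 0 0 = h := by
  obtain ⟨C, K, hC, hK, hJ⟩ := jost_asymptotics hV hxI h le_rfl
  have hd := differentiable_jost_zero hV hxI
  have hpi : (Real.pi : ℂ) ≠ 0 := by exact_mod_cast Real.pi_ne_zero
  have hlim := tendsto_integral_div_jostFun hV hxI h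
    (N := fun z => z * jost V xI 0 z)
    (E := fun z => 1 / Complex.I + h / (z + Complex.I))
    (by fun_prop) (by simp) (fun z hz => analyticAt_const.add (analyticAt_const.div
      (analyticAt_id.add analyticAt_const) (add_I_ne_zero hz)))
    (a := 1) (C₁ := 0) (C₂ := C + |h|) (K := K) one_pos le_rfl (by positivity)
    (fun z hz hzK => by
      have h1 := (hJ z hz hzK).2.2.2
      have hz1 : 0 < ‖z‖ := by linarith
      have hz0 : z ≠ 0 := norm_pos_iff.mp hz1
      have hzI := add_I_ne_zero hz
      have e : z * jost V xI 0 z / jostFun V xI h z - (1 / Complex.I + h / (z + Complex.I)) =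
          (z * jost V xI 0 z / jostFun V xI h z - 1 / Complex.I - h / z) +
            h * Complex.I / (z * (z + Complex.I)) := by
        have : (h : ℂ) / (z + Complex.I) = h / z - h * Complex.I / (z * (z + Complex.I)) := by
          field_simp
          ring
        rw [this]
        ring
      rw [e, zero_div, zero_mul, zero_add, add_div]
      refine (norm_add_le _ _).trans (add_le_add h1 ?_)
      rw [norm_div, norm_mul, norm_mul, Complex.norm_I, mul_one, Complex.norm_real,
        Real.norm_eq_abs, pow_two]
      gcongr
      exact norm_le_norm_add_I hz)
  have hspec := integrable_specDensity hV hxI h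
  have hic : Continuous fun k : ℝ => Complex.I * h * (((1 + k ^ 2)⁻¹ : ℝ) : ℂ) :=
    continuous_const.mul (Complex.continuous_ofReal.comp
      (Continuous.inv₀ (by fun_prop) fun k => by positivity))
  have hval : ∀ R : ℝ, ∫ k in (-R)..R, ((k : ℂ) * jost V xI 0 k / jostFun V xI h k -
      (1 / Complex.I + h / (k + Complex.I))) = (∫ k in (-R)..R, specDensity V xI h k) +
      Complex.I * h * ∫ k in (-R)..R, (((1 + k ^ 2)⁻¹ : ℝ) : ℂ) := fun R => by
    rw [← intervalIntegral.integral_const_mul, ← intervalIntegral.integral_add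
      hspec.intervalIntegrable (hic.intervalIntegrable _ _)]
    refine intervalIntegral.integral_congr_ae ?_
    filter_upwards [(countable_singleton (0 : ℝ)).ae_notMem volume] with k hk _
    rw [specDensity, mul_jFun_eq hV hxI h hk]
    have hkI : (k : ℂ) + Complex.I ≠ 0 := add_I_ne_zero (by simp)
    have hk2 : (1 + k ^ 2 : ℂ) ≠ 0 := by
      have : (1 + k ^ 2 : ℝ) ≠ 0 := by positivity
      exact_mod_cast this
    have : (h : ℂ) / (k + Complex.I) = h * k / (1 + k ^ 2) - Complex.I * h * (1 + (k : ℂ) ^ 2)⁻¹ := by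
      field_simp
      linear_combination (h : ℂ) * Complex.I_sq
    rw [this]
    push_cast
    ring
  have hlim2 := (tendsto_integral_neg_self hspec).add
    (integral_inv_one_add_sq_complex.const_mul (Complex.I * h))
  have huniq := tendsto_nhds_unique (hlim2.congr fun R => (hval R).symm) hlim
  have hsum : ∑ t ∈ eigenFinset hV hxI h, normConst V xI h t =
      2 * ∑ t ∈ (finite_eigenvalues hV hxI h).toFinset,
        t * jost V xI 0 t / deriv (jostFun V xI h) t := by
    rw [Finset.mul_sum]
    refine Finset.sum_congr rfl fun t ht => ?_
    rw [normConst_eq hV hxI h ((finite_eigenvalues hV hxI h).mem_toFinset.mp ht)]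
    ring
  rw [KKernel_eq hV hxI h le_rfl]
  simp only [sol_zero hV, Complex.ofReal_zero, mul_zero, Complex.cos_zero, mul_one, one_mul, hsum]
  have e : ∫ k, specDensity V xI h k = 2 * Real.pi * Complex.I *
      (∑ t ∈ (finite_eigenvalues hV hxI h).toFinset,
        t * jost V xI 0 t / deriv (jostFun V xI h) t) - Complex.I * h * Real.pi := by
    linear_combination huniq
  rw [e]
  field_simp
  linear_combination (2 * (∑ t ∈ (finite_eigenvalues hV hxI h).toFinset,
        t * jost V xI 0 t / deriv (jostFun V xI h) t) - h) * Complex.I_sq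

/-- For x > 0 both kernels are continuous in y, so their equality for |y| < x passes to the limit y
↑ x. -/
lemma KKernel_self (hV : IsPotential xI V) (hxI : 0 < xI) (h : ℝ) {x : ℝ} (hx : 0 ≤ x) :
    KKernel V xI h x x = diagValue V h x := by
  rcases hx.eq_or_lt with rfl | hx0
  · rw [KKernel_zero_zero hV hxI h]
    simp [diagValue]
  · rw [← transKernel_self hV h hx]
    have h1 := ((continuous_KKernel hV hxI h hx).tendsto x).mono_left
      (nhdsWithin_le_nhds (s := Iio x))
    have h2 := ((continuous_transKernel hV h hx).tendsto x).mono_left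
      (nhdsWithin_le_nhds (s := Iio x))
    refine tendsto_nhds_unique h1 (h2.congr' ?_)
    filter_upwards [Ioo_mem_nhdsLT hx0] with y hy
    exact (KKernel_eq_transKernel hV hxI h (abs_lt.mpr ⟨by linarith [hy.1], hy.2⟩)).symm

lemma hasDerivWithinAt_diagValue (hV : IsPotential xI V) (h : ℝ) {x : ℝ} (hx : 0 ≤ x) :
    HasDerivWithinAt (fun t => (diagValue V h t : ℂ)) ((-(1 / 2) * V x : ℝ) : ℂ) (Ici 0) x := by
  have hc := hV.continuous_max
  have h1 : HasDerivAt (fun u => ∫ t in (0 : ℝ)..u, V (max t 0)) (V (max x 0)) x :=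
    intervalIntegral.integral_hasDerivAt_right (hc.intervalIntegrable _ _)
      hc.stronglyMeasurable.stronglyMeasurableAtFilter hc.continuousAt
  rw [max_eq_left hx] at h1
  have h2 := ((h1.const_mul (1 / 2)).const_sub h).ofReal_comp.hasDerivWithinAt (s := Ici 0)
  have e : ∀ t ∈ Ici (0 : ℝ), (diagValue V h t : ℂ) =
      ((h - 1 / 2 * ∫ s in (0 : ℝ)..t, V (max s 0) : ℝ) : ℂ) := fun t ht => by
    rw [diagValue]
    congr 3
    refine intervalIntegral.integral_congr fun s hs => ?_
    rw [uIcc_of_le ht] at hs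
    simp only [max_eq_left hs.1]
  refine (h2.congr e (e x hx)).congr_deriv ?_
  push_cast
  ring

end Diagonal

/-! ### The Gelfand–Levitan equation -/

section GelfandLevitan

variable {xI : ℝ} {V : ℝ → ℝ}

/-- Insert φ = cos kx − ∫₀ˣ κ cos kt dt, with κ the transformation kernel, into the integral and
into the eigenvalue sum of K, and exchange the order of integration. No relation between x and y
enters. -/
lemma KKernel_eq_gKernel_sub (hV : IsPotential xI V) (hxI : 0 < xI) (h : ℝ) {x : ℝ} (hx : 0 ≤ x)
    (y : ℝ) : KKernel V xI h x y = gKernel V xI h x y -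
      ∫ s in (0 : ℝ)..x, transKernel V h x s * gKernel V xI h s y := by
  have hκ := continuous_transKernel hV h hx
  have hspec := integrable_specDensity hV hxI h
  set P : ℂ → ℂ := fun k => ∫ s in (0 : ℝ)..x, transKernel V h x s * Complex.cos (k * s)
  have hφ : ∀ k, (sol V 1 (-h) k x).1 = Complex.cos (k * x) - P k :=
    sol_eq_cos_sub_integral hV h hx
  have hcos : ∀ s : ℝ, Integrable fun k : ℝ =>
      specDensity V xI h k * (Complex.cos (k * s) * Complex.cos (k * y)) := fun s =>
    integrable_specDensity_mul hV hxI h (M := 1 * 1) (by fun_prop) fun k => by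
      rw [norm_mul]
      gcongr <;> exact norm_ofReal_cos_le _ _
  -- Fubini applies because the regularized density is absolutely integrable and the cosines are
  -- bounded; the original principal value integrand would not allow it directly.
  have hprod : Integrable (Function.uncurry fun (s k : ℝ) => transKernel V h x s *
      (specDensity V xI h k * (Complex.cos (k * s) * Complex.cos (k * y))))
      ((volume.restrict (Ioc 0 x)).prod volume) := by
    have h1 : Integrable (transKernel V h x) (volume.restrict (Ioc 0 x)) :=
      (hκ.intervalIntegrable 0 x).1
    refine ((h1.mul_prod hspec).mul_bdd (c := 1 * 1) (g := fun p : ℝ × ℝ =>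
      Complex.cos (p.2 * p.1) * Complex.cos (p.2 * y)) (by fun_prop : Continuous fun p : ℝ × ℝ =>
      Complex.cos (p.2 * p.1) * Complex.cos (p.2 * y)).aestronglyMeasurable
      (Eventually.of_forall fun p => ?_)).congr (Eventually.of_forall fun p => ?_)
    · rw [norm_mul]
      gcongr <;> exact norm_ofReal_cos_le _ _
    · simp only [Function.uncurry]
      ring
  have hswap : ∫ s in (0 : ℝ)..x, transKernel V h x s * ∫ k, specDensity V xI h k *
      (Complex.cos (k * s) * Complex.cos (k * y)) =
      ∫ k : ℝ, specDensity V xI h k * (P k * Complex.cos (k * y)) := by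
    simp only [← integral_const_mul]
    rw [intervalIntegral.integral_of_le hx, integral_integral_swap hprod]
    refine integral_congr_ae (Eventually.of_forall fun k => ?_)
    simp only [P]
    rw [intervalIntegral.integral_of_le hx, ← integral_mul_const, ← integral_const_mul]
    refine integral_congr_ae (Eventually.of_forall fun s => ?_)
    simp only
    ring
  have hsum : ∫ s in (0 : ℝ)..x, transKernel V h x s * ∑ t ∈ eigenFinset hV hxI h,
        Complex.cos (t * s) * normConst V xI h t * Complex.cos (t * y) =
      ∑ t ∈ eigenFinset hV hxI h, P t * normConst V xI h t * Complex.cos (t * y) := by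
    simp only [Finset.mul_sum]
    rw [intervalIntegral.integral_finsetSum
      fun t _ => Continuous.intervalIntegrable (by fun_prop) _ _]
    refine Finset.sum_congr rfl fun t _ => ?_
    simp only [P]
    rw [← intervalIntegral.integral_mul_const, ← intervalIntegral.integral_mul_const]
    refine intervalIntegral.integral_congr fun s _ => ?_
    ring
  have hPint : Integrable fun k : ℝ => specDensity V xI h k * (P k * Complex.cos (k * y)) := by
    refine (hprod.integral_prod_right).congr (Eventually.of_forall fun k => ?_)
    simp only [P, Function.uncurry]
    rw [intervalIntegral.integral_of_le hx, ← integral_mul_const, ← integral_const_mul]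
    refine integral_congr_ae (Eventually.of_forall fun s => ?_)
    simp only
    ring
  have hG : Continuous fun s : ℝ => ∫ k, specDensity V xI h k *
      (Complex.cos (k * s) * Complex.cos (k * y)) := by
    have := continuous_integral_specDensity_mul_cos hV hxI h
      (ψ := fun k : ℝ => Complex.cos (k * y)) (by fun_prop) fun k => norm_ofReal_cos_le k y
    exact this.congr fun s => by simp only [mul_comm]
  have hI : ∫ s in (0 : ℝ)..x, transKernel V h x s * gKernel V xI h s y =
      Complex.I / Real.pi * (∫ k : ℝ, specDensity V xI h k * (P k * Complex.cos (k * y))) +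
      ∑ t ∈ eigenFinset hV hxI h, P t * normConst V xI h t * Complex.cos (t * y) := by
    rw [← hswap, ← hsum, ← intervalIntegral.integral_const_mul, ← intervalIntegral.integral_add
      (Continuous.intervalIntegrable (by fun_prop) _ _)
      (Continuous.intervalIntegrable (by fun_prop) _ _)]
    refine intervalIntegral.integral_congr fun s _ => ?_
    simp only [gKernel_eq hV hxI]
    ring
  rw [hI, KKernel_eq hV hxI h hx, gKernel_eq hV hxI]
  simp only [hφ, sub_mul, mul_sub, Finset.sum_sub_distrib]
  rw [integral_sub (hcos x) hPint]
  ring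

/-- Both factors are even in s, so the integral is twice that over [0, x], where the kernels agree
except possibly at the single point s = x. -/
lemma integral_KKernel_mul_gKernel (hV : IsPotential xI V) (hxI : 0 < xI) (h : ℝ) {x : ℝ}
    (hx : 0 ≤ x) (y : ℝ) :
    ∫ s in (-x)..x, KKernel V xI h x s * gKernel V xI h s y =
      2 * ∫ s in (0 : ℝ)..x, transKernel V h x s * gKernel V xI h s y := by
  rw [integral_even_interval (f := fun s => KKernel V xI h x s * gKernel V xI h s y) ((continuous_KKernel hV hxI h hx).mul (continuous_gKernel hV hxI h y))
    fun s => by rw [KKernel_neg hV hxI h hx, gKernel_neg hV hxI]]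
  congr 1
  refine intervalIntegral.integral_congr_ae ?_
  filter_upwards [(countable_singleton x).ae_notMem volume] with s hs hs'
  rw [uIoc_of_le hx] at hs'
  rw [KKernel_eq_transKernel hV hxI h
    (abs_lt.mpr ⟨by linarith [hs'.1, hs'.2], lt_of_le_of_ne hs'.2 hs⟩)]

end GelfandLevitan
end LoveProblem
end


theorem mainTheorem3 (xI h : ℝ) (hxI : 0 < xI) (V : ℝ → ℝ) (hV : IsPotential xI V) :
    -- all the objects exist
    (eigenvalues V xI h).Finite ∧
    (∀ x y : ℝ, PVConverges (gIntegrand V xI h x y)) ∧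
    (∀ x y : ℝ, 0 ≤ x → PVConverges (KIntegrand V xI h x y)) ∧
    -- the Gelfand-Levitan equation
    (∀ x y : ℝ, 0 ≤ x → y ≤ x →
      IntervalIntegrable (fun s => KKernel V xI h x s * gKernel V xI h s y) volume (-x) x ∧
      KKernel V xI h x y - gKernel V xI h x y +
        1 / 2 * ∫ s in (-x)..x, KKernel V xI h x s * gKernel V xI h s y = 0) ∧
    -- the potential
    (∀ x : ℝ, 0 ≤ x → ∃ d : ℂ,
      HasDerivWithinAt (fun t => KKernel V xI h t t) d (Ici 0) x ∧ (V x : ℂ) = -2 * d) := by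
  refine ⟨finite_eigenvalues hV hxI h, fun x y => (gIntegrand_pv hV hxI h x y).1,
    fun x y hx => (KIntegrand_pv hV hxI h hx y).1, fun x y hx _ => ⟨?_, ?_⟩, fun x hx => ?_⟩
  · exact ((continuous_KKernel hV hxI h hx).mul
      (continuous_gKernel hV hxI h y)).intervalIntegrable _ _
  · rw [integral_KKernel_mul_gKernel hV hxI h hx, KKernel_eq_gKernel_sub hV hxI h hx]
    ring
  · refine ⟨_, (hasDerivWithinAt_diagValue hV h hx).congr
      (fun t ht => KKernel_self hV hxI h ht) (KKernel_self hV hxI h hx), ?_⟩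
    push_cast
    ring
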